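/- Let $E=(E^0,E^1,r,s)$ be an arbitrary directed graph, $K$ a field and $L=L_K(E)$ the (in general non-unital) Leavitt path algebra, with its $\mathbb Z$-grading ($\deg v=0$, $\deg e=1$, $\deg e^*=-1$). All ideals are two-sided, and the intersection of an empty family of ideals is $L$. Write $u\ge v$ if there is a path (possibly of length $0$) from $u$ to $v$. A set $H\subseteq E^0$ is hereditary if $u\in H$, $u\ge v$ imply $v\in H$; it is saturated if every vertex $v$ that emits a non-empty finite set of edges, all with range in $H$, belongs to $H$. For $H$ hereditary and saturated, $B_H$ is the set of $v\in E^0\setminus H$ that emit infinitely many edges, of which only finitely many but at least one have range outside $H$; for $v\in B_H$ put $v^H=v-\sum_{s(e)=v,\,r(e)\notin H}ee^*$. For $S\subseteq B_H$ let $I(H,S)$ be the ideal generated by $H\cup\{v^H:v\in S\}$, and let $E\setminus(H,S)$ be the quotient graph with vertices $(E^0\setminus H)\cup\{v':v\in B_H\setminus S\}$ and edges $\{e:r(e)\notin H\}\cup\{e':r(e)\in B_H\setminus S\}$, where $s(e')=s(e)$ and $r(e')=r(e)'$. A graph is downward directed if it has a vertex and for all vertices $u,v$ there is a vertex $w$ with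 $u\ge w$ and $v\ge w$. It satisfies Condition (L) if every cycle has an exit. It satisfies the strong countable separation property if there is a countable set $C$ of vertices such that every vertex $u$ satisfies $u\ge v$ for some $v\in C$, and $C$ is contained in every non-empty hereditary saturated set of vertices. The graded part $\mathrm{gr}(P)$ of an ideal $P$ is the ideal generated by the homogeneous elements of $P$. The ideal $P$ is called strongly primitive if $\mathrm{gr}(P)=I(H,S)$ for some hereditary saturated $H$ and $S\subseteq B_H$ such that $E\setminus(H,S)$ is downward directed, satisfies the strong countable separation property and, in case $P$ is a graded ideal, also satisfies Condition (L). Theorem. For a prime ideal $P$ of $L$ the following are equivalent: (a) $P$ is locally closed, i.e. $P$ is not the intersection of all the prime ideals of $L$ properly containing $P$; (b) $P$ is completely irreducible, i.e. $P$ is not the intersection of all the ideals of $L$ properly containing $P$; (c) there is an element $a\in L$ such that $P$ is maximal among the ideals of $L$ that do not contain $a$; (d) $P$ is strongly primitive. -/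

import Mathlib

/-!
A directed graph `E = (E⁰, E¹, r, s)` is a `Quiver` structure on its vertex type `V = E⁰`, with no
restriction on cardinalities. `Quiver.Total V` is the set `E¹` of all edges (`e.left` is the source
`s(e)` and `e.right` the range `r(e)`), `Quiver.Star v` is the set `s⁻¹(v)` of edges emitted by `v`,
and `Quiver.Path u v` is the type of paths from `u` to `v`, those of length zero included.
-/

universe u v w

noncomputable section

namespace LPA

section Graph

variable {V : Type u} [Quiver.{v} V]

/-- `u ≥ v`: there is a path from `u` to `v`. -/
def Reaches (a b : V) : Prop := Nonempty (Quiver.Path a b)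

/-- A regular vertex emits a non-empty finite set of edges. -/
def IsRegular (a : V) : Prop := Nonempty (Quiver.Star a) ∧ Finite (Quiver.Star a)

/-- An infinite emitter emits infinitely many edges. -/
def IsInfiniteEmitter (a : V) : Prop := Infinite (Quiver.Star a)

/-- Hereditary sets of vertices. -/
def IsHereditary (H : Set V) : Prop := ∀ a ∈ H, ∀ b, Reaches a b → b ∈ H

/-- Saturated sets of vertices. -/
def IsSaturated (H : Set V) : Prop :=
  ∀ a : V, IsRegular a → (∀ e : Quiver.Star a, e.1 ∈ H) → a ∈ H

/-- A cycle `e₁ ⋯ eₙ`, `n > 0`: consecutive edges are composable, the last one ends where the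
first one starts, and the sources of the edges are pairwise distinct. -/
def IsCycle (c : List (Quiver.Total V)) : Prop :=
  c.IsChain (fun e f => e.right = f.left) ∧
    (∃ h : c ≠ [], (c.getLast h).right = (c.head h).left) ∧
    (c.map Quiver.Total.left).Nodup

/-- An exit of `e₁ ⋯ eₙ` is an edge `f` with `s(f) = s(eᵢ)` and `f ≠ eᵢ` for some `i`. -/
def HasExit (c : List (Quiver.Total V)) : Prop :=
  ∃ f : Quiver.Total V, ∃ e ∈ c, f.left = e.left ∧ f ≠ e

variable (V) in
/-- Condition (L): every cycle has an exit. -/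
def ConditionL : Prop := ∀ c : List (Quiver.Total V), IsCycle c → HasExit c

variable (V) in
/-- The vertex set is (non-empty and) downward directed. -/
def DownwardDirected : Prop :=
  Nonempty V ∧ ∀ a b : V, ∃ c : V, Reaches a c ∧ Reaches b c

/-- The countable separation property with respect to the set `S` of vertices. -/
def CSPWith (S : Set V) : Prop := S.Countable ∧ ∀ a : V, ∃ b ∈ S, Reaches a b

variable (V) in
/-- The strong countable separation property: the countable separation property holds with respect
to a countable set which is contained in every non-empty hereditary saturated set of vertices. -/
def StrongCSP : Prop :=
  ∃ S : Set V, CSPWith S ∧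
    ∀ H : Set V, H.Nonempty → IsHereditary H → IsSaturated H → S ⊆ H

/-- The set `B_H` of breaking vertices of `H`. -/
def breaking (H : Set V) : Set V :=
  {a | a ∉ H ∧ IsInfiniteEmitter a ∧
    Nonempty {e : Quiver.Star a // e.1 ∉ H} ∧ Finite {e : Quiver.Star a // e.1 ∉ H}}

/-- `(H, S)` is an admissible pair. -/
def IsAdmissible (H S : Set V) : Prop := IsHereditary H ∧ IsSaturated H ∧ S ⊆ breaking H

/-- The vertices of the quotient graph `E \ (H, S)`: the vertices of `E` outside `H` (`Sum.inl`),
and a new vertex `a'` for each `a ∈ B_H \ S` (`Sum.inr`). -/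
def QuotientGraph (H S : Set V) : Type u :=
  {a : V // a ∉ H} ⊕ {a : V // a ∈ breaking H \ S}

/-- The edges of the quotient graph `E \ (H, S)`: each edge of `E` between vertices outside `H`,
and, for each edge `e` of `E` from a vertex outside `H` to a vertex `a ∈ B_H \ S`, a new edge
`e'` from `s(e)` to `a'`. The new vertices are sinks. For hereditary `H` an edge with range
outside `H` has its source outside `H` too. -/
instance (H S : Set V) : Quiver.{v} (QuotientGraph H S) where
  Hom
    | Sum.inl a, Sum.inl b => (a : V) ⟶ (b : V)
    | Sum.inl a, Sum.inr b => (a : V) ⟶ (b : V)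
    | Sum.inr _, _ => PEmpty.{v + 1}

end Graph

section Algebra

variable (K : Type w) [Field K] (V : Type u) [Quiver.{v} V]

/-- The generators of the Leavitt path algebra: the vertices `a`, the edges `e` and the ghost
edges `e*`. -/
inductive Gen : Type (max u v)
  | vertex (a : V) : Gen
  | edge (e : Quiver.Total V) : Gen
  | ghost (e : Quiver.Total V) : Gen

variable {V} in
/-- A generator, in the free unital algebra. -/
abbrev freeGen (g : Gen V) : FreeAlgebra K (Gen V) := FreeAlgebra.ι K g

open Gen in
/-- The defining relations of the Leavitt path algebra. -/
inductive Rel : FreeAlgebra K (Gen V) → FreeAlgebra K (Gen V) → Prop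
  | idem (a : V) : Rel (freeGen K (vertex a) * freeGen K (vertex a)) (freeGen K (vertex a))
  | orth (a b : V) (h : a ≠ b) : Rel (freeGen K (vertex a) * freeGen K (vertex b)) 0
  | source_edge (e : Quiver.Total V) :
      Rel (freeGen K (vertex e.left) * freeGen K (edge e)) (freeGen K (edge e))
  | edge_range (e : Quiver.Total V) :
      Rel (freeGen K (edge e) * freeGen K (vertex e.right)) (freeGen K (edge e))
  | range_ghost (e : Quiver.Total V) :
      Rel (freeGen K (vertex e.right) * freeGen K (ghost e)) (freeGen K (ghost e))
  | ghost_source (e : Quiver.Total V) :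
      Rel (freeGen K (ghost e) * freeGen K (vertex e.left)) (freeGen K (ghost e))
  | ck1_same (e : Quiver.Total V) :
      Rel (freeGen K (ghost e) * freeGen K (edge e)) (freeGen K (vertex e.right))
  | ck1_ne (e f : Quiver.Total V) (h : e ≠ f) :
      Rel (freeGen K (ghost e) * freeGen K (edge f)) 0
  | ck2 (a : V) [Fintype (Quiver.Star a)] [Nonempty (Quiver.Star a)] :
      Rel (freeGen K (vertex a))
        (∑ e : Quiver.Star a,
          freeGen K (edge ⟨a, e.1, e.2⟩) * freeGen K (ghost ⟨a, e.1, e.2⟩))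

/-- A generator, in the unital algebra presented by the relations above. -/
def unitalGen (g : Gen V) : RingQuot (Rel K V) :=
  RingQuot.mkAlgHom K (Rel K V) (freeGen K g)

/-- The Leavitt path algebra `L_K(E)`: the (in general non-unital) associative `K`-algebra
presented by the generators and relations above. The unital algebra with the same presentation is
the unitization of `L_K(E)`, inside which `L_K(E)` is the non-unital subalgebra spanned by the
non-empty words in the generators. -/
def LeavittPathAlgebra : Type (max u v w) :=
  NonUnitalAlgebra.adjoin K (Set.range (unitalGen K V))

instance : NonUnitalRing (LeavittPathAlgebra K V) :=
  inferInstanceAs (NonUnitalRing (NonUnitalAlgebra.adjoin K (Set.range (unitalGen K V))))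

instance : Module K (LeavittPathAlgebra K V) :=
  inferInstanceAs (Module K (NonUnitalAlgebra.adjoin K (Set.range (unitalGen K V))))

instance : IsScalarTower K (LeavittPathAlgebra K V) (LeavittPathAlgebra K V) :=
  inferInstanceAs (IsScalarTower K (NonUnitalAlgebra.adjoin K (Set.range (unitalGen K V)))
    (NonUnitalAlgebra.adjoin K (Set.range (unitalGen K V))))

instance : SMulCommClass K (LeavittPathAlgebra K V) (LeavittPathAlgebra K V) :=
  inferInstanceAs (SMulCommClass K (NonUnitalAlgebra.adjoin K (Set.range (unitalGen K V)))
    (NonUnitalAlgebra.adjoin K (Set.range (unitalGen K V))))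

variable {V}

/-- A generator, in the Leavitt path algebra. -/
def gen (g : Gen V) : LeavittPathAlgebra K V :=
  (⟨unitalGen K V g, NonUnitalAlgebra.subset_adjoin K (Set.mem_range_self g)⟩ :
    NonUnitalAlgebra.adjoin K (Set.range (unitalGen K V)))

/-- The element of the Leavitt path algebra given by a path. -/
def ofPath {a : V} : ∀ {b : V}, Quiver.Path a b → LeavittPathAlgebra K V
  | _, .nil => gen K (.vertex a)
  | _, .cons p e => ofPath p * gen K (.edge ⟨_, _, e⟩)

/-- The element `β*` of the Leavitt path algebra given by a path `β`. -/
def ofGhostPath {a : V} : ∀ {b : V}, Quiver.Path a b → LeavittPathAlgebra K V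
  | _, .nil => gen K (.vertex a)
  | _, .cons p e => gen K (.ghost ⟨_, _, e⟩) * ofGhostPath p

variable (V) in
/-- The homogeneous component `L_n`: the span of the `α β*` with `r(α) = r(β)` and
`|α| - |β| = n`. -/
def component (n : ℤ) : Submodule K (LeavittPathAlgebra K V) :=
  Submodule.span K {x | ∃ (a b c : V) (α : Quiver.Path a c) (β : Quiver.Path b c),
    (α.length : ℤ) - (β.length : ℤ) = n ∧ x = ofPath K α * ofGhostPath K β}

variable {K}

/-- The set of homogeneous elements of an ideal, that is, the union of the `I ∩ L_n`. -/
def homogeneousElements (I : TwoSidedIdeal (LeavittPathAlgebra K V)) :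
    Set (LeavittPathAlgebra K V) :=
  {x | x ∈ I ∧ ∃ n : ℤ, x ∈ component K V n}

/-- A graded ideal: `I` is the sum of the `I ∩ L_n`. -/
def IsGraded (I : TwoSidedIdeal (LeavittPathAlgebra K V)) : Prop :=
  ∀ x ∈ I, x ∈ AddSubgroup.closure (homogeneousElements I)

/-- The graded part `gr(I)` of an ideal: the ideal generated by the homogeneous elements of `I`,
which is the largest graded ideal contained in `I`. -/
def gradedPart (I : TwoSidedIdeal (LeavittPathAlgebra K V)) :
    TwoSidedIdeal (LeavittPathAlgebra K V) :=
  TwoSidedIdeal.span (homogeneousElements I)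

variable (K) in
/-- The element `a^H = a - ∑ e e*`, the sum being over the edges `e` with `s(e) = a` and
`r(e) ∉ H`, which are finite in number when `a ∈ B_H`. -/
def breakingElement (H : Set V) (a : V) : LeavittPathAlgebra K V :=
  gen K (.vertex a) - ∑ᶠ e : {e : Quiver.Star a // e.1 ∉ H},
    gen K (.edge ⟨a, e.1.1, e.1.2⟩) * gen K (.ghost ⟨a, e.1.1, e.1.2⟩)

variable (K) in
/-- The ideal `I(H, S)` generated by `H ∪ {a^H : a ∈ S}`. -/
def admissibleIdeal (H S : Set V) : TwoSidedIdeal (LeavittPathAlgebra K V) :=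
  TwoSidedIdeal.span ((fun a => gen K (.vertex a)) '' H ∪ breakingElement K H '' S)

/-- An ideal `P` with graded part `I(H, S)` is strongly primitive if the quotient graph
`E \ (H, S)` is downward directed, satisfies the strong countable separation property and, in case
`P` is graded, satisfies Condition (L). (For a non-graded prime ideal `P` the quotient graph always
has a cycle without exits, and such a `P` counts as strongly primitive.) -/
def IsStronglyPrimitive (P : TwoSidedIdeal (LeavittPathAlgebra K V)) : Prop :=
  ∃ H S : Set V, IsAdmissible H S ∧ gradedPart P = admissibleIdeal K H S ∧
    DownwardDirected (QuotientGraph H S) ∧ StrongCSP (QuotientGraph H S) ∧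
    (IsGraded P → ConditionL (QuotientGraph H S))

end Algebra

section Ideals

variable {R : Type*} [NonUnitalRing R]

/-- A prime ideal of a (possibly non-unital) ring: a proper two-sided ideal `P` such that
`A B ⊆ P` implies `A ⊆ P` or `B ⊆ P`, for all two-sided ideals `A` and `B`. -/
def IsPrimeIdeal (P : TwoSidedIdeal R) : Prop :=
  P ≠ ⊤ ∧ ∀ A B : TwoSidedIdeal R, (∀ a ∈ A, ∀ b ∈ B, a * b ∈ P) → A ≤ P ∨ B ≤ P

/-- `P` is not the intersection of all the prime ideals properly containing it (the empty
intersection being the whole ring). -/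
def IsLocallyClosed (P : TwoSidedIdeal R) : Prop :=
  P ≠ sInf {Q | IsPrimeIdeal Q ∧ P < Q}

/-- `I` is not the intersection of all the ideals properly containing it. -/
def IsCompletelyIrreducible (I : TwoSidedIdeal R) : Prop :=
  I ≠ sInf {J | I < J}

end Ideals

end LPA

end

/-!
Modulo its graded part `I(H, S)`, a prime ideal `P` becomes an ideal `J` of `L / I(H, S)`, an
algebra generated by a family of elements satisfying the Leavitt relations of the quotient graph,
whose vertices are not in `J`. In such an algebra every non-zero element can be multiplied on both
sides into a vertex, or into a non-zero element of the corner at a vertex `a` of a cycle without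
exits. In the second case the corner consists, up to multiplication by powers of the cycle, of the
polynomials in the cycle.

* If `J ≠ ⊥`, then `J` meets such a corner, and the polynomials of the corner lying in `J` form a
  non-zero prime ideal of `K[X]`, which is maximal. Hence `a` belongs to every ideal properly
  containing `J`. Since all vertices reach `a`, strong separation holds with `{a}`.
* If `J = ⊥`, the ideal `P` is graded. Under Condition (L) every non-zero ideal contains a vertex,
  and the vertices in an ideal form a hereditary saturated set, so strong separation gives a vertex
  common to all non-zero ideals. Conversely, let `y ≠ 0` belong to all non-zero prime ideals. If a
  vertex `a` lies on a cycle without exits, the ideal generated by `y` contains a polynomial `f ≠ 0`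
  in the cycle, and a prime ideal containing `X * f + 1` but not `a` cannot contain `y`; so
  Condition (L) holds. The ideal generated by `y` then contains a vertex `u`, which lies in every
  non-empty hereditary saturated set, and the countably many vertices reached from `u` through
  regular vertices separate.
-/

noncomputable section

namespace LPA

section Walks

variable {F : Type u} [Quiver.{v} F]

/-- The list of edges `l` is a path from `a` to `b`. Lists are used in place of `Quiver.Path` since
cycles are lists of edges, and since subpaths and powers of a path are then sublists and powers. -/
def IsWalk : F → List (Quiver.Total F) → F → Prop
  | a, [], b => a = b
  | a, e :: l, b => e.left = a ∧ IsWalk e.right l b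

theorem isWalk_singleton (e : Quiver.Total F) : IsWalk e.left [e] e.right := ⟨rfl, rfl⟩

theorem isWalk_append {a c : F} {l l' : List (Quiver.Total F)} :
    IsWalk a (l ++ l') c ↔ ∃ b, IsWalk a l b ∧ IsWalk b l' c := by
  induction l generalizing a with
  | nil => simp [IsWalk]
  | cons e l ih => simp [IsWalk, ih, and_assoc]

theorem IsWalk.append {a b c : F} {l l' : List (Quiver.Total F)} (h : IsWalk a l b)
    (h' : IsWalk b l' c) : IsWalk a (l ++ l') c :=
  isWalk_append.2 ⟨b, h, h'⟩

theorem IsWalk.target_unique {a b c : F} {l : List (Quiver.Total F)} (h : IsWalk a l b)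
    (h' : IsWalk a l c) : b = c := by
  induction l generalizing a with
  | nil => exact h.symm.trans h'
  | cons e l ih => exact ih h.2 h'.2

theorem IsWalk.of_append_right {a b c : F} {l l' : List (Quiver.Total F)}
    (h : IsWalk a (l ++ l') c) (hl : IsWalk a l b) : IsWalk b l' c := by
  obtain ⟨b', h₁, h₂⟩ := isWalk_append.1 h
  rwa [hl.target_unique h₁]

theorem Reaches.refl (a : F) : Reaches a a := ⟨.nil⟩

theorem Reaches.trans {a b c : F} (h : Reaches a b) (h' : Reaches b c) : Reaches a c :=
  ⟨h.some.comp h'.some⟩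

theorem Reaches.of_edge (e : Quiver.Total F) : Reaches e.left e.right := ⟨e.hom.toPath⟩

theorem IsWalk.reaches {a b : F} {l : List (Quiver.Total F)} (h : IsWalk a l b) :
    Reaches a b := by
  induction l generalizing a with
  | nil => exact h ▸ Reaches.refl a
  | cons e l ih => exact h.1 ▸ (Reaches.of_edge e).trans (ih h.2)

theorem Reaches.exists_isWalk {a b : F} (h : Reaches a b) : ∃ l, IsWalk a l b := by
  obtain ⟨p⟩ := h
  induction p with
  | nil => exact ⟨[], rfl⟩
  | cons _ e ih =>
    obtain ⟨l, hl⟩ := ih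
    exact ⟨l ++ [⟨_, _, e⟩], hl.append (isWalk_singleton _)⟩

end Walks

section Span

variable {K A : Type*} [CommSemiring K] [NonUnitalNonAssocSemiring A] [Module K A]

theorem mul_mem_of_mem_span [SMulCommClass K A A] {s : Set A} {N : Submodule K A} {c x : A}
    (h : ∀ y ∈ s, c * y ∈ N) (hx : x ∈ Submodule.span K s) : c * x ∈ N :=
  (Submodule.span_le (p := N.comap (LinearMap.mulLeft K c))).2 h hx

theorem mul_mem_of_mem_span' [IsScalarTower K A A] {s : Set A} {N : Submodule K A} {c x : A}
    (h : ∀ y ∈ s, y * c ∈ N) (hx : x ∈ Submodule.span K s) : x * c ∈ N :=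
  (Submodule.span_le (p := N.comap (LinearMap.mulRight K c))).2 h hx

theorem eventually_apply_eq_of_mem_span {ι M : Type*} [AddCommMonoid M] [Module K M]
    {l : Filter ι} {f : ι → M →ₗ[K] M} {s : Set M} (h : ∀ x ∈ s, ∀ᶠ i in l, f i x = x) {x : M}
    (hx : x ∈ Submodule.span K s) : ∀ᶠ i in l, f i x = x := by
  induction hx using Submodule.span_induction with
  | mem x hx => exact h x hx
  | zero => simp
  | add x y _ _ hx hy => filter_upwards [hx, hy] with i hx hy; rw [map_add, hx, hy]
  | smul k x _ hx => filter_upwards [hx] with i hx; rw [map_smul, hx]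

end Span

/-- A family of elements of a (non-unital) algebra `A` indexed by the vertices and edges of a
graph `F`, which satisfies the defining relations of the Leavitt path algebra and generates `A`.
Besides the Leavitt path algebra itself this covers its quotients by the ideals `I(H, S)`, which
are studied by means of such families over the quotient graphs. -/
structure CKFamily (K : Type w) [Field K] (F : Type u) [Quiver.{v} F] (A : Type*)
    [NonUnitalRing A] [Module K A] [IsScalarTower K A A] [SMulCommClass K A A] where
  /-- the images of the vertices -/
  p : F → A
  /-- the images of the edges -/
  s : Quiver.Total F → A
  /-- the images of the ghost edges -/
  t : Quiver.Total F → A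
  p_mul_self : ∀ a, p a * p a = p a
  p_mul_p_of_ne : ∀ a b, a ≠ b → p a * p b = 0
  p_mul_s : ∀ e, p e.left * s e = s e
  s_mul_p : ∀ e, s e * p e.right = s e
  p_mul_t : ∀ e, p e.right * t e = t e
  t_mul_p : ∀ e, t e * p e.left = t e
  t_mul_s_self : ∀ e, t e * s e = p e.right
  t_mul_s_of_ne : ∀ e f, e ≠ f → t e * s f = 0
  finsum_s_mul_t : ∀ a, IsRegular a →
    ∑ᶠ e : Quiver.Star a, s ⟨a, e.1, e.2⟩ * t ⟨a, e.1, e.2⟩ = p a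
  adjoin_eq_top :
    NonUnitalAlgebra.adjoin K (Set.range p ∪ Set.range s ∪ Set.range t) = ⊤

namespace CKFamily

variable {K : Type w} [Field K] {F : Type u} [Quiver.{v} F] {A : Type*}
    [NonUnitalRing A] [Module K A] [IsScalarTower K A A] [SMulCommClass K A A]
    (Φ : CKFamily K F A)

section Paths

theorem p_mul_s_of_ne {a : F} {e : Quiver.Total F} (h : a ≠ e.left) : Φ.p a * Φ.s e = 0 := by
  rw [← Φ.p_mul_s, ← mul_assoc, Φ.p_mul_p_of_ne _ _ h, zero_mul]

theorem t_mul_p_of_ne {a : F} {e : Quiver.Total F} (h : e.left ≠ a) : Φ.t e * Φ.p a = 0 := by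
  rw [← Φ.t_mul_p, mul_assoc, Φ.p_mul_p_of_ne _ _ h, mul_zero]

/-- The product `s e₁ ⋯ s eₙ` for a path `e₁ ⋯ eₙ` ending at `b`. The vertex `b` is an argument
since it is the value for the empty list. -/
def real (l : List (Quiver.Total F)) (b : F) : A := l.foldr (fun e x => Φ.s e * x) (Φ.p b)

/-- The product `t eₙ ⋯ t e₁` for a path `e₁ ⋯ eₙ` ending at `b`. -/
def ghost (l : List (Quiver.Total F)) (b : F) : A := l.foldr (fun e x => x * Φ.t e) (Φ.p b)

theorem real_nil (b : F) : Φ.real [] b = Φ.p b := rfl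

theorem ghost_nil (b : F) : Φ.ghost [] b = Φ.p b := rfl

theorem real_cons (e : Quiver.Total F) (l : List (Quiver.Total F)) (b : F) :
    Φ.real (e :: l) b = Φ.s e * Φ.real l b := rfl

theorem ghost_cons (e : Quiver.Total F) (l : List (Quiver.Total F)) (b : F) :
    Φ.ghost (e :: l) b = Φ.ghost l b * Φ.t e := rfl

variable {a b c : F} {l l' : List (Quiver.Total F)}

theorem p_mul_real (h : IsWalk a l b) : Φ.p a * Φ.real l b = Φ.real l b := by
  cases l with
  | nil => obtain rfl := h; exact Φ.p_mul_self a
  | cons e l => rw [real_cons, ← mul_assoc, ← h.1, Φ.p_mul_s]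

theorem ghost_mul_p (h : IsWalk a l b) : Φ.ghost l b * Φ.p a = Φ.ghost l b := by
  cases l with
  | nil => obtain rfl := h; exact Φ.p_mul_self a
  | cons e l => rw [ghost_cons, mul_assoc, ← h.1, Φ.t_mul_p]

theorem p_mul_real_of_ne (h : IsWalk a l b) (hc : c ≠ a) : Φ.p c * Φ.real l b = 0 := by
  rw [← Φ.p_mul_real h, ← mul_assoc, Φ.p_mul_p_of_ne _ _ hc, zero_mul]

theorem ghost_mul_p_of_ne (h : IsWalk a l b) (hc : a ≠ c) : Φ.ghost l b * Φ.p c = 0 := by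
  rw [← Φ.ghost_mul_p h, mul_assoc, Φ.p_mul_p_of_ne _ _ hc, mul_zero]

theorem real_mul_real (h : IsWalk b l' c) :
    Φ.real l b * Φ.real l' c = Φ.real (l ++ l') c := by
  induction l with
  | nil => exact Φ.p_mul_real h
  | cons e l ih => rw [real_cons, mul_assoc, ih, List.cons_append, real_cons]

theorem ghost_mul_ghost (h : IsWalk b l' c) :
    Φ.ghost l' c * Φ.ghost l b = Φ.ghost (l ++ l') c := by
  induction l with
  | nil => exact Φ.ghost_mul_p h
  | cons e l ih => rw [ghost_cons, ← mul_assoc, ih, List.cons_append, ghost_cons]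

variable (l b) in
theorem real_mul_p : Φ.real l b * Φ.p b = Φ.real l b := by
  simpa only [real_nil, List.append_nil] using Φ.real_mul_real (l := l) (l' := []) (b := b) rfl

variable (l b) in
theorem p_mul_ghost : Φ.p b * Φ.ghost l b = Φ.ghost l b := by
  simpa only [ghost_nil, List.append_nil] using Φ.ghost_mul_ghost (l := l) (l' := []) (b := b) rfl

theorem real_singleton (e : Quiver.Total F) : Φ.real [e] e.right = Φ.s e := Φ.s_mul_p e

theorem ghost_singleton (e : Quiver.Total F) : Φ.ghost [e] e.right = Φ.t e := Φ.p_mul_t e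

theorem real_mul_s (e : Quiver.Total F) :
    Φ.real l e.left * Φ.s e = Φ.real (l ++ [e]) e.right := by
  rw [← real_singleton, Φ.real_mul_real (isWalk_singleton e)]

theorem t_mul_ghost (e : Quiver.Total F) :
    Φ.t e * Φ.ghost l e.left = Φ.ghost (l ++ [e]) e.right := by
  rw [← ghost_singleton, Φ.ghost_mul_ghost (isWalk_singleton e)]

variable {e f : Quiver.Total F}

theorem t_mul_real_cons_self (h : IsWalk a (e :: l) b) :
    Φ.t e * Φ.real (e :: l) b = Φ.real l b := by
  rw [real_cons, ← mul_assoc, Φ.t_mul_s_self, Φ.p_mul_real h.2]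

theorem t_mul_real_cons_of_ne (h : e ≠ f) : Φ.t e * Φ.real (f :: l) b = 0 := by
  rw [real_cons, ← mul_assoc, Φ.t_mul_s_of_ne _ _ h, zero_mul]

theorem ghost_cons_mul_s_self (h : IsWalk a (e :: l) b) :
    Φ.ghost (e :: l) b * Φ.s e = Φ.ghost l b := by
  rw [ghost_cons, mul_assoc, Φ.t_mul_s_self, Φ.ghost_mul_p h.2]

theorem ghost_cons_mul_s_of_ne (h : f ≠ e) : Φ.ghost (f :: l) b * Φ.s e = 0 := by
  rw [ghost_cons, mul_assoc, Φ.t_mul_s_of_ne _ _ h, mul_zero]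

theorem ghost_mul_real_self (h : IsWalk a l b) : Φ.ghost l b * Φ.real l b = Φ.p b := by
  induction l generalizing a with
  | nil => exact Φ.p_mul_self b
  | cons e l ih => rw [ghost_cons, mul_assoc, Φ.t_mul_real_cons_self h, ih h.2]

theorem ghost_mul_real_of_not_prefix {a' : F} (hl : IsWalk a l b) (hl' : IsWalk a' l' c)
    (h : ¬ l <+: l') (h' : ¬ l' <+: l) : Φ.ghost l b * Φ.real l' c = 0 := by
  induction l generalizing a a' l' with
  | nil => exact (h List.nil_prefix).elim
  | cons e l ih =>
    cases l' with
    | nil => exact (h' List.nil_prefix).elim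
    | cons f l' =>
      rw [ghost_cons, mul_assoc]
      rcases eq_or_ne e f with rfl | hef
      · rw [Φ.t_mul_real_cons_self hl']
        exact ih hl.2 hl'.2 (fun hp => h (List.cons_prefix_cons.2 ⟨rfl, hp⟩))
          fun hp => h' (List.cons_prefix_cons.2 ⟨rfl, hp⟩)
      · rw [Φ.t_mul_real_cons_of_ne hef, mul_zero]

end Paths

section Degree

/-- The span of the `α β*` with `|α| - |β| = n`. -/
def deg (n : ℤ) : Submodule K A :=
  Submodule.span K {x | ∃ (a b c : F) (α β : List (Quiver.Total F)), IsWalk a α c ∧ IsWalk b β c ∧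
    (α.length : ℤ) - β.length = n ∧ x = Φ.real α c * Φ.ghost β c}

theorem real_mul_ghost_mem_deg {a b c : F} {α β : List (Quiver.Total F)} (hα : IsWalk a α c)
    (hβ : IsWalk b β c) : Φ.real α c * Φ.ghost β c ∈ Φ.deg ((α.length : ℤ) - β.length) :=
  Submodule.subset_span ⟨a, b, c, α, β, hα, hβ, rfl, rfl⟩

theorem real_mem_deg {a c : F} {α : List (Quiver.Total F)} (hα : IsWalk a α c) :
    Φ.real α c ∈ Φ.deg α.length := by
  simpa [ghost_nil, real_mul_p] using Φ.real_mul_ghost_mem_deg (β := []) hα rfl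

theorem ghost_mem_deg {a c : F} {α : List (Quiver.Total F)} (hα : IsWalk a α c) :
    Φ.ghost α c ∈ Φ.deg (-α.length) := by
  simpa [real_nil, p_mul_ghost] using Φ.real_mul_ghost_mem_deg (α := []) (a := c) rfl hα

theorem p_mem_deg (a : F) : Φ.p a ∈ Φ.deg 0 := by
  simpa [real_nil] using Φ.real_mem_deg (α := []) (a := a) rfl

theorem s_mem_deg (e : Quiver.Total F) : Φ.s e ∈ Φ.deg 1 := by
  simpa [real_singleton] using Φ.real_mem_deg (isWalk_singleton e)

theorem t_mem_deg (e : Quiver.Total F) : Φ.t e ∈ Φ.deg (-1) := by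
  simpa [ghost_singleton] using Φ.ghost_mem_deg (isWalk_singleton e)

theorem p_mul_mem_deg (a : F) {n : ℤ} {x : A} (hx : x ∈ Φ.deg n) : Φ.p a * x ∈ Φ.deg n := by
  refine mul_mem_of_mem_span ?_ hx
  rintro _ ⟨b, b', c, α, β, hα, hβ, rfl, rfl⟩
  rcases eq_or_ne a b with rfl | h
  · rw [← mul_assoc, Φ.p_mul_real hα]
    exact Φ.real_mul_ghost_mem_deg hα hβ
  · rw [← mul_assoc, Φ.p_mul_real_of_ne hα h, zero_mul]
    exact zero_mem _

theorem s_mul_mem_deg (e : Quiver.Total F) {n : ℤ} {x : A} (hx : x ∈ Φ.deg n) :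
    Φ.s e * x ∈ Φ.deg (1 + n) := by
  refine mul_mem_of_mem_span ?_ hx
  rintro _ ⟨b, b', c, α, β, hα, hβ, rfl, rfl⟩
  rcases eq_or_ne e.right b with rfl | h
  · rw [← mul_assoc, ← real_cons]
    convert Φ.real_mul_ghost_mem_deg (a := e.left) (α := e :: α) ⟨rfl, hα⟩ hβ using 2
    push_cast [List.length_cons]
    ring
  · rw [← Φ.s_mul_p, mul_assoc, ← mul_assoc (Φ.p _), Φ.p_mul_real_of_ne hα h, zero_mul, mul_zero]
    exact zero_mem _

theorem t_mul_ghost_mem_deg (e : Quiver.Total F) {b c : F} {β : List (Quiver.Total F)}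
    (hβ : IsWalk b β c) : Φ.t e * Φ.ghost β c ∈ Φ.deg (-1 - β.length) := by
  rcases eq_or_ne e.left c with rfl | h
  · rw [t_mul_ghost]
    convert Φ.ghost_mem_deg (hβ.append (isWalk_singleton e)) using 2
    push_cast [List.length_append, List.length_singleton]
    ring
  · rw [← Φ.p_mul_ghost, ← mul_assoc, Φ.t_mul_p_of_ne h, zero_mul]
    exact zero_mem _

theorem t_mul_mem_deg (e : Quiver.Total F) {n : ℤ} {x : A} (hx : x ∈ Φ.deg n) :
    Φ.t e * x ∈ Φ.deg (-1 + n) := by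
  refine mul_mem_of_mem_span ?_ hx
  rintro _ ⟨b, b', c, α, β, hα, hβ, rfl, rfl⟩
  cases α with
  | nil =>
    rw [real_nil, p_mul_ghost]
    convert Φ.t_mul_ghost_mem_deg e hβ using 2
    rw [List.length_nil, Nat.cast_zero]
    ring
  | cons f α =>
    rw [← mul_assoc]
    rcases eq_or_ne e f with rfl | h
    · rw [Φ.t_mul_real_cons_self hα]
      convert Φ.real_mul_ghost_mem_deg hα.2 hβ using 2
      push_cast [List.length_cons]
      ring
    · rw [Φ.t_mul_real_cons_of_ne h, zero_mul]
      exact zero_mem _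

theorem real_mul_mem_deg (α : List (Quiver.Total F)) (c : F) {n : ℤ} {x : A} (hx : x ∈ Φ.deg n) :
    Φ.real α c * x ∈ Φ.deg (α.length + n) := by
  induction α with
  | nil => simpa [real_nil] using Φ.p_mul_mem_deg c hx
  | cons e α ih =>
    rw [real_cons, mul_assoc]
    convert Φ.s_mul_mem_deg e ih using 2
    push_cast [List.length_cons]
    ring

theorem ghost_mul_mem_deg (β : List (Quiver.Total F)) (c : F) {n : ℤ} {x : A} (hx : x ∈ Φ.deg n) :
    Φ.ghost β c * x ∈ Φ.deg (-β.length + n) := by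
  induction β generalizing x n with
  | nil => simpa [ghost_nil] using Φ.p_mul_mem_deg c hx
  | cons e β ih =>
    rw [ghost_cons, mul_assoc]
    convert ih (Φ.t_mul_mem_deg e hx) using 2
    push_cast [List.length_cons]
    ring

theorem mul_mem_deg {m n : ℤ} {x y : A} (hx : x ∈ Φ.deg m) (hy : y ∈ Φ.deg n) :
    x * y ∈ Φ.deg (m + n) := by
  refine mul_mem_of_mem_span' ?_ hx
  rintro _ ⟨a, b, c, α, β, -, -, rfl, rfl⟩
  rw [mul_assoc, sub_eq_add_neg, add_assoc]
  exact Φ.real_mul_mem_deg α c (Φ.ghost_mul_mem_deg β c hy)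

theorem mul_mem_iSup_deg {x y : A} (hx : x ∈ ⨆ n, Φ.deg n) (hy : y ∈ ⨆ n, Φ.deg n) :
    x * y ∈ ⨆ n, Φ.deg n := by
  refine Submodule.iSup_induction _ (motive := fun x => x * y ∈ ⨆ n, Φ.deg n) hx
    (fun m x hx => ?_) (by simp only [zero_mul, zero_mem])
    fun x z hx hz => by simpa only [add_mul] using add_mem hx hz
  exact Submodule.iSup_induction _ (motive := fun y => x * y ∈ ⨆ n, Φ.deg n) hy
    (fun n y hy => Submodule.mem_iSup_of_mem _ (Φ.mul_mem_deg hx hy))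
    (by simp only [mul_zero, zero_mem])
    fun y z hy hz => by simpa only [mul_add] using add_mem hy hz

theorem iSup_deg_eq_top : ⨆ n, Φ.deg n = ⊤ := by
  refine eq_top_iff.2 fun x _ => ?_
  have hx : x ∈ NonUnitalAlgebra.adjoin K (Set.range Φ.p ∪ Set.range Φ.s ∪ Set.range Φ.t) :=
    Φ.adjoin_eq_top ▸ trivial
  induction hx using NonUnitalAlgebra.adjoin_induction with
  | mem x hx =>
    rcases hx with (⟨a, rfl⟩ | ⟨e, rfl⟩) | ⟨e, rfl⟩
    · exact Submodule.mem_iSup_of_mem _ (Φ.p_mem_deg a)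
    · exact Submodule.mem_iSup_of_mem _ (Φ.s_mem_deg e)
    · exact Submodule.mem_iSup_of_mem _ (Φ.t_mem_deg e)
  | add x y _ _ hx hy => exact add_mem (hx trivial) (hy trivial)
  | zero => exact zero_mem _
  | smul k x _ hx => exact Submodule.smul_mem _ _ (hx trivial)
  | mul x y _ _ hx hy => exact Φ.mul_mem_iSup_deg (hx trivial) (hy trivial)

theorem mem_span_real_mul_ghost (x : A) :
    x ∈ Submodule.span K {x | ∃ (a b c : F) (α β : List (Quiver.Total F)),
      IsWalk a α c ∧ IsWalk b β c ∧ x = Φ.real α c * Φ.ghost β c} := by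
  have hx : x ∈ ⨆ n, Φ.deg n := Φ.iSup_deg_eq_top ▸ trivial
  refine (iSup_le fun n => Submodule.span_mono ?_ : ⨆ n, Φ.deg n ≤ _) hx
  rintro _ ⟨a, b, c, α, β, hα, hβ, -, rfl⟩
  exact ⟨a, b, c, α, β, hα, hβ, rfl⟩

end Degree

section LocalUnits

open Filter

theorem eventually_mul_sum_p_eq (x : A) :
    ∀ᶠ T : Finset F in atTop, x * ∑ a ∈ T, Φ.p a = x := by
  refine eventually_apply_eq_of_mem_span (f := fun T => LinearMap.mulRight K (∑ a ∈ T, Φ.p a))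
    ?_ (Φ.mem_span_real_mul_ghost x)
  rintro _ ⟨a, b, c, α, β, -, hβ, rfl⟩
  filter_upwards [eventually_ge_atTop {b}] with T hT
  rw [LinearMap.mulRight_apply, mul_assoc, Finset.mul_sum, Finset.sum_eq_single b, Φ.ghost_mul_p hβ]
  · exact fun d _ hd => Φ.ghost_mul_p_of_ne hβ hd.symm
  · exact fun hb => (hb (Finset.singleton_subset_iff.1 hT)).elim

theorem eventually_sum_p_mul_eq (x : A) :
    ∀ᶠ T : Finset F in atTop, (∑ a ∈ T, Φ.p a) * x = x := by
  refine eventually_apply_eq_of_mem_span (f := fun T => LinearMap.mulLeft K (∑ a ∈ T, Φ.p a))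
    ?_ (Φ.mem_span_real_mul_ghost x)
  rintro _ ⟨a, b, c, α, β, hα, -, rfl⟩
  filter_upwards [eventually_ge_atTop {a}] with T hT
  rw [LinearMap.mulLeft_apply, ← mul_assoc, Finset.sum_mul, Finset.sum_eq_single a,
    Φ.p_mul_real hα]
  · exact fun d _ hd => Φ.p_mul_real_of_ne hα hd
  · exact fun ha => (ha (Finset.singleton_subset_iff.1 hT)).elim

theorem eq_zero_of_forall_mul_p {x : A} (h : ∀ a, x * Φ.p a = 0) : x = 0 := by
  obtain ⟨T, hT⟩ := (Φ.eventually_mul_sum_p_eq x).exists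
  rw [← hT, Finset.mul_sum, Finset.sum_eq_zero fun a _ => h a]

theorem eq_zero_of_forall_p_mul {x : A} (h : ∀ a, Φ.p a * x = 0) : x = 0 := by
  obtain ⟨T, hT⟩ := (Φ.eventually_sum_p_mul_eq x).exists
  rw [← hT, Finset.sum_mul, Finset.sum_eq_zero fun a _ => h a]

end LocalUnits

end CKFamily

section Lists

variable {X : Type*} {l : List X}

/-- The `n`-fold concatenation of a list with itself. -/
def listPow (l : List X) (n : ℕ) : List X := (List.replicate n l).flatten

theorem listPow_zero (l : List X) : listPow l 0 = [] := rfl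

theorem listPow_succ (l : List X) (n : ℕ) : listPow l (n + 1) = l ++ listPow l n := by
  rw [listPow, List.replicate_succ, List.flatten_cons, listPow]

theorem listPow_add (l : List X) (m n : ℕ) : listPow l (m + n) = listPow l m ++ listPow l n := by
  rw [listPow, List.replicate_add, List.flatten_append, listPow, listPow]

theorem listPow_append_self (l : List X) (n : ℕ) : listPow l n ++ l = l ++ listPow l n := by
  rw [← listPow_succ, listPow_add, listPow_succ, listPow_zero, List.append_nil]

theorem le_length_listPow (hl : l ≠ []) (n : ℕ) : n ≤ (listPow l n).length := by
  rw [listPow, List.length_flatten, List.map_replicate, List.sum_replicate, smul_eq_mul]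
  exact Nat.le_mul_of_pos_right _ (List.length_pos_iff.2 hl)

theorem mem_of_mem_listPow {n : ℕ} {x : X} (h : x ∈ listPow l n) : x ∈ l := by
  simp only [listPow, List.mem_flatten, List.mem_replicate] at h
  obtain ⟨_, ⟨-, rfl⟩, h⟩ := h
  exact h

theorem prefix_listPow_of_prefix_append {d : List X} (hl : l ≠ []) (h : d <+: l ++ d) :
    d <+: listPow l d.length := by
  have hpow : ∀ n, d <+: listPow l n ++ d := fun n => by
    induction n with
    | zero => exact List.prefix_rfl
    | succ n ih =>
      rw [listPow_succ, List.append_assoc]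
      exact h.trans ((List.prefix_append_right_inj l).2 ih)
  exact List.prefix_of_prefix_length_le (hpow d.length) (List.prefix_append _ _)
    (le_length_listPow hl _)

theorem not_append_singleton_prefix {l₁ l₂ : List X} {e f : X} (hf : f ≠ e) (n : ℕ) :
    ¬ listPow (l₁ ++ e :: l₂) n ++ (l₁ ++ [f]) <+:
      (l₁ ++ e :: l₂) ++ (listPow (l₁ ++ e :: l₂) n ++ (l₁ ++ [f])) := by
  intro h
  rw [← List.append_assoc (l₁ ++ _), ← listPow_append_self, List.append_assoc (listPow _ _),
    List.prefix_append_right_inj, List.append_assoc, List.prefix_append_right_inj,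
    List.cons_append, List.cons_prefix_cons] at h
  exact hf h.1

theorem exists_append_of_not_nodup_map {Y : Type*} {f : X → Y} (h : ¬ (l.map f).Nodup) :
    ∃ l₁ x l₂ y l₃, l = l₁ ++ x :: l₂ ++ y :: l₃ ∧ f x = f y := by
  induction l with
  | nil => simp at h
  | cons x l ih =>
    by_cases hx : f x ∈ l.map f
    · obtain ⟨y, hy, hxy⟩ := List.mem_map.1 hx
      obtain ⟨l₂, l₃, rfl⟩ := List.append_of_mem hy
      exact ⟨[], x, l₂, y, l₃, rfl, hxy.symm⟩
    · obtain ⟨l₁, x', l₂, y, l₃, rfl, hxy⟩ := ih fun hl => h (List.nodup_cons.2 ⟨hx, hl⟩)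
      exact ⟨x :: l₁, x', l₂, y, l₃, rfl, hxy⟩

theorem append_singleton_prefix_iff {α β : List X} {e : X} (he : e ∉ β) :
    α ++ [e] <+: β ++ [e] ↔ α = β := by
  refine ⟨fun h => ?_, fun h => h ▸ List.prefix_rfl⟩
  rcases List.prefix_concat_iff.1 h with h | h
  · exact List.append_cancel_right h
  · exact (he (h.subset (by simp))).elim

end Lists

section NoExit

variable {F : Type u} [Quiver.{v} F]

theorem IsWalk.listPow {a : F} {l : List (Quiver.Total F)} (h : IsWalk a l a) (n : ℕ) :
    IsWalk a (listPow l n) a := by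
  induction n with
  | zero => rfl
  | succ n ih => rw [listPow_succ]; exact h.append ih

/-- A vertex through which there passes a closed path without exits. -/
def IsNoExit (a : F) : Prop :=
  ∃ l : List (Quiver.Total F), l ≠ [] ∧ IsWalk a l a ∧ ¬ HasExit l

theorem IsWalk.exists_extension_not_prefix {a b : F} {d l : List (Quiver.Total F)}
    (hd : IsWalk a d b) (hl : IsWalk a l a) (hex : HasExit l) :
    ∃ (c : F) (d' : List (Quiver.Total F)), IsWalk a (d ++ d') c ∧
      ¬ d ++ d' <+: l ++ (d ++ d') := by
  by_cases h : d <+: l ++ d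
  · obtain ⟨f, e, he, hfe, hne⟩ := hex
    obtain ⟨l₁, l₂, rfl⟩ := List.append_of_mem he
    obtain ⟨d', hd'⟩ := prefix_listPow_of_prefix_append (by simp) h
    obtain ⟨c, h₁, h₂⟩ := isWalk_append.1 hl
    refine ⟨f.right, d' ++ (l₁ ++ [f]), ?_, ?_⟩
    · rw [← List.append_assoc, hd']
      exact (hl.listPow _).append (h₁.append ⟨hfe.trans h₂.1, rfl⟩)
    · rw [← List.append_assoc, hd']
      exact not_append_singleton_prefix hne _
  · exact ⟨b, [], by simpa using hd, by simpa using h⟩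

end NoExit

namespace CKFamily

variable {K : Type w} [Field K] {F : Type u} [Quiver.{v} F] {A : Type*}
    [NonUnitalRing A] [Module K A] [IsScalarTower K A A] [SMulCommClass K A A]
    (Φ : CKFamily K F A)

section Reduces

/-- `y` arises from `x` by successive multiplications by homogeneous elements on either side. -/
inductive Reduces (x : A) : A → Prop
  | refl : Reduces x x
  | mul_left {n : ℤ} {u y : A} : u ∈ Φ.deg n → Reduces x y → Reduces x (u * y)
  | mul_right {n : ℤ} {u y : A} : u ∈ Φ.deg n → Reduces x y → Reduces x (y * u)

variable {Φ} {x y z : A}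

theorem Reduces.trans (h : Φ.Reduces x y) (h' : Φ.Reduces y z) : Φ.Reduces x z := by
  induction h' with
  | refl => exact h
  | mul_left hu _ ih => exact .mul_left hu ih
  | mul_right hu _ ih => exact .mul_right hu ih

theorem Reduces.mem (h : Φ.Reduces x y) {J : TwoSidedIdeal A} (hx : x ∈ J) : y ∈ J := by
  induction h with
  | refl => exact hx
  | mul_left _ _ ih => exact J.mul_mem_left _ _ ih
  | mul_right _ _ ih => exact J.mul_mem_right _ _ ih

theorem Reduces.exists_mem_deg (h : Φ.Reduces x y) {n : ℤ} (hx : x ∈ Φ.deg n) :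
    ∃ m, y ∈ Φ.deg m := by
  induction h with
  | refl => exact ⟨n, hx⟩
  | mul_left hu _ ih => exact ih.imp' _ fun _ hy => Φ.mul_mem_deg hu hy
  | mul_right hu _ ih => exact ih.imp' _ fun _ hy => Φ.mul_mem_deg hy hu

theorem reduces_p_of_smul {k : K} (hk : k ≠ 0) {a : F} (h : Φ.Reduces x (k • Φ.p a)) :
    Φ.Reduces x (Φ.p a) := by
  have h' := h.mul_left (Submodule.smul_mem _ k⁻¹ (Φ.p_mem_deg a))
  rwa [smul_mul_smul_comm, inv_mul_cancel₀ hk, one_smul, Φ.p_mul_self] at h'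

end Reduces

section RealSpan

open Filter

/-- The span of the paths of `s`, all of which are supposed to end at `b`. -/
def realSpan (b : F) (s : Set (List (Quiver.Total F))) : Submodule K A :=
  Submodule.span K ((Φ.real · b) '' s)

/-- The span of the products `y * t e`. -/
def mulTSpan : Submodule K A := Submodule.span K {x | ∃ y e, x = y * Φ.t e}

variable {Φ} {b : F} {x : A}

theorem mem_realSpan_of_subset {s s' : Set (List (Quiver.Total F))} (h : s ⊆ s')
    (hx : x ∈ Φ.realSpan b s) : x ∈ Φ.realSpan b s' :=
  Submodule.span_mono (Set.image_mono h) hx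

theorem realSpan_mul_p {s : Set (List (Quiver.Total F))} (hx : x ∈ Φ.realSpan b s) :
    x * Φ.p b = x := by
  refine LinearMap.eqOn_span (f := LinearMap.mulRight K (Φ.p b)) (g := LinearMap.id) ?_ hx
  rintro _ ⟨α, -, rfl⟩
  exact Φ.real_mul_p b α

theorem eventually_mem_realSpan {ι : Type*} {l : Filter ι} {s : Set (List (Quiver.Total F))}
    {P : ι → List (Quiver.Total F) → Prop} (h : ∀ α ∈ s, ∀ᶠ i in l, P i α)
    (hx : x ∈ Φ.realSpan b s) : ∀ᶠ i in l, x ∈ Φ.realSpan b {α ∈ s | P i α} := by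
  induction hx using Submodule.span_induction with
  | mem x hx =>
    obtain ⟨α, hα, rfl⟩ := hx
    filter_upwards [h α hα] with i hi using Submodule.subset_span ⟨α, ⟨hα, hi⟩, rfl⟩
  | zero => exact .of_forall fun i => zero_mem _
  | add x y _ _ hx hy => filter_upwards [hx, hy] with e hx hy using add_mem hx hy
  | smul k x _ hx => filter_upwards [hx] with e hx using Submodule.smul_mem _ _ hx

theorem eventually_mem_realSpan_notMem {s : Set (List (Quiver.Total F))}
    (hx : x ∈ Φ.realSpan b s) : ∀ᶠ e in cofinite, x ∈ Φ.realSpan b {α ∈ s | e ∉ α} :=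
  eventually_mem_realSpan (fun α _ => (List.finite_toSet α).compl_mem_cofinite) hx

theorem exists_mem_realSpan_length_le {s : Set (List (Quiver.Total F))}
    (hx : x ∈ Φ.realSpan b s) : ∃ n, x ∈ Φ.realSpan b {α ∈ s | α.length ≤ n} :=
  (eventually_mem_realSpan (fun α _ => eventually_ge_atTop α.length) hx).exists

/-- Paths `α e` and `β e` such that `α ≠ β` avoid the edge `e` are incomparable, so `x * s e`
determines the coefficients of `x`. -/
theorem eq_zero_of_mul_s_eq_zero {e : Quiver.Total F} (hp : Φ.p e.right ≠ 0)
    (hx : x ∈ Φ.realSpan e.left {α ∈ {α | ∃ a, IsWalk a α e.left} | e ∉ α})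
    (h : x * Φ.s e = 0) : x = 0 := by
  obtain ⟨f, hf, rfl⟩ := (Finsupp.mem_span_image_iff_linearCombination K).1 hx
  suffices f = 0 by rw [this, map_zero]
  by_contra hf0
  obtain ⟨α, hα⟩ := Finsupp.support_nonempty_iff.2 hf0
  have hwalk := fun β (hβ : β ∈ f.support) => ((Finsupp.mem_supported _ _).1 hf hβ)
  obtain ⟨⟨a, ha⟩, heα⟩ := hwalk α hα
  have hcoeff : Φ.ghost (α ++ [e]) e.right *
      (Finsupp.linearCombination K (Φ.real · e.left) f * Φ.s e) = f α • Φ.p e.right := by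
    rw [Finsupp.linearCombination_apply, Finsupp.sum, Finset.sum_mul, Finset.mul_sum,
      Finset.sum_eq_single_of_mem α hα]
    · rw [smul_mul_assoc, real_mul_s, mul_smul_comm,
        Φ.ghost_mul_real_self (ha.append (isWalk_singleton e))]
    · intro β hβ hne
      obtain ⟨⟨c, hc⟩, heβ⟩ := hwalk β hβ
      rw [smul_mul_assoc, real_mul_s, mul_smul_comm,
        Φ.ghost_mul_real_of_not_prefix (ha.append (isWalk_singleton e))
          (hc.append (isWalk_singleton e)), smul_zero]
      · exact fun h => hne ((append_singleton_prefix_iff heβ).1 h).symm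
      · exact fun h => hne ((append_singleton_prefix_iff heα).1 h)
  rw [h, mul_zero, eq_comm, smul_eq_zero] at hcoeff
  exact hcoeff.elim (Finsupp.mem_support_iff.1 hα) hp

theorem eventually_mul_s_eq_zero (hx : x ∈ Φ.mulTSpan) : ∀ᶠ e in cofinite, x * Φ.s e = 0 := by
  induction hx using Submodule.span_induction with
  | mem x hx =>
    obtain ⟨y, f, rfl⟩ := hx
    filter_upwards [(Set.finite_singleton f).compl_mem_cofinite] with e he
    rw [mul_assoc, Φ.t_mul_s_of_ne _ _ (Ne.symm he), mul_zero]
  | zero => simp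
  | add x y _ _ hx hy => filter_upwards [hx, hy] with e hx hy; rw [add_mul, hx, hy, add_zero]
  | smul k x _ hx => filter_upwards [hx] with e hx; rw [smul_mul_assoc, hx, smul_zero]

theorem eq_zero_of_forall_mul_s_eq_zero (hx : x ∈ Φ.mulTSpan) (h : ∀ e, x * Φ.s e = 0) :
    x = 0 := by
  have hsum : ∀ᶠ T : Finset (Quiver.Total F) in atTop, x * ∑ e ∈ T, Φ.s e * Φ.t e = x := by
    refine eventually_apply_eq_of_mem_span
      (f := fun T => LinearMap.mulRight K (∑ e ∈ T, Φ.s e * Φ.t e)) ?_ hx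
    rintro _ ⟨y, f, rfl⟩
    filter_upwards [eventually_ge_atTop {f}] with T hT
    rw [LinearMap.mulRight_apply, mul_assoc, Finset.mul_sum,
      Finset.sum_eq_single_of_mem f (Finset.singleton_subset_iff.1 hT)]
    · rw [← mul_assoc (Φ.t f), Φ.t_mul_s_self, Φ.p_mul_t]
    · exact fun e _ he => by rw [← mul_assoc, Φ.t_mul_s_of_ne _ _ he.symm, zero_mul]
  obtain ⟨T, hT⟩ := hsum.exists
  rw [← hT, Finset.mul_sum]
  exact Finset.sum_eq_zero fun e _ => by rw [← mul_assoc, h, zero_mul]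

theorem mul_p_eq_zero_of_isRegular (hb : IsRegular b) (h : ∀ e, x * Φ.s e = 0) :
    x * Φ.p b = 0 := by
  have := hb.2
  have := Fintype.ofFinite (Quiver.Star b)
  rw [← Φ.finsum_s_mul_t b hb, finsum_eq_sum_of_fintype, Finset.mul_sum]
  exact Finset.sum_eq_zero fun e _ => by rw [← mul_assoc, h, zero_mul]

/-- The span of the `α β*` with `β` of length at most `N` and starting at `b`. -/
def ghostSpan (Φ : CKFamily K F A) (N : ℕ) (b : F) : Submodule K A :=
  Submodule.span K {x | ∃ (a c : F) (α β : List (Quiver.Total F)), IsWalk a α c ∧ IsWalk b β c ∧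
    β.length ≤ N ∧ x = Φ.real α c * Φ.ghost β c}

theorem exists_mul_p_mem_ghostSpan (Φ : CKFamily K F A) (x : A) (b : F) :
    ∃ N, x * Φ.p b ∈ Φ.ghostSpan N b := by
  have hmono : Monotone (Φ.ghostSpan · b) := by
    rintro N N' h
    refine Submodule.span_mono ?_
    rintro _ ⟨a, c, α, β, hα, hβ, hN, rfl⟩
    exact ⟨a, c, α, β, hα, hβ, hN.trans h, rfl⟩
  rw [← Submodule.mem_iSup_of_directed _ hmono.directed_le]
  refine mul_mem_of_mem_span' ?_ (Φ.mem_span_real_mul_ghost x)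
  rintro _ ⟨a, b', c, α, β, hα, hβ, rfl⟩
  rcases eq_or_ne b' b with rfl | h
  · rw [mul_assoc, Φ.ghost_mul_p hβ]
    exact Submodule.mem_iSup_of_mem β.length
      (Submodule.subset_span ⟨a, c, α, β, hα, hβ, le_rfl, rfl⟩)
  · rw [mul_assoc, Φ.ghost_mul_p_of_ne hβ h, mul_zero]
    exact zero_mem _

theorem mem_realSpan_of_mem_ghostSpan_zero (hx : x ∈ Φ.ghostSpan 0 b) :
    x ∈ Φ.realSpan b {α | ∃ a, IsWalk a α b} := by
  refine Submodule.span_mono ?_ hx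
  rintro _ ⟨a, c, α, β, hα, hβ, hN, rfl⟩
  obtain rfl := List.length_eq_zero_iff.1 (Nat.le_zero.1 hN)
  obtain rfl := hβ
  exact ⟨α, ⟨a, hα⟩, (Φ.real_mul_p b α).symm⟩

theorem ghostSpan_le_sup (N : ℕ) (b : F) :
    Φ.ghostSpan N b ≤ Φ.realSpan b {α | ∃ a, IsWalk a α b} ⊔ Φ.mulTSpan := by
  refine Submodule.span_le.2 ?_
  rintro _ ⟨a, c, α, _ | ⟨e, β⟩, hα, hβ, -, rfl⟩
  · obtain rfl := hβ
    exact Submodule.mem_sup_left (Submodule.subset_span ⟨α, ⟨a, hα⟩, (Φ.real_mul_p b α).symm⟩)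
  · rw [ghost_cons, ← mul_assoc]
    exact Submodule.mem_sup_right (Submodule.subset_span ⟨_, e, rfl⟩)

theorem mul_s_mem_ghostSpan {N : ℕ} {e : Quiver.Total F} (hx : x ∈ Φ.ghostSpan (N + 1) e.left) :
    x * Φ.s e ∈ Φ.ghostSpan N e.right := by
  refine mul_mem_of_mem_span' ?_ hx
  rintro _ ⟨a, c, α, β, hα, hβ, hN, rfl⟩
  rw [mul_assoc]
  rcases β with _ | ⟨f, β⟩
  · obtain rfl := hβ
    rw [ghost_nil, Φ.p_mul_s, real_mul_s]
    refine Submodule.subset_span ⟨a, e.right, α ++ [e], [], hα.append (isWalk_singleton e), rfl,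
      Nat.zero_le N, ?_⟩
    rw [ghost_nil, real_mul_p]
  · rcases eq_or_ne f e with rfl | h
    · rw [Φ.ghost_cons_mul_s_self hβ]
      exact Submodule.subset_span ⟨a, c, α, β, hα, hβ.2, Nat.le_of_succ_le_succ hN, rfl⟩
    · rw [Φ.ghost_cons_mul_s_of_ne h, mul_zero]
      exact zero_mem _

theorem mul_p_of_mem_ghostSpan {N : ℕ} (hx : x ∈ Φ.ghostSpan N b) : x * Φ.p b = x := by
  refine LinearMap.eqOn_span (f := LinearMap.mulRight K (Φ.p b)) (g := LinearMap.id) ?_ hx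
  rintro _ ⟨a, c, α, β, -, hβ, -, rfl⟩
  rw [LinearMap.mulRight_apply, mul_assoc, Φ.ghost_mul_p hβ, LinearMap.id_apply]

/-- At an infinite emitter `b`, almost every edge `e` from `b` is foreign to the given expression of
`x`, so `x * s e = 0` forces the part of `x` without ghost edges to vanish. -/
theorem mem_realSpan_of_forall_mul_s_eq_zero (hp : ∀ a, Φ.p a ≠ 0) {N : ℕ}
    (hx : x ∈ Φ.ghostSpan N b) (h : ∀ e, x * Φ.s e = 0) :
    x ∈ Φ.realSpan b {α | ∃ a, IsWalk a α b} := by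
  by_cases hreg : IsRegular b
  · rw [← mul_p_of_mem_ghostSpan hx, mul_p_eq_zero_of_isRegular hreg h]
    exact zero_mem _
  obtain ⟨z, hz, w, hw, rfl⟩ := Submodule.mem_sup.1 (ghostSpan_le_sup N b hx)
  suffices z = 0 ∨ ∀ e, w * Φ.s e = 0 by
    rcases this with rfl | hws
    · rw [zero_add] at h ⊢
      rw [eq_zero_of_forall_mul_s_eq_zero hw h]
      exact zero_mem _
    · rwa [eq_zero_of_forall_mul_s_eq_zero hw hws, add_zero]
  rcases isEmpty_or_nonempty (Quiver.Star b) with hsink | hne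
  · refine Or.inr fun e => ?_
    have he : b ≠ e.left := by
      rintro rfl
      exact hsink.false ⟨e.right, e.hom⟩
    have hzs : z * Φ.s e = 0 := by
      rw [← realSpan_mul_p hz, mul_assoc, Φ.p_mul_s_of_ne he, mul_zero]
    simpa [add_mul, hzs] using h e
  · have : Infinite (Quiver.Star b) := not_finite_iff_infinite.1 fun hfin => hreg ⟨hne, hfin⟩
    have hinj : Function.Injective fun e : Quiver.Star b => (⟨b, e.1, e.2⟩ : Quiver.Total F) := by
      rintro ⟨c, e⟩ ⟨c', e'⟩ h
      simpa using h
    obtain ⟨e, hze, hwe⟩ := (hinj.tendsto_cofinite.eventually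
      ((eventually_mem_realSpan_notMem hz).and (eventually_mul_s_eq_zero hw))).exists
    refine Or.inl (eq_zero_of_mul_s_eq_zero (e := ⟨b, e.1, e.2⟩) (hp e.1) hze ?_)
    simpa only [add_mul, hwe, add_zero] using h ⟨b, e.1, e.2⟩

theorem exists_reduces_mem_realSpan (hp : ∀ a, Φ.p a ≠ 0) {N : ℕ} (hx : x ∈ Φ.ghostSpan N b)
    (h0 : x ≠ 0) :
    ∃ c, ∃ y ∈ Φ.realSpan c {α | ∃ a, IsWalk a α c}, y ≠ 0 ∧ Φ.Reduces x y := by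
  induction N generalizing x b with
  | zero => exact ⟨b, x, mem_realSpan_of_mem_ghostSpan_zero hx, h0, .refl⟩
  | succ N ih =>
    by_cases h : ∀ e, x * Φ.s e = 0
    · exact ⟨b, x, mem_realSpan_of_forall_mul_s_eq_zero hp hx h, h0, .refl⟩
    · obtain ⟨e, he⟩ := not_forall.1 h
      obtain rfl : b = e.left := by
        by_contra hb
        rw [← mul_p_of_mem_ghostSpan hx, mul_assoc, Φ.p_mul_s_of_ne hb, mul_zero] at he
        exact he rfl
      obtain ⟨c, y, hy, hy0, hred⟩ := ih (mul_s_mem_ghostSpan hx) he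
      exact ⟨c, y, hy, hy0, (Reduces.refl.mul_right (Φ.s_mem_deg e)).trans hred⟩

theorem p_mul_mem_realSpan (a : F) {s : Set (List (Quiver.Total F))}
    (hx : x ∈ Φ.realSpan b {α ∈ s | ∃ a, IsWalk a α b}) :
    Φ.p a * x ∈ Φ.realSpan b {α ∈ s | IsWalk a α b} := by
  refine mul_mem_of_mem_span ?_ hx
  rintro _ ⟨α, ⟨hα, c, hc⟩, rfl⟩
  rcases eq_or_ne a c with rfl | h
  · beta_reduce
    rw [Φ.p_mul_real hc]
    exact Submodule.subset_span ⟨α, ⟨hα, hc⟩, rfl⟩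
  · beta_reduce
    rw [Φ.p_mul_real_of_ne hc h]
    exact zero_mem _

theorem exists_eq_smul_p_add {s : Set (List (Quiver.Total F))} (hx : x ∈ Φ.realSpan b s) :
    ∃ k : K, ∃ w ∈ Φ.realSpan b (s \ {[]}), x = k • Φ.p b + w ∧ (k ≠ 0 → [] ∈ s) := by
  by_cases h : [] ∈ s
  · rw [← Set.insert_sdiff_self_of_mem h, realSpan, Set.image_insert_eq,
      Submodule.mem_span_insert] at hx
    obtain ⟨k, w, hw, rfl⟩ := hx
    exact ⟨k, w, hw, rfl, fun _ => h⟩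
  · rw [← Set.sdiff_singleton_eq_self h] at hx
    exact ⟨0, x, hx, by rw [zero_smul, zero_add], fun h => (h rfl).elim⟩

theorem eq_zero_of_forall_t_mul_eq_zero (hx : x ∈ Φ.realSpan b {α | α ≠ []})
    (h : ∀ e, Φ.t e * x = 0) : x = 0 := by
  have hsum : ∀ᶠ T : Finset (Quiver.Total F) in atTop, (∑ e ∈ T, Φ.s e * Φ.t e) * x = x := by
    refine eventually_apply_eq_of_mem_span
      (f := fun T => LinearMap.mulLeft K (∑ e ∈ T, Φ.s e * Φ.t e)) ?_ hx
    rintro _ ⟨_ | ⟨f, α⟩, hα, rfl⟩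
    · exact (hα rfl).elim
    filter_upwards [eventually_ge_atTop {f}] with T hT
    rw [LinearMap.mulLeft_apply, Finset.sum_mul,
      Finset.sum_eq_single_of_mem f (Finset.singleton_subset_iff.1 hT)]
    · rw [real_cons, ← mul_assoc, mul_assoc (Φ.s f), Φ.t_mul_s_self, Φ.s_mul_p]
    · exact fun e _ he => by rw [mul_assoc, Φ.t_mul_real_cons_of_ne he, mul_zero]
  obtain ⟨T, hT⟩ := hsum.exists
  rw [← hT, Finset.sum_mul]
  exact Finset.sum_eq_zero fun e _ => by rw [mul_assoc, h, mul_zero]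

theorem t_mul_mem_realSpan {n : ℕ} (e : Quiver.Total F)
    (hx : x ∈ Φ.realSpan b {α | α ≠ [] ∧ α.length ≤ n + 1 ∧ ∃ a, IsWalk a α b}) :
    Φ.t e * x ∈ Φ.realSpan b {α | α.length ≤ n ∧ ∃ a, IsWalk a α b} := by
  refine mul_mem_of_mem_span ?_ hx
  rintro _ ⟨_ | ⟨f, α⟩, ⟨hα, hn, a, ha⟩, rfl⟩
  · exact (hα rfl).elim
  · beta_reduce
    rcases eq_or_ne e f with rfl | h
    · rw [Φ.t_mul_real_cons_self ha]
      exact Submodule.subset_span ⟨α, ⟨Nat.le_of_succ_le_succ hn, _, ha.2⟩, rfl⟩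
    · rw [Φ.t_mul_real_cons_of_ne h]
      exact zero_mem _

theorem exists_reduces_smul_p_add {n : ℕ}
    (hx : x ∈ Φ.realSpan b {α | α.length ≤ n ∧ ∃ a, IsWalk a α b}) (h0 : x ≠ 0) :
    ∃ k : K, k ≠ 0 ∧ ∃ w ∈ Φ.realSpan b {γ | γ ≠ [] ∧ IsWalk b γ b},
      k • Φ.p b + w ≠ 0 ∧ Φ.Reduces x (k • Φ.p b + w) := by
  induction n generalizing x with
  | zero =>
    obtain ⟨k, w, hw, rfl, -⟩ := exists_eq_smul_p_add hx
    obtain rfl : w = 0 := by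
      refine (Submodule.span_eq_bot.2 ?_ : Φ.realSpan b _ = ⊥).le hw
      rintro _ ⟨α, ⟨⟨hα, -⟩, hα'⟩, -⟩
      exact (hα' (List.length_eq_zero_iff.1 (Nat.le_zero.1 hα))).elim
    refine ⟨k, ?_, 0, zero_mem _, h0, .refl⟩
    rintro rfl
    simp at h0
  | succ n ih =>
    obtain ⟨a, ha⟩ : ∃ a, Φ.p a * x ≠ 0 := not_forall.1 (mt Φ.eq_zero_of_forall_p_mul h0)
    have hred : Φ.Reduces x (Φ.p a * x) := Reduces.refl.mul_left (Φ.p_mem_deg a)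
    obtain ⟨k, w, hw, hkw, hka⟩ := exists_eq_smul_p_add (p_mul_mem_realSpan a hx)
    rw [hkw] at ha hred
    rcases eq_or_ne k 0 with rfl | hk
    · rw [zero_smul, zero_add] at ha hred
      obtain ⟨e, he⟩ : ∃ e, Φ.t e * w ≠ 0 := not_forall.1 (mt (eq_zero_of_forall_t_mul_eq_zero
        (mem_realSpan_of_subset (fun α hα => hα.2) hw)) ha)
      obtain ⟨k, hk, v, hv, hv0, hv'⟩ := ih (t_mul_mem_realSpan e (mem_realSpan_of_subset
        (fun α hα => ⟨hα.2, hα.1.1, a, hα.1.2⟩) hw)) he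
      exact ⟨k, hk, v, hv, hv0, (hred.mul_left (Φ.t_mem_deg e)).trans hv'⟩
    · obtain rfl : a = b := (hka hk).2
      exact ⟨k, hk, w, mem_realSpan_of_subset (fun α hα => ⟨hα.2, hα.1.2⟩) hw,
        ha, hred⟩

/-- A path `d` which is not a prefix of `γ d` gives `ghost d * γ * real d = 0`, and this persists
when `d` is extended. -/
theorem exists_ghost_mul_mul_real_eq_zero {a : F} (ha : ¬ IsNoExit a) {w : A}
    (hw : w ∈ Φ.realSpan a {γ | γ ≠ [] ∧ IsWalk a γ a}) {d : List (Quiver.Total F)}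
    (hd : IsWalk a d b) :
    ∃ (c : F) (d' : List (Quiver.Total F)), IsWalk a (d ++ d') c ∧
      Φ.ghost (d ++ d') c * w * Φ.real (d ++ d') c = 0 := by
  induction hw using Submodule.span_induction generalizing b d with
  | mem w hw =>
    obtain ⟨γ, ⟨hγ0, hγ⟩, rfl⟩ := hw
    have hex : HasExit γ := by_contra fun h => ha ⟨γ, hγ0, hγ, h⟩
    obtain ⟨c, d', hd', hnot⟩ := hd.exists_extension_not_prefix hγ hex
    refine ⟨c, d', hd', ?_⟩
    rw [mul_assoc, Φ.real_mul_real hd', Φ.ghost_mul_real_of_not_prefix hd' (hγ.append hd') hnot]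
    intro h
    have := h.length_le
    have := List.length_pos_iff.2 hγ0
    rw [List.length_append] at *
    omega
  | zero => exact ⟨b, [], by rwa [List.append_nil], by rw [mul_zero, zero_mul]⟩
  | add x y _ _ hx hy =>
    obtain ⟨c, d', hd', h⟩ := hx hd
    obtain ⟨c', d'', hd'', h'⟩ := hy hd'
    have hw := hd''.of_append_right hd'
    refine ⟨c', d' ++ d'', by rwa [← List.append_assoc], ?_⟩
    rw [← List.append_assoc, mul_add, add_mul, h', add_zero, ← Φ.ghost_mul_ghost hw,
      ← Φ.real_mul_real hw]
    calc _ = Φ.ghost d'' c' * (Φ.ghost (d ++ d') c * x * Φ.real (d ++ d') c) * Φ.real d'' c' := by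
          simp only [mul_assoc]
      _ = 0 := by rw [h, mul_zero, zero_mul]
  | smul k x _ hx =>
    obtain ⟨c, d', hd', h⟩ := hx hd
    exact ⟨c, d', hd', by rw [mul_smul_comm, smul_mul_assoc, h, smul_zero]⟩

theorem reduces_p_of_not_isNoExit {a : F} (ha : ¬ IsNoExit a) {k : K} (hk : k ≠ 0) {w : A}
    (hw : w ∈ Φ.realSpan a {γ | γ ≠ [] ∧ IsWalk a γ a}) :
    ∃ c, Φ.Reduces (k • Φ.p a + w) (Φ.p c) := by
  obtain ⟨c, d, hd, h⟩ := exists_ghost_mul_mul_real_eq_zero ha hw (d := []) rfl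
  rw [List.nil_append] at hd h
  refine ⟨c, reduces_p_of_smul hk ?_⟩
  convert (Reduces.refl.mul_left (Φ.ghost_mem_deg hd)).mul_right (Φ.real_mem_deg hd) using 1
  rw [mul_add, add_mul, h, add_zero, mul_smul_comm, Φ.ghost_mul_p hd, smul_mul_assoc,
    Φ.ghost_mul_real_self hd]

theorem p_mul_eq_self {a : F} (hx : x ∈ Φ.realSpan b {α | IsWalk a α b}) : Φ.p a * x = x := by
  refine LinearMap.eqOn_span (f := LinearMap.mulLeft K (Φ.p a)) (g := LinearMap.id) ?_ hx
  rintro _ ⟨α, hα, rfl⟩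
  exact Φ.p_mul_real hα

end RealSpan

theorem exists_reduces (hp : ∀ a, Φ.p a ≠ 0) {x : A} (hx : x ≠ 0) :
    ∃ a, Φ.Reduces x (Φ.p a) ∨
      IsNoExit a ∧ ∃ y, y ≠ 0 ∧ Φ.p a * y * Φ.p a = y ∧ Φ.Reduces x y := by
  obtain ⟨b, hb⟩ : ∃ b, x * Φ.p b ≠ 0 := not_forall.1 (mt Φ.eq_zero_of_forall_mul_p hx)
  obtain ⟨N, hN⟩ := Φ.exists_mul_p_mem_ghostSpan x b
  obtain ⟨a, y, hy, hy0, hxy⟩ := exists_reduces_mem_realSpan hp hN hb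
  obtain ⟨n, hn⟩ := exists_mem_realSpan_length_le hy
  obtain ⟨k, hk, w, hw, hw0, hyw⟩ := exists_reduces_smul_p_add
    (mem_realSpan_of_subset (fun α hα => ⟨hα.2, hα.1⟩) hn) hy0
  have hred := ((Reduces.refl.mul_right (Φ.p_mem_deg b)).trans hxy).trans hyw
  by_cases ha : IsNoExit a
  · have hpw : Φ.p a * w = w :=
      p_mul_eq_self (mem_realSpan_of_subset (fun α hα => hα.2) hw)
    refine ⟨a, .inr ⟨ha, _, hw0, ?_, hred⟩⟩
    rw [mul_add, add_mul, hpw, realSpan_mul_p hw, mul_smul_comm, Φ.p_mul_self, smul_mul_assoc,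
      Φ.p_mul_self]
  · obtain ⟨c, hc⟩ := reduces_p_of_not_isNoExit ha hk hw
    exact ⟨c, .inl (hred.trans hc)⟩

end CKFamily

section NoExit

variable {F : Type u} [Quiver.{v} F]

theorem not_hasExit_iff {l : List (Quiver.Total F)} :
    ¬ HasExit l ↔ ∀ e ∈ l, ∀ f : Quiver.Total F, f.left = e.left → f = e := by
  unfold HasExit
  push Not
  exact ⟨fun h e he f hf => h f e he hf, fun h f e he hf => h e he f hf⟩

theorem IsWalk.prefix_of_not_hasExit {a b c : F} {l l' : List (Quiver.Total F)}
    (h : IsWalk a l b) (h' : IsWalk a l' c) (hl' : ¬ HasExit l') (hle : l.length ≤ l'.length) :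
    l <+: l' := by
  rw [not_hasExit_iff] at hl'
  induction l generalizing a l' with
  | nil => exact List.nil_prefix
  | cons e l ih =>
    cases l' with
    | nil => simp at hle
    | cons f l' =>
      obtain rfl : e = f := hl' f (by simp) e (h.1.trans h'.1.symm)
      rw [List.cons_prefix_cons]
      exact ⟨rfl, ih h.2 h'.2 (fun e he => hl' e (by simp [he])) (by simpa using hle)⟩

theorem IsWalk.prefix_listPow {a b : F} {l l' : List (Quiver.Total F)} (h : IsWalk a l b)
    (h' : IsWalk a l' a) (hl' : l' ≠ []) (hex : ¬ HasExit l') :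
    l <+: LPA.listPow l' l.length := by
  refine h.prefix_of_not_hasExit (h'.listPow _) ?_ (le_length_listPow hl' _)
  rw [not_hasExit_iff] at hex ⊢
  exact fun e he => hex e (mem_of_mem_listPow he)

theorem IsNoExit.not_hasExit {a b : F} (ha : IsNoExit a) {l : List (Quiver.Total F)}
    (h : IsWalk a l b) : ¬ HasExit l := by
  obtain ⟨l', hl', h', hex⟩ := ha
  have := h.prefix_listPow h' hl' hex
  rw [not_hasExit_iff] at hex ⊢
  exact fun e he => hex e (mem_of_mem_listPow (this.subset he))

theorem IsNoExit.reaches {a b : F} (ha : IsNoExit a) (h : Reaches a b) : Reaches b a := by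
  obtain ⟨l', hl', h', hex⟩ := ha
  obtain ⟨l, hl⟩ := h.exists_isWalk
  obtain ⟨l'', h''⟩ := hl.prefix_listPow h' hl' hex
  have := h'.listPow l.length
  rw [← h'', isWalk_append] at this
  obtain ⟨c, h1, h2⟩ := this
  obtain rfl := hl.target_unique h1
  exact h2.reaches

/-- A shortest non-empty closed path at `a`, where `a` is a vertex none of whose paths has an
exit. -/
structure IsLoop (a : F) (l : List (Quiver.Total F)) : Prop where
  isNoExit : IsNoExit a
  ne_nil : l ≠ []
  isWalk : IsWalk a l a
  length_le : ∀ l', IsWalk a l' a → l' ≠ [] → l.length ≤ l'.length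

theorem IsNoExit.exists_isLoop {a : F} (ha : IsNoExit a) :
    ∃ l : List (Quiver.Total F), IsLoop a l := by
  classical
  have hex : ∃ n, ∃ l : List (Quiver.Total F), l ≠ [] ∧ IsWalk a l a ∧ l.length = n := by
    obtain ⟨l, hl, hw, -⟩ := ha
    exact ⟨_, l, hl, hw, rfl⟩
  obtain ⟨l, hl, hw, hmin⟩ := Nat.find_spec hex
  exact ⟨l, ha, hl, hw, fun l' h h' => hmin ▸ Nat.find_min' hex ⟨l', h', h, rfl⟩⟩

theorem IsLoop.eq_listPow {a : F} {l l' : List (Quiver.Total F)} (hl : IsLoop a l)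
    (h' : IsWalk a l' a) : ∃ n, l' = listPow l n := by
  induction hn : l'.length using Nat.strong_induction_on generalizing l' with
  | _ n ih =>
    by_cases h0 : l' = []
    · exact ⟨0, h0⟩
    · obtain ⟨l'', rfl⟩ := hl.isWalk.prefix_of_not_hasExit h' (hl.isNoExit.not_hasExit h')
        (hl.length_le l' h' h0)
      obtain ⟨b, h1, h2⟩ := isWalk_append.1 h'
      obtain rfl := hl.isWalk.target_unique h1
      have hpos : 0 < l.length := List.length_pos_iff.2 hl.ne_nil
      obtain ⟨m, rfl⟩ := ih l''.length (by rw [← hn, List.length_append]; omega) h2 rfl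
      exact ⟨m + 1, (listPow_succ _ _).symm⟩

theorem IsWalk.isChain {a b : F} {l : List (Quiver.Total F)} (h : IsWalk a l b) :
    l.IsChain fun e f => e.right = f.left := by
  induction l generalizing a with
  | nil => exact .nil
  | cons e l ih =>
    cases l with
    | nil => exact .singleton _
    | cons f l => exact .cons_cons h.2.1.symm (ih h.2)

theorem IsWalk.head_left {a b : F} {l : List (Quiver.Total F)} (h : IsWalk a l b) (hl : l ≠ []) :
    (l.head hl).left = a := by
  cases l with
  | nil => exact (hl rfl).elim
  | cons e l => exact h.1

theorem IsWalk.getLast_right {a b : F} {l : List (Quiver.Total F)} (h : IsWalk a l b)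
    (hl : l ≠ []) : (l.getLast hl).right = b := by
  induction l generalizing a with
  | nil => exact (hl rfl).elim
  | cons e l ih =>
    cases l with
    | nil => exact h.2
    | cons f l => exact ih h.2 (by simp)

theorem isWalk_of_isChain {l : List (Quiver.Total F)}
    (h : l.IsChain fun e f => e.right = f.left) (hl : l ≠ []) :
    IsWalk (l.head hl).left l (l.getLast hl).right := by
  induction l with
  | nil => exact (hl rfl).elim
  | cons e l ih =>
    cases l with
    | nil => exact ⟨rfl, rfl⟩
    | cons f l =>
      rw [List.isChain_cons_cons] at h
      exact ⟨rfl, h.1 ▸ ih h.2 (by simp)⟩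

theorem IsNoExit.not_conditionL {a : F} (ha : IsNoExit a) : ¬ ConditionL F := by
  intro hL
  obtain ⟨l, -, hl, hw, hmin⟩ := ha.exists_isLoop
  refine ha.not_hasExit hw (hL l ⟨hw.isChain, ⟨hl, ?_⟩, ?_⟩)
  · rw [hw.getLast_right, hw.head_left]
  · by_contra hnd
    obtain ⟨l₁, x, l₂, y, l₃, rfl, hxy⟩ := exists_append_of_not_nodup_map hnd
    rw [List.append_assoc, isWalk_append] at hw
    obtain ⟨b, h1, h2⟩ := hw
    obtain ⟨c, -, h3⟩ := isWalk_append.1 h2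
    have h4 : IsWalk b (y :: l₃) a := ⟨hxy.symm.trans h2.1, h3.2⟩
    have := hmin _ (h1.append h4) (by simp)
    simp only [List.length_append, List.length_cons] at this
    omega

theorem conditionL_of_forall_not_isNoExit (h : ∀ a : F, ¬ IsNoExit a) : ConditionL F := by
  rintro l ⟨h1, ⟨hl, h2⟩, -⟩
  by_contra hex
  have := isWalk_of_isChain h1 hl
  rw [h2] at this
  exact h _ ⟨l, hl, this, hex⟩

end NoExit

namespace CKFamily

variable {K : Type w} [Field K] {F : Type u} [Quiver.{v} F] {A : Type*}
    [NonUnitalRing A] [Module K A] [IsScalarTower K A A] [SMulCommClass K A A]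
    (Φ : CKFamily K F A)

theorem s_mul_t_of_unique {e : Quiver.Total F}
    (h : ∀ f : Quiver.Total F, f.left = e.left → f = e) : Φ.s e * Φ.t e = Φ.p e.left := by
  obtain ⟨a, b, e⟩ := e
  let _ : Unique (Quiver.Star a) :=
    { default := ⟨b, e⟩
      uniq := by
        rintro ⟨c, f⟩
        simpa using h ⟨a, c, f⟩ rfl }
  rw [← Φ.finsum_s_mul_t a ⟨inferInstance, inferInstance⟩, finsum_unique]
  rfl

theorem real_mul_ghost_of_not_hasExit {a b : F} {l : List (Quiver.Total F)} (h : IsWalk a l b)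
    (hl : ¬ HasExit l) : Φ.real l b * Φ.ghost l b = Φ.p a := by
  induction l generalizing a with
  | nil => obtain rfl := h; exact Φ.p_mul_self a
  | cons e l ih =>
    rw [not_hasExit_iff] at hl
    have := ih h.2 (not_hasExit_iff.2 fun e he => hl e (by simp [he]))
    rw [real_cons, ghost_cons, mul_assoc, ← mul_assoc (Φ.real l b), this, Φ.p_mul_t,
      Φ.s_mul_t_of_unique (hl e (by simp)), h.1]

theorem real_mul_ghost_eq {a b b' : F} (ha : IsNoExit a) {α β α' β' : List (Quiver.Total F)}
    (hα : IsWalk a α b) (hβ : IsWalk a β b) (hα' : IsWalk a α' b') (hβ' : IsWalk a β' b')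
    (h : (α.length : ℤ) - β.length = α'.length - β'.length) (hle : α.length ≤ α'.length) :
    Φ.real α b * Φ.ghost β b = Φ.real α' b' * Φ.ghost β' b' := by
  obtain ⟨γ, rfl⟩ := hα.prefix_of_not_hasExit hα' (ha.not_hasExit hα') hle
  obtain ⟨γ', rfl⟩ := hβ.prefix_of_not_hasExit hβ' (ha.not_hasExit hβ') (by omega)
  obtain ⟨c, h1, h2⟩ := isWalk_append.1 hα'
  obtain rfl := hα.target_unique h1
  obtain ⟨c, h3, h4⟩ := isWalk_append.1 hβ'
  obtain rfl := hβ.target_unique h3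
  have hγ : ¬ HasExit γ := by
    have := ha.not_hasExit hα'
    rw [not_hasExit_iff] at this ⊢
    exact fun e he => this e (by simp [he])
  have hlen : γ'.length = γ.length := by
    simp only [List.length_append] at h
    omega
  obtain rfl : γ' = γ := (h4.prefix_of_not_hasExit h2 hγ hlen.le).eq_of_length hlen
  rw [← Φ.real_mul_real h2, ← Φ.ghost_mul_ghost h2, mul_assoc, ← mul_assoc (Φ.real γ' b'),
    Φ.real_mul_ghost_of_not_hasExit h2 hγ, Φ.p_mul_ghost]

theorem p_mul_mul_p_mem_span_of_mem_deg (a b : F) {n : ℤ} {x : A} (hx : x ∈ Φ.deg n) :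
    Φ.p a * x * Φ.p b ∈ Submodule.span K {y | ∃ (c : F) (α β : List (Quiver.Total F)),
      IsWalk a α c ∧ IsWalk b β c ∧ (α.length : ℤ) - β.length = n ∧
        y = Φ.real α c * Φ.ghost β c} := by
  induction hx using Submodule.span_induction with
  | mem y hy =>
    obtain ⟨a', b', c, α, β, hα, hβ, hn, rfl⟩ := hy
    rw [← mul_assoc, mul_assoc]
    by_cases ha : a = a'
    · by_cases hb : b' = b
      · subst ha hb
        rw [Φ.p_mul_real hα, Φ.ghost_mul_p hβ]
        exact Submodule.subset_span ⟨c, α, β, hα, hβ, hn, rfl⟩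
      · rw [Φ.ghost_mul_p_of_ne hβ hb, mul_zero]
        exact zero_mem _
    · rw [Φ.p_mul_real_of_ne hα ha, zero_mul]
      exact zero_mem _
  | zero => rw [mul_zero, zero_mul]; exact zero_mem _
  | add x y _ _ hx hy => rw [mul_add, add_mul]; exact add_mem hx hy
  | smul k x _ hx => rw [mul_smul_comm, smul_mul_assoc]; exact Submodule.smul_mem _ _ hx

theorem p_mul_mul_p_mem_span (a b : F) (x : A) :
    Φ.p a * x * Φ.p b ∈ Submodule.span K {y | ∃ (c : F) (α β : List (Quiver.Total F)),
      IsWalk a α c ∧ IsWalk b β c ∧ y = Φ.real α c * Φ.ghost β c} := by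
  have hx : x ∈ ⨆ n, Φ.deg n := Φ.iSup_deg_eq_top ▸ Submodule.mem_top
  induction hx using Submodule.iSup_induction' with
  | mem n x hx =>
    refine Submodule.span_mono ?_ (Φ.p_mul_mul_p_mem_span_of_mem_deg a b hx)
    rintro _ ⟨c, α, β, hα, hβ, -, rfl⟩
    exact ⟨c, α, β, hα, hβ, rfl⟩
  | zero => rw [mul_zero, zero_mul]; exact zero_mem _
  | add x y _ _ hx hy => rw [mul_add, add_mul]; exact add_mem hx hy

theorem exists_eq_smul_real_mul_ghost {a : F} (ha : IsNoExit a) {n : ℤ} {x : A}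
    (hx : x ∈ Φ.deg n) (hxa : Φ.p a * x * Φ.p a = x) (h0 : x ≠ 0) :
    ∃ (k : K) (b : F) (α β : List (Quiver.Total F)),
      k ≠ 0 ∧ IsWalk a α b ∧ IsWalk a β b ∧ x = k • (Φ.real α b * Φ.ghost β b) := by
  have hspan := Φ.p_mul_mul_p_mem_span_of_mem_deg a a hx
  rw [hxa] at hspan
  set s := {y | ∃ (c : F) (α β : List (Quiver.Total F)), IsWalk a α c ∧ IsWalk a β c ∧
    (α.length : ℤ) - β.length = n ∧ y = Φ.real α c * Φ.ghost β c}
  have hsub : s.Subsingleton := by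
    rintro _ ⟨b, α, β, hα, hβ, hn, rfl⟩ _ ⟨b', α', β', hα', hβ', hn', rfl⟩
    rcases le_total α.length α'.length with h | h
    · exact Φ.real_mul_ghost_eq ha hα hβ hα' hβ' (hn.trans hn'.symm) h
    · exact (Φ.real_mul_ghost_eq ha hα' hβ' hα hβ (hn'.trans hn.symm) h).symm
  rcases hsub.eq_empty_or_singleton with hs | ⟨y, hs⟩
  · rw [hs, Submodule.span_empty, Submodule.mem_bot] at hspan
    exact (h0 hspan).elim
  · obtain ⟨b, α, β, hα, hβ, -, rfl⟩ : y ∈ s := hs ▸ rfl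
    rw [hs] at hspan
    obtain ⟨k, rfl⟩ := Submodule.mem_span_singleton.1 hspan
    exact ⟨k, b, α, β, fun hk => h0 (by rw [hk, zero_smul]), hα, hβ, rfl⟩

theorem exists_reduces_p_of_mem_deg (hp : ∀ a, Φ.p a ≠ 0) {n : ℤ} {x : A} (hx : x ∈ Φ.deg n)
    (h0 : x ≠ 0) : ∃ a, Φ.Reduces x (Φ.p a) := by
  obtain ⟨a, h | ⟨ha, y, hy, hya, h⟩⟩ := Φ.exists_reduces hp h0
  · exact ⟨a, h⟩
  · obtain ⟨m, hm⟩ := h.exists_mem_deg hx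
    obtain ⟨k, b, α, β, hk, hα, hβ, rfl⟩ := Φ.exists_eq_smul_real_mul_ghost ha hm hya hy
    have h' := (h.mul_left (Φ.ghost_mem_deg hα)).mul_right (Φ.real_mem_deg hβ)
    refine ⟨b, reduces_p_of_smul hk ?_⟩
    rwa [mul_smul_comm, smul_mul_assoc, ← mul_assoc, Φ.ghost_mul_real_self hα, mul_assoc,
      Φ.ghost_mul_real_self hβ, Φ.p_mul_self] at h'

end CKFamily

section Ideals

variable {R S : Type*} [NonUnitalRing R] [NonUnitalRing S] {P : TwoSidedIdeal R}

theorem IsPrimeIdeal.mem_or_mem (hP : IsPrimeIdeal P) {x y : R}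
    (h : ∀ z, x * z * y ∈ P) : x ∈ P ∨ y ∈ P := by
  let A : TwoSidedIdeal R := .mk' {a | ∀ z, a * z * y ∈ P}
    (fun z => by simp only [zero_mul, P.zero_mem])
    (fun ha hb z => by rw [add_mul, add_mul]; exact P.add_mem (ha z) (hb z))
    (fun ha z => by rw [neg_mul, neg_mul]; exact P.neg_mem (ha z))
    (fun hb z => by rw [mul_assoc, mul_assoc, ← mul_assoc _ z]; exact P.mul_mem_left _ _ (hb z))
    (fun ha z => by rw [mul_assoc _ _ z]; exact ha _)
  let B : TwoSidedIdeal R := .mk' {b | ∀ a ∈ A, ∀ z, a * z * b ∈ P}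
    (fun a _ z => by rw [mul_zero]; exact P.zero_mem)
    (fun hb hc a ha z => by rw [mul_add]; exact P.add_mem (hb a ha z) (hc a ha z))
    (fun hb a ha z => by rw [mul_neg]; exact P.neg_mem (hb a ha z))
    (fun {c _} hb a ha z => by rw [← mul_assoc, mul_assoc a]; exact hb a ha (z * c))
    (fun hb a ha z => by rw [← mul_assoc]; exact P.mul_mem_right _ _ (hb a ha z))
  let D : TwoSidedIdeal R := .mk' {d | ∀ b ∈ B, d * b ∈ P}
    (fun b _ => by rw [zero_mul]; exact P.zero_mem)
    (fun hc hd b hb => by rw [add_mul]; exact P.add_mem (hc b hb) (hd b hb))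
    (fun hd b hb => by rw [neg_mul]; exact P.neg_mem (hd b hb))
    (fun hd b hb => by rw [mul_assoc]; exact P.mul_mem_left _ _ (hd b hb))
    (fun hd b hb => by rw [mul_assoc]; exact hd _ (B.mul_mem_left _ _ hb))
  have mem_A : ∀ a, a ∈ A ↔ ∀ z, a * z * y ∈ P := fun a => by simp [A]
  have mem_B : ∀ b, b ∈ B ↔ ∀ a ∈ A, ∀ z, a * z * b ∈ P := fun b => by simp [B]
  have mem_D : ∀ d, d ∈ D ↔ ∀ b ∈ B, d * b ∈ P := fun d => by simp [D]
  rcases hP.2 D B fun d hd b hb => (mem_D d).1 hd b hb with hDP | hBP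
  · have hAtop : A ≤ P ∨ ⊤ ≤ P := hP.2 A ⊤ fun a ha z _ =>
      hDP ((mem_D _).2 fun b hb => (mem_B b).1 hb a ha z)
    exact .inl (hAtop.resolve_right (fun h => hP.1 (top_le_iff.1 h)) ((mem_A x).2 h))
  · exact .inr (hBP ((mem_B y).2 fun a ha => (mem_A a).1 ha))

theorem IsPrimeIdeal.exists_mul_mul_notMem (hP : IsPrimeIdeal P) {x y : R} (hx : x ∉ P)
    (hy : y ∉ P) : ∃ z, x * z * y ∉ P := by
  by_contra! h
  exact (hP.mem_or_mem h).elim hx hy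

theorem exists_isPrimeIdeal {N : TwoSidedIdeal R} {e : R} (he : IsIdempotentElem e)
    (heN : e ∉ N) : ∃ Q, IsPrimeIdeal Q ∧ N ≤ Q ∧ e ∉ Q := by
  have chain_bound : ∀ c ⊆ {Q : TwoSidedIdeal R | e ∉ Q}, IsChain (· ≤ ·) c → ∀ y ∈ c,
      ∃ ub ∈ {Q : TwoSidedIdeal R | e ∉ Q}, ∀ Q ∈ c, Q ≤ ub := by
    intro c hc hchain y hy
    let U : TwoSidedIdeal R := .mk' {x | ∃ Q ∈ c, x ∈ Q}
      ⟨y, hy, y.zero_mem⟩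
      (by
        rintro a b ⟨Q, hQ, ha⟩ ⟨Q', hQ', hb⟩
        rcases hchain.total hQ hQ' with h | h
        · exact ⟨Q', hQ', Q'.add_mem (h ha) hb⟩
        · exact ⟨Q, hQ, Q.add_mem ha (h hb)⟩)
      (by rintro a ⟨Q, hQ, ha⟩; exact ⟨Q, hQ, Q.neg_mem ha⟩)
      (by rintro a b ⟨Q, hQ, ha⟩; exact ⟨Q, hQ, Q.mul_mem_left _ _ ha⟩)
      (by rintro a b ⟨Q, hQ, ha⟩; exact ⟨Q, hQ, Q.mul_mem_right _ _ ha⟩)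
    have mem_U : ∀ x, x ∈ U ↔ ∃ Q ∈ c, x ∈ Q := fun x => by simp [U]
    refine ⟨U, fun h => ?_, fun Q hQ x hx => (mem_U x).2 ⟨Q, hQ, hx⟩⟩
    obtain ⟨Q, hQ, heQ⟩ := (mem_U e).1 h
    exact hc hQ heQ
  obtain ⟨Q, hNQ, hQ⟩ := zorn_le_nonempty₀ _ chain_bound N heN
  have heQ : e ∉ Q := hQ.prop
  have exists_add_eq : ∀ A : TwoSidedIdeal R, ¬ A ≤ Q → ∃ a ∈ A, ∃ q ∈ Q, a + q = e := by
    intro A hA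
    by_contra hcon
    have heAQ : e ∉ A ⊔ Q := fun h => hcon (TwoSidedIdeal.mem_sup.1 h)
    exact hA (le_sup_left.trans (hQ.le_of_ge (y := A ⊔ Q) heAQ le_sup_right))
  refine ⟨Q, ⟨fun hQtop => heQ (hQtop ▸ TwoSidedIdeal.mem_top R), fun A B hAB => ?_⟩, hNQ, heQ⟩
  by_contra! hcon
  obtain ⟨a, ha, q, hq, hae⟩ := exists_add_eq A hcon.1
  obtain ⟨b, hb, r, hr, hbe⟩ := exists_add_eq B hcon.2
  have heq : e = a * b + a * r + q * e := by
    rw [← mul_add, hbe, ← add_mul, hae, he.eq]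
  rw [heq] at heQ
  exact heQ (Q.add_mem (Q.add_mem (hAB a ha b hb) (Q.mul_mem_left _ _ hr))
    (Q.mul_mem_right _ _ hq))

theorem IsLocallyClosed.exists_forall_mem (h : IsLocallyClosed P) :
    ∃ y ∉ P, ∀ Q, IsPrimeIdeal Q → P < Q → y ∈ Q := by
  have hle : P ≤ sInf {Q | IsPrimeIdeal Q ∧ P < Q} := le_sInf fun _ hQ => hQ.2.le
  obtain ⟨y, hy, hyP⟩ := SetLike.exists_of_lt (lt_of_le_of_ne hle h)
  exact ⟨y, hyP, fun Q hQ hPQ => (TwoSidedIdeal.mem_sInf _).1 hy Q ⟨hQ, hPQ⟩⟩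

theorem IsCompletelyIrreducible.isLocallyClosed (h : IsCompletelyIrreducible P) :
    IsLocallyClosed P := fun heq =>
  h (le_antisymm (le_sInf fun _ hQ => hQ.le)
    ((sInf_le_sInf fun _ hQ => hQ.2).trans heq.ge))

theorem isCompletelyIrreducible_iff_exists_maximal :
    IsCompletelyIrreducible P ↔ ∃ a : R, Maximal (fun J : TwoSidedIdeal R => a ∉ J) P := by
  constructor
  · intro h
    have hle : P ≤ sInf {J | P < J} := le_sInf fun _ hQ => hQ.le
    obtain ⟨a, ha, haP⟩ := SetLike.exists_of_lt (lt_of_le_of_ne hle h)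
    refine ⟨a, haP, fun J haJ hPJ => ?_⟩
    by_contra hJP
    exact haJ ((TwoSidedIdeal.mem_sInf _).1 ha J (lt_of_le_not_ge hPJ hJP))
  · rintro ⟨a, ha⟩ heq
    refine ha.prop ?_
    rw [heq, TwoSidedIdeal.mem_sInf]
    intro J hJ
    by_contra haJ
    exact ha.not_prop_of_gt hJ haJ

theorem exists_mem_ne_zero_of_ne_bot (hP : P ≠ ⊥) : ∃ x ∈ P, x ≠ 0 := by
  by_contra! h
  exact hP (eq_bot_iff.2 fun x hx => (TwoSidedIdeal.mem_bot R).2 (h x hx))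

section Comap

variable {f : R →ₙ+* S} (hf : Function.Surjective f)
include hf

theorem exists_comap_eq {I : TwoSidedIdeal R} (hI : ∀ x, f x = 0 → x ∈ I) :
    ∃ J : TwoSidedIdeal S, J.comap f = I := by
  have mem_of_map_eq : ∀ x y, f x = f y → x ∈ I → y ∈ I := fun x y hxy hx => by
    have := I.sub_mem hx (hI (x - y) (by rw [map_sub, hxy, sub_self]))
    rwa [sub_sub_cancel] at this
  refine ⟨.mk' (f '' I) ⟨0, I.zero_mem, map_zero _⟩ ?_ ?_ ?_ ?_, ?_⟩
  · rintro _ _ ⟨x, hx, rfl⟩ ⟨y, hy, rfl⟩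
    exact ⟨x + y, I.add_mem hx hy, map_add _ _ _⟩
  · rintro _ ⟨x, hx, rfl⟩
    exact ⟨-x, I.neg_mem hx, map_neg _ _⟩
  · rintro x _ ⟨y, hy, rfl⟩
    obtain ⟨x, rfl⟩ := hf x
    exact ⟨x * y, I.mul_mem_left _ _ hy, map_mul _ _ _⟩
  · rintro _ y ⟨x, hx, rfl⟩
    obtain ⟨y, rfl⟩ := hf y
    exact ⟨x * y, I.mul_mem_right _ _ hx, map_mul _ _ _⟩
  · ext x
    exact (TwoSidedIdeal.mem_comap f).trans <| (TwoSidedIdeal.mem_mk' _ _ _ _ _ _ _).trans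
      ⟨fun ⟨y, hy, hyx⟩ => mem_of_map_eq y x hyx hy, fun hx => ⟨x, hx, rfl⟩⟩

theorem comap_le_comap_iff {I J : TwoSidedIdeal S} : I.comap f ≤ J.comap f ↔ I ≤ J := by
  refine ⟨fun h y hy => ?_, fun h => TwoSidedIdeal.comap_le_comap f h⟩
  obtain ⟨x, rfl⟩ := hf y
  exact (TwoSidedIdeal.mem_comap f).1 (h ((TwoSidedIdeal.mem_comap f).2 hy))

theorem comap_lt_comap_iff {I J : TwoSidedIdeal S} : I.comap f < J.comap f ↔ I < J := by
  rw [lt_iff_le_not_ge, lt_iff_le_not_ge, comap_le_comap_iff hf, comap_le_comap_iff hf]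

theorem comap_injective : Function.Injective (TwoSidedIdeal.comap f) := fun _ _ h =>
  le_antisymm ((comap_le_comap_iff hf).1 h.le) ((comap_le_comap_iff hf).1 h.ge)

theorem exists_comap_eq_of_comap_le {J : TwoSidedIdeal S} {Q : TwoSidedIdeal R}
    (h : J.comap f ≤ Q) : ∃ J' : TwoSidedIdeal S, J'.comap f = Q :=
  exists_comap_eq hf fun _ hx => h ((TwoSidedIdeal.mem_comap f).2 (hx ▸ J.zero_mem))

theorem isPrimeIdeal_comap_iff {J : TwoSidedIdeal S} :
    IsPrimeIdeal (J.comap f) ↔ IsPrimeIdeal J := by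
  constructor
  · refine fun h => ⟨?_, fun A B hAB => ?_⟩
    · rintro rfl
      exact h.1 (top_le_iff.1 fun _ _ => (TwoSidedIdeal.mem_comap f).2 (TwoSidedIdeal.mem_top S))
    · simp only [← comap_le_comap_iff hf]
      refine h.2 _ _ fun a ha b hb => ?_
      simp only [TwoSidedIdeal.mem_comap] at ha hb
      rw [TwoSidedIdeal.mem_comap, map_mul]
      exact hAB _ ha _ hb
  · refine fun h => ⟨fun htop => h.1 (comap_injective hf (htop.trans ?_)), fun A B hAB => ?_⟩
    · exact (top_le_iff.1 fun _ _ => (TwoSidedIdeal.mem_comap f).2 (TwoSidedIdeal.mem_top S)).symm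
    · by_contra! hcon
      obtain ⟨a, ha, haJ⟩ := SetLike.not_le_iff_exists.1 hcon.1
      obtain ⟨b, hb, hbJ⟩ := SetLike.not_le_iff_exists.1 hcon.2
      obtain ⟨z, hz⟩ := h.exists_mul_mul_notMem (mt (TwoSidedIdeal.mem_comap f).2 haJ)
        (mt (TwoSidedIdeal.mem_comap f).2 hbJ)
      obtain ⟨z, rfl⟩ := hf z
      rw [← map_mul, ← map_mul, ← TwoSidedIdeal.mem_comap] at hz
      exact hz (hAB _ (A.mul_mem_right _ _ ha) _ hb)

theorem comap_eq_sInf_iff {J : TwoSidedIdeal S} {s : Set (TwoSidedIdeal R)}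
    {t : Set (TwoSidedIdeal S)} (hs : ∀ Q ∈ s, J.comap f ≤ Q)
    (hst : ∀ J' : TwoSidedIdeal S, J'.comap f ∈ s ↔ J' ∈ t) :
    J.comap f = sInf s ↔ J = sInf t := by
  have hcomap : sInf s = (sInf t).comap f := by
    ext x
    simp only [TwoSidedIdeal.mem_comap, TwoSidedIdeal.mem_sInf]
    refine ⟨fun h J' hJ' => (TwoSidedIdeal.mem_comap f).1 (h _ ((hst J').2 hJ')), fun h Q hQ => ?_⟩
    obtain ⟨J', rfl⟩ := exists_comap_eq_of_comap_le hf (hs Q hQ)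
    exact (TwoSidedIdeal.mem_comap f).2 (h J' ((hst J').1 hQ))
  rw [hcomap, (comap_injective hf).eq_iff]

theorem isCompletelyIrreducible_comap_iff {J : TwoSidedIdeal S} :
    IsCompletelyIrreducible (J.comap f) ↔ IsCompletelyIrreducible J :=
  (comap_eq_sInf_iff hf (fun _ h => le_of_lt h) fun _ => comap_lt_comap_iff hf).not

theorem isLocallyClosed_comap_iff {J : TwoSidedIdeal S} :
    IsLocallyClosed (J.comap f) ↔ IsLocallyClosed J :=
  (comap_eq_sInf_iff hf (fun _ h => h.2.le) fun _ =>
    and_congr (isPrimeIdeal_comap_iff hf) (comap_lt_comap_iff hf)).not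

end Comap

end Ideals

namespace CKFamily

variable {K : Type w} [Field K] {F : Type u} [Quiver.{v} F] {A : Type*}
    [NonUnitalRing A] [Module K A] [IsScalarTower K A A] [SMulCommClass K A A]
    (Φ : CKFamily K F A) {a : F} {l : List (Quiver.Total F)}

open Polynomial

/-- Evaluation of polynomials at a closed path `l` at `a`, with values in the corner at `a`. -/
def polyEval (a : F) (l : List (Quiver.Total F)) : K[X] →ₗ[K] A :=
  Polynomial.lsum fun n => LinearMap.toSpanSingleton K A (Φ.real (listPow l n) a)

theorem polyEval_monomial (a : F) (l : List (Quiver.Total F)) (n : ℕ) (k : K) :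
    Φ.polyEval a l (monomial n k) = k • Φ.real (listPow l n) a := by
  simp [polyEval, Polynomial.lsum_apply, Polynomial.sum_monomial_index]

theorem polyEval_X_pow (a : F) (l : List (Quiver.Total F)) (n : ℕ) :
    Φ.polyEval a l (X ^ n) = Φ.real (listPow l n) a := by
  rw [← monomial_one_right_eq_X_pow, polyEval_monomial, one_smul]

theorem polyEval_one (a : F) (l : List (Quiver.Total F)) : Φ.polyEval a l 1 = Φ.p a :=
  Φ.polyEval_X_pow a l 0

theorem polyEval_mul (h : IsWalk a l a) (f g : K[X]) :
    Φ.polyEval a l (f * g) = Φ.polyEval a l f * Φ.polyEval a l g := by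
  induction f using Polynomial.induction_on' with
  | add f f' hf hf' => rw [add_mul, map_add, map_add, add_mul, hf, hf']
  | monomial m k =>
    induction g using Polynomial.induction_on' with
    | add g g' hg hg' => rw [mul_add, map_add, map_add, mul_add, hg, hg']
    | monomial n k' =>
      rw [monomial_mul_monomial, polyEval_monomial, polyEval_monomial, polyEval_monomial,
        smul_mul_smul_comm, Φ.real_mul_real (h.listPow n), listPow_add]

theorem p_mul_polyEval (h : IsWalk a l a) (f : K[X]) :
    Φ.p a * Φ.polyEval a l f = Φ.polyEval a l f := by
  rw [← Φ.polyEval_one a l, ← Φ.polyEval_mul h, one_mul]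

theorem polyEval_mul_p (h : IsWalk a l a) (f : K[X]) :
    Φ.polyEval a l f * Φ.p a = Φ.polyEval a l f := by
  rw [← Φ.polyEval_one a l, ← Φ.polyEval_mul h, mul_one]

theorem polyEval_X_pow_mul_ghost (h : IsLoop a l) (n : ℕ) :
    Φ.polyEval a l (X ^ n) * Φ.ghost (listPow l n) a = Φ.p a := by
  rw [polyEval_X_pow, Φ.real_mul_ghost_of_not_hasExit (h.isWalk.listPow n)
    (h.isNoExit.not_hasExit (h.isWalk.listPow n))]

/-- The polynomial `f` represents the element `x` of the corner at `a`, up to a power of the closed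
path `l`: if `l` is a loop without exits, the corner consists of the Laurent polynomials in `l`,
and `p a * x * p a` is `f` divided by a power of the variable. -/
def Represents (a : F) (l : List (Quiver.Total F)) (f : K[X]) (x : A) : Prop :=
  ∃ n : ℕ, Φ.p a * x * Φ.polyEval a l (X ^ n) = Φ.polyEval a l f

theorem represents_polyEval (h : IsWalk a l a) (f : K[X]) :
    Φ.Represents a l f (Φ.polyEval a l f) :=
  ⟨0, by rw [pow_zero, polyEval_one, Φ.p_mul_polyEval h, Φ.polyEval_mul_p h]⟩

variable {Φ}

namespace Represents

variable {x y : A} {f g : K[X]}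

theorem of_p_mul_mul_p (h : IsWalk a l a) (hf : Φ.Represents a l f (Φ.p a * x * Φ.p a)) :
    Φ.Represents a l f x := by
  obtain ⟨n, hf⟩ := hf
  refine ⟨n, ?_⟩
  rw [← hf, ← Φ.p_mul_polyEval h (X ^ n)]
  simp only [← mul_assoc, Φ.p_mul_self]
  simp only [mul_assoc, Φ.p_mul_self]

theorem add (h : IsWalk a l a) (hf : Φ.Represents a l f x) (hg : Φ.Represents a l g y) :
    ∃ m n : ℕ, Φ.Represents a l (f * X ^ n + g * X ^ m) (x + y) := by
  obtain ⟨m, hf⟩ := hf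
  obtain ⟨n, hg⟩ := hg
  refine ⟨m, n, m + n, ?_⟩
  rw [map_add, Φ.polyEval_mul h, Φ.polyEval_mul h, ← hf, ← hg, mul_assoc (Φ.p a * x),
    mul_assoc (Φ.p a * y), ← Φ.polyEval_mul h, ← Φ.polyEval_mul h, ← pow_add, ← pow_add,
    add_comm n m, mul_add, add_mul]

theorem neg (hf : Φ.Represents a l f x) : Φ.Represents a l (-f) (-x) := by
  obtain ⟨n, hf⟩ := hf
  exact ⟨n, by rw [map_neg, ← hf, mul_neg, neg_mul]⟩

theorem smul (k : K) (hf : Φ.Represents a l f x) : Φ.Represents a l (k • f) (k • x) := by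
  obtain ⟨n, hf⟩ := hf
  exact ⟨n, by rw [map_smul, ← hf, mul_smul_comm, smul_mul_assoc]⟩

theorem mul (h : IsWalk a l a) (hf : Φ.Represents a l f x) (hg : Φ.Represents a l g y) :
    Φ.Represents a l (f * g) (x * Φ.p a * y) := by
  obtain ⟨m, hf⟩ := hf
  obtain ⟨n, hg⟩ := hg
  refine ⟨m + n, ?_⟩
  calc Φ.p a * (x * Φ.p a * y) * Φ.polyEval a l (X ^ (m + n))
      = Φ.p a * x * (Φ.p a * y * Φ.polyEval a l (X ^ n)) * Φ.polyEval a l (X ^ m) := by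
        rw [add_comm, pow_add, Φ.polyEval_mul h]; simp only [mul_assoc]
    _ = Φ.p a * x * Φ.polyEval a l (X ^ m) * Φ.polyEval a l g := by
        rw [hg, mul_assoc, ← Φ.polyEval_mul h, mul_comm g, Φ.polyEval_mul h, ← mul_assoc]
    _ = Φ.polyEval a l (f * g) := by rw [hf, Φ.polyEval_mul h]

theorem p_mul_mul_p_mem_iff (h : IsLoop a l) (hf : Φ.Represents a l f x) {J : TwoSidedIdeal A} :
    Φ.p a * x * Φ.p a ∈ J ↔ Φ.polyEval a l f ∈ J := by
  obtain ⟨n, hf⟩ := hf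
  constructor <;> intro hJ
  · rw [← hf, ← Φ.p_mul_polyEval h.isWalk, ← mul_assoc]
    exact J.mul_mem_right _ _ hJ
  · rw [← Φ.polyEval_X_pow_mul_ghost h n, ← mul_assoc, Φ.polyEval_X_pow_mul_ghost h n, hf]
    exact J.mul_mem_right _ _ hJ

end Represents

variable (Φ)

theorem exists_represents_real_mul_ghost (h : IsLoop a l) {c : F}
    {α β : List (Quiver.Total F)} (hα : IsWalk a α c) (hβ : IsWalk a β c) :
    ∃ f, Φ.Represents a l f (Φ.real α c * Φ.ghost β c) := by
  obtain ⟨γ, hγ⟩ := hβ.prefix_listPow h.isWalk h.ne_nil (h.isNoExit.not_hasExit h.isWalk)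
  obtain ⟨d, hβd, hγd⟩ := isWalk_append.1 (hγ ▸ h.isWalk.listPow β.length)
  obtain rfl := hβ.target_unique hβd
  obtain ⟨n, hn⟩ := h.eq_listPow (hα.append hγd)
  refine ⟨X ^ n, β.length, ?_⟩
  rw [polyEval_X_pow, polyEval_X_pow, ← hγ, ← hn, ← Φ.real_mul_real hγd, ← Φ.real_mul_real hγd,
    ← mul_assoc (Φ.p _), Φ.p_mul_real hα, mul_assoc, ← mul_assoc (Φ.ghost _ _),
    Φ.ghost_mul_real_self hβ, Φ.p_mul_real hγd]

theorem exists_represents (h : IsLoop a l) (x : A) :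
    ∃ f, Φ.Represents a l f x := by
  suffices ∀ y ∈ Submodule.span K {y | ∃ (c : F) (α β : List (Quiver.Total F)),
      IsWalk a α c ∧ IsWalk a β c ∧ y = Φ.real α c * Φ.ghost β c}, ∃ f, Φ.Represents a l f y from
    (this _ (Φ.p_mul_mul_p_mem_span a a x)).imp fun _ => .of_p_mul_mul_p h.isWalk
  intro y hy
  induction hy using Submodule.span_induction with
  | mem y hy =>
    obtain ⟨c, α, β, hα, hβ, rfl⟩ := hy
    exact Φ.exists_represents_real_mul_ghost h hα hβ
  | zero => exact ⟨0, 0, by rw [mul_zero, zero_mul, map_zero]⟩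
  | add x y _ _ hx hy =>
    obtain ⟨f, hf⟩ := hx
    obtain ⟨g, hg⟩ := hy
    obtain ⟨m, n, hfg⟩ := hf.add h.isWalk hg
    exact ⟨_, hfg⟩
  | smul k x _ hx => exact hx.elim fun f hf => ⟨k • f, hf.smul k⟩

/-- The contraction of a two-sided ideal along the evaluation of polynomials at a closed path. -/
def polyIdeal (h : IsWalk a l a) (J : TwoSidedIdeal A) : Ideal K[X] where
  carrier := {f | Φ.polyEval a l f ∈ J}
  add_mem' {f g} hf hg := show Φ.polyEval a l (f + g) ∈ J by
    rw [map_add]; exact J.add_mem hf hg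
  zero_mem' := show Φ.polyEval a l 0 ∈ J by rw [map_zero]; exact J.zero_mem
  smul_mem' f g hg := show Φ.polyEval a l (f * g) ∈ J by
    rw [Φ.polyEval_mul h]; exact J.mul_mem_left _ _ hg

theorem mem_polyIdeal {h : IsWalk a l a} {J : TwoSidedIdeal A} {f : K[X]} :
    f ∈ Φ.polyIdeal h J ↔ Φ.polyEval a l f ∈ J := Iff.rfl

theorem polyIdeal_eq_top_iff {h : IsWalk a l a} {J : TwoSidedIdeal A} :
    Φ.polyIdeal h J = ⊤ ↔ Φ.p a ∈ J := by
  rw [Ideal.eq_top_iff_one, mem_polyIdeal, polyEval_one]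

theorem isPrime_polyIdeal (h : IsLoop a l) {J : TwoSidedIdeal A} (hJ : IsPrimeIdeal J)
    (ha : Φ.p a ∉ J) : (Φ.polyIdeal h.isWalk J).IsPrime := by
  refine ⟨fun htop => ha (Φ.polyIdeal_eq_top_iff.1 htop), fun {f g} hfg => ?_⟩
  refine hJ.mem_or_mem fun z => ?_
  obtain ⟨r, hr⟩ := Φ.exists_represents h z
  have hrep := ((Φ.represents_polyEval h.isWalk f).mul h.isWalk hr).mul h.isWalk
    (Φ.represents_polyEval h.isWalk g)
  have hmem : f * r * g ∈ Φ.polyIdeal h.isWalk J := by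
    rw [mul_right_comm]
    exact Ideal.mul_mem_right _ _ hfg
  have := (hrep.p_mul_mul_p_mem_iff h).2 hmem
  rwa [mul_assoc _ (Φ.p a), Φ.p_mul_polyEval h.isWalk, Φ.polyEval_mul_p h.isWalk, mul_assoc,
    mul_assoc, Φ.polyEval_mul_p h.isWalk, ← mul_assoc, ← mul_assoc,
    Φ.p_mul_polyEval h.isWalk] at this

theorem exists_p_mul_mul_p_notMem {J Q : TwoSidedIdeal A} (hJ : IsPrimeIdeal J)
    (ha : Φ.p a ∉ J) (hJQ : J < Q) : ∃ x ∈ Q, Φ.p a * x * Φ.p a ∉ J := by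
  obtain ⟨y, hyQ, hyJ⟩ := SetLike.exists_of_lt hJQ
  obtain ⟨z, hz⟩ := hJ.exists_mul_mul_notMem ha hyJ
  obtain ⟨z', hz'⟩ := hJ.exists_mul_mul_notMem hz ha
  refine ⟨z * y * z', Q.mul_mem_right _ _ (Q.mul_mem_left _ _ hyQ), ?_⟩
  simpa only [mul_assoc] using hz'

theorem p_mem_of_isPrimeIdeal_lt (h : IsLoop a l) {J Q : TwoSidedIdeal A} (hJ : IsPrimeIdeal J)
    {x : A} (hxJ : x ∈ J) (hx0 : x ≠ 0) (hxa : Φ.p a * x * Φ.p a = x) (hJQ : J < Q) :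
    Φ.p a ∈ Q := by
  by_cases ha : Φ.p a ∈ J
  · exact hJQ.le ha
  obtain ⟨f, hf⟩ := Φ.exists_represents h x
  have hmax : (Φ.polyIdeal h.isWalk J).IsMaximal := by
    refine (Φ.isPrime_polyIdeal h hJ ha).isMaximal fun hbot => hx0 ?_
    have hfJ : f ∈ Φ.polyIdeal h.isWalk J := (hf.p_mul_mul_p_mem_iff h).1 (hxa.symm ▸ hxJ)
    rw [hbot, Ideal.mem_bot] at hfJ
    have := (hf.p_mul_mul_p_mem_iff h (J := ⊥)).2
    rw [hfJ, map_zero, hxa] at this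
    exact (TwoSidedIdeal.mem_bot A).1 (this (zero_mem _))
  obtain ⟨y, hyQ, hyJ⟩ := Φ.exists_p_mul_mul_p_notMem hJ ha hJQ
  obtain ⟨g, hg⟩ := Φ.exists_represents h y
  have hlt : Φ.polyIdeal h.isWalk J < Φ.polyIdeal h.isWalk Q := by
    refine lt_of_le_of_ne (fun r hr => hJQ.le hr) fun heq => hyJ ?_
    have hgQ : g ∈ Φ.polyIdeal h.isWalk Q :=
      (hg.p_mul_mul_p_mem_iff h).1 (Q.mul_mem_right _ _ (Q.mul_mem_left _ _ hyQ))
    exact (hg.p_mul_mul_p_mem_iff h).2 (heq.symm ▸ hgQ : g ∈ Φ.polyIdeal h.isWalk J)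
  exact Φ.polyIdeal_eq_top_iff.1 (hmax.out.2 _ hlt)

/-- The extension of an ideal `I` of `K[X]` along the evaluation at a loop: the elements all of
whose multiples have their corner at `a` represented by a polynomial in `I`. -/
def loopIdeal (h : IsWalk a l a) (I : Ideal K[X]) : TwoSidedIdeal A :=
  .mk' {x | ∀ u v, ∃ f ∈ I, Φ.Represents a l f (u * x * v)}
    (fun u v => ⟨0, I.zero_mem, 0, by simp⟩)
    (fun {x y} hx hy u v => by
      obtain ⟨f, hfI, hf⟩ := hx u v
      obtain ⟨g, hgI, hg⟩ := hy u v
      obtain ⟨m, n, hfg⟩ := hf.add h hg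
      exact ⟨_, I.add_mem (I.mul_mem_right _ hfI) (I.mul_mem_right _ hgI),
        by rw [mul_add u, add_mul _ _ v]; exact hfg⟩)
    (fun {x} hx u v => by
      obtain ⟨f, hfI, hf⟩ := hx u v
      exact ⟨-f, I.neg_mem hfI, by rw [mul_neg, neg_mul]; exact hf.neg⟩)
    (fun {x y} hy u v => by simpa only [mul_assoc] using hy (u * x) v)
    (fun {x y} hx u v => by simpa only [mul_assoc] using hx u (y * v))

theorem mem_loopIdeal {h : IsWalk a l a} {I : Ideal K[X]} {x : A} :
    x ∈ Φ.loopIdeal h I ↔ ∀ u v, ∃ f ∈ I, Φ.Represents a l f (u * x * v) := by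
  simp [loopIdeal]

theorem polyEval_mem_loopIdeal (h : IsLoop a l) {I : Ideal K[X]} {f : K[X]} (hf : f ∈ I) :
    Φ.polyEval a l f ∈ Φ.loopIdeal h.isWalk I := by
  refine Φ.mem_loopIdeal.2 fun u v => ?_
  obtain ⟨r, hr⟩ := Φ.exists_represents h u
  obtain ⟨s, hs⟩ := Φ.exists_represents h v
  refine ⟨r * f * s, I.mul_mem_right _ (I.mul_mem_left _ hf), ?_⟩
  have := (hr.mul h.isWalk (Φ.represents_polyEval h.isWalk f)).mul h.isWalk hs
  rwa [mul_assoc u, Φ.p_mul_polyEval h.isWalk, mul_assoc u, Φ.polyEval_mul_p h.isWalk] at this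

theorem exists_X_pow_mem_of_p_mem_loopIdeal {h : IsWalk a l a} {I : Ideal K[X]}
    (hinj : Function.Injective (Φ.polyEval a l)) (ha : Φ.p a ∈ Φ.loopIdeal h I) :
    ∃ n : ℕ, X ^ n ∈ I := by
  obtain ⟨f, hfI, n, hf⟩ := Φ.mem_loopIdeal.1 ha (Φ.p a) (Φ.p a)
  rw [Φ.p_mul_self, Φ.p_mul_self, Φ.p_mul_self, Φ.p_mul_polyEval h] at hf
  exact ⟨n, hinj hf ▸ hfI⟩

end CKFamily

section StrongCSP

variable {F : Type u} [Quiver.{v} F]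

/-- The vertices reached from `u` by paths of length `n` all of whose edges start at regular
vertices. Their union over `n` is the countable set used to prove the strong countable separation
property. -/
def regularLevel (u : F) : ℕ → Set F
  | 0 => {u}
  | n + 1 => {b | ∃ e : Quiver.Total F, e.left ∈ regularLevel u n ∧ IsRegular e.left ∧ e.right = b}

theorem finite_regularLevel (u : F) (n : ℕ) : (regularLevel u n).Finite := by
  induction n with
  | zero => exact Set.finite_singleton u
  | succ n ih =>
    have hsub : regularLevel u (n + 1) ⊆ ⋃ a ∈ regularLevel u n, {b | IsRegular a ∧
        b ∈ Set.range fun e : Quiver.Star a => e.1} := by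
      rintro _ ⟨e, he, hreg, rfl⟩
      simp only [Set.mem_iUnion]
      exact ⟨e.left, he, hreg, ⟨e.right, e.hom⟩, rfl⟩
    refine (ih.biUnion fun a _ => ?_).subset hsub
    by_cases h : IsRegular a
    · have := h.2
      exact (Set.finite_range _).subset fun b hb => hb.2
    · exact Set.finite_empty.subset fun b hb => h hb.1

theorem reaches_of_mem_regularLevel {u a : F} {n : ℕ} (h : a ∈ regularLevel u n) :
    Reaches u a := by
  induction n generalizing a with
  | zero => obtain rfl := h; exact .refl _
  | succ n ih =>
    obtain ⟨e, he, -, rfl⟩ := h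
    exact (ih he).trans (.of_edge e)

/-- The saturated closure of a set of vertices, as a predicate on vertices. -/
inductive SatClosure (X : Set F) : F → Prop
  | base (a : F) (h : a ∈ X) : SatClosure X a
  | step (a : F) (h : IsRegular a) (h' : ∀ e : Quiver.Star a, SatClosure X e.1) : SatClosure X a

theorem SatClosure.isHereditary {X : Set F} (hX : IsHereditary X) :
    IsHereditary {a | SatClosure X a} := by
  have range_mem : ∀ a, SatClosure X a → ∀ e : Quiver.Star a, SatClosure X e.1 := by
    intro a ha e
    cases ha with
    | base a h => exact .base _ (hX a h _ ⟨e.2.toPath⟩)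
    | step a _ h => exact h e
  rintro a ha b ⟨p⟩
  induction p with
  | nil => exact ha
  | cons _ e ih => exact range_mem _ ih ⟨_, e⟩

theorem SatClosure.isSaturated (X : Set F) : IsSaturated {a | SatClosure X a} :=
  fun a ha h => SatClosure.step a ha h

theorem SatClosure.exists_mem_regularLevel {X : Set F} {u c : F} {n : ℕ} (hc : SatClosure X c)
    (hn : c ∈ regularLevel u n) : ∃ m, ∃ b ∈ regularLevel u m, b ∈ X := by
  induction hc generalizing n with
  | base c h => exact ⟨n, c, hn, h⟩
  | step c hreg _ ih =>
    obtain ⟨e⟩ := hreg.1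
    exact ih e (n := n + 1) ⟨⟨c, e.1, e.2⟩, hn, hreg, rfl⟩

theorem strongCSP_of_forall_mem (hdd : DownwardDirected F) {u : F}
    (hu : ∀ H : Set F, H.Nonempty → IsHereditary H → IsSaturated H → u ∈ H) : StrongCSP F := by
  refine ⟨⋃ n, regularLevel u n,
    ⟨Set.countable_iUnion fun n => (finite_regularLevel u n).countable, fun a => ?_⟩, ?_⟩
  · obtain ⟨x, hax, -⟩ := hdd.2 a u
    have hX : IsHereditary {b : F | Reaches x b} := fun b hb c hc => Reaches.trans hb hc
    have huX : SatClosure {b : F | Reaches x b} u :=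
      hu {a | SatClosure {b : F | Reaches x b} a} ⟨x, .base _ (Reaches.refl x)⟩
        (SatClosure.isHereditary hX) (SatClosure.isSaturated _)
    obtain ⟨n, b, hb, hxb⟩ := huX.exists_mem_regularLevel (n := 0) rfl
    exact ⟨b, Set.mem_iUnion_of_mem n hb, hax.trans hxb⟩
  · intro H hne hH hsat b hb
    obtain ⟨n, hn⟩ := Set.mem_iUnion.1 hb
    exact hH u (hu H hne hH hsat) b (reaches_of_mem_regularLevel hn)

theorem IsNoExit.strongCSP {a : F} (ha : IsNoExit a) (hdd : DownwardDirected F) :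
    StrongCSP F := by
  have reaches_a : ∀ b, Reaches b a := fun b => by
    obtain ⟨c, hbc, hac⟩ := hdd.2 b a
    exact hbc.trans (ha.reaches hac)
  refine ⟨{a}, ⟨Set.countable_singleton a, fun b => ⟨a, rfl, reaches_a b⟩⟩, ?_⟩
  rintro H ⟨b, hb⟩ hH - _ rfl
  exact hH b hb _ (reaches_a b)

end StrongCSP

section Walks

variable {F : Type u} [Quiver.{v} F] {H : Set F}

theorem IsSaturated.exists_isWalk (hsat : IsSaturated H) {a : F} (ha : a ∉ H) (n : ℕ) :
    ∃ γ, ∃ c ∉ H, IsWalk a γ c ∧ (γ.length = n ∨ ¬ IsRegular c) := by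
  induction n with
  | zero => exact ⟨[], a, ha, rfl, .inl rfl⟩
  | succ n ih =>
    obtain ⟨γ, c, hc, hγ, hlen | hreg⟩ := ih
    · by_cases hreg : IsRegular c
      · obtain ⟨e, he⟩ := not_forall.1 (mt (hsat c hreg) hc)
        exact ⟨γ ++ [⟨c, e.1, e.2⟩], e.1, he, hγ.append (isWalk_singleton ⟨c, e.1, e.2⟩),
          .inl (by simp [hlen])⟩
      · exact ⟨γ, c, hc, hγ, .inr hreg⟩
    · exact ⟨γ, c, hc, hγ, .inr hreg⟩

theorem IsHereditary.not_prefix (hH : IsHereditary H) {a b c : F} {α γ : List (Quiver.Total F)}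
    (hα : IsWalk a α c) (hc : c ∈ H) (hγ : IsWalk a γ b) (hb : b ∉ H) : ¬ α <+: γ := by
  rintro ⟨δ, rfl⟩
  exact hb (hH c hc b (hγ.of_append_right hα).reaches)

theorem IsHereditary.exists_isWalk_not_prefix (hH : IsHereditary H) (hsat : IsSaturated H) {a : F}
    (ha : a ∉ H) (T : Finset (List (Quiver.Total F))) :
    ∃ γ b, IsWalk a γ b ∧
      ∀ α ∈ T, ∀ c ∈ H, IsWalk a α c → ¬ α <+: γ ∧ ¬ γ <+: α := by
  obtain ⟨γ, b, hb, hγ, hlen | hreg⟩ := hsat.exists_isWalk ha (T.sup List.length + 1)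
  · refine ⟨γ, b, hγ, fun α hα c hc hac => ⟨hH.not_prefix hac hc hγ hb, fun hpre => ?_⟩⟩
    have := Finset.le_sup (f := List.length) hα
    have := hpre.length_le
    omega
  by_cases hstar : Nonempty (Quiver.Star b)
  · have : Infinite (Quiver.Star b) := not_finite_iff_infinite.1 fun hfin => hreg ⟨hstar, hfin⟩
    have hinj : Function.Injective fun e : Quiver.Star b => (⟨b, e.1, e.2⟩ : Quiver.Total F) := by
      rintro ⟨c, e⟩ ⟨c', e'⟩ h
      simpa using h
    have hused : {e : Quiver.Total F | ∃ α ∈ T, e ∈ α}.Finite :=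
      (T.finite_toSet.biUnion fun α _ => α.finite_toSet).subset fun e ⟨α, hα, he⟩ =>
        Set.mem_biUnion hα he
    obtain ⟨_, ⟨e, rfl⟩, he⟩ := (Set.infinite_range_of_injective hinj).exists_notMem_finite hused
    refine ⟨_, _, hγ.append (isWalk_singleton ⟨b, e.1, e.2⟩), fun α hα c hc hac =>
      ⟨fun hpre => ?_, fun hpre => he ⟨α, hα, hpre.subset (by simp)⟩⟩⟩
    rcases List.prefix_concat_iff.1 hpre with rfl | hpre
    · exact he ⟨_, hα, by simp⟩
    · exact hH.not_prefix hac hc hγ hb hpre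
  · refine ⟨γ, b, hγ, fun α hα c hc hac => ⟨hH.not_prefix hac hc hγ hb, ?_⟩⟩
    rintro ⟨δ, rfl⟩
    cases δ with
    | nil => exact hb ((hac.of_append_right hγ : b = c) ▸ hc)
    | cons e δ =>
      obtain ⟨rfl, -⟩ := hac.of_append_right hγ
      exact hstar ⟨⟨e.right, e.hom⟩⟩

end Walks

namespace CKFamily

variable {K : Type w} [Field K] {F : Type u} [Quiver.{v} F] {A : Type*}
    [NonUnitalRing A] [Module K A] [IsScalarTower K A A] [SMulCommClass K A A]
    (Φ : CKFamily K F A)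

theorem isHereditary_vertices (J : TwoSidedIdeal A) : IsHereditary {a | Φ.p a ∈ J} := by
  intro a ha b hab
  obtain ⟨l, hl⟩ := hab.exists_isWalk
  change Φ.p b ∈ J
  rw [← Φ.ghost_mul_real_self hl, ← Φ.p_mul_real hl]
  exact J.mul_mem_left _ _ (J.mul_mem_right _ _ ha)

theorem isSaturated_vertices (J : TwoSidedIdeal A) : IsSaturated {a | Φ.p a ∈ J} := by
  intro a ha h
  have := ha.2
  cases nonempty_fintype (Quiver.Star a)
  change Φ.p a ∈ J
  rw [← Φ.finsum_s_mul_t a ha, finsum_eq_sum_of_fintype]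
  refine sum_mem fun e _ => ?_
  rw [← Φ.s_mul_p]
  exact J.mul_mem_right _ _ (J.mul_mem_left _ _ (h e))

/-- The right ideal generated by the paths ending in `H`. -/
def rangeSpan (H : Set F) : Submodule K A :=
  Submodule.span K {x | ∃ a α, ∃ c ∈ H, ∃ y, IsWalk a α c ∧ x = Φ.real α c * y}

variable {H : Set F}

theorem mul_p_mul_mem_rangeSpan (hH : IsHereditary H) {c : F} (hc : c ∈ H) (x y : A) :
    x * Φ.p c * y ∈ Φ.rangeSpan H := by
  rw [mul_assoc]
  refine mul_mem_of_mem_span' ?_ (Φ.mem_span_real_mul_ghost x)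
  rintro _ ⟨a, b, d, α, β, hα, hβ, rfl⟩
  rcases eq_or_ne b c with rfl | hbc
  · rw [mul_assoc]
    exact Submodule.subset_span ⟨a, α, d, hH b hc d hβ.reaches, _, hα, rfl⟩
  · rw [mul_assoc, ← mul_assoc (Φ.ghost β d), Φ.ghost_mul_p_of_ne hβ hbc, zero_mul, mul_zero]
    exact zero_mem _

theorem mem_rangeSpan_of_mem_span (hH : IsHereditary H) {x : A}
    (hx : x ∈ TwoSidedIdeal.span (Φ.p '' H)) : x ∈ Φ.rangeSpan H := by
  rw [TwoSidedIdeal.mem_span_iff_mem_addSubgroup_closure_nonunital] at hx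
  refine (AddSubgroup.closure_le (Φ.rangeSpan H).toAddSubgroup).2 ?_ hx
  rintro _ (((⟨c, hc, rfl⟩ | ⟨_, ⟨c, hc, rfl⟩, y, -, rfl⟩) | ⟨y, -, _, ⟨c, hc, rfl⟩, rfl⟩) |
    ⟨_, ⟨y, -, _, ⟨c, hc, rfl⟩, rfl⟩, z, -, rfl⟩) <;> change _ ∈ Φ.rangeSpan H
  · simpa only [Φ.p_mul_self] using Φ.mul_p_mul_mem_rangeSpan hH hc (Φ.p c) (Φ.p c)
  · simpa only [Φ.p_mul_self] using Φ.mul_p_mul_mem_rangeSpan hH hc (Φ.p c) y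
  · simpa only [mul_assoc, Φ.p_mul_self] using Φ.mul_p_mul_mem_rangeSpan hH hc y (Φ.p c)
  · exact Φ.mul_p_mul_mem_rangeSpan hH hc y z

theorem exists_finset_ghost_mul_eq_zero {x : A} (hx : x ∈ Φ.rangeSpan H) :
    ∃ T : Finset (List (Quiver.Total F)), ∀ a γ b, IsWalk a γ b →
      (∀ α ∈ T, ∀ c ∈ H, IsWalk a α c → ¬ α <+: γ ∧ ¬ γ <+: α) → Φ.ghost γ b * x = 0 := by
  classical
  induction hx using Submodule.span_induction with
  | mem x hx =>
    obtain ⟨a', α, c, hc, y, hα, rfl⟩ := hx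
    refine ⟨{α}, fun a γ b hγ hT => ?_⟩
    rw [← mul_assoc]
    rcases eq_or_ne a a' with rfl | ha
    · obtain ⟨h, h'⟩ := hT α (Finset.mem_singleton_self α) c hc hα
      rw [Φ.ghost_mul_real_of_not_prefix hγ hα h' h, zero_mul]
    · rw [← Φ.ghost_mul_p hγ, mul_assoc _ (Φ.p a), Φ.p_mul_real_of_ne hα ha, mul_zero, zero_mul]
  | zero => exact ⟨∅, fun _ _ _ _ _ => mul_zero _⟩
  | add x y _ _ hx hy =>
    obtain ⟨T, hT⟩ := hx
    obtain ⟨T', hT'⟩ := hy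
    refine ⟨T ∪ T', fun a γ b hγ h => ?_⟩
    rw [mul_add, hT a γ b hγ fun α hα => h α (Finset.mem_union_left _ hα),
      hT' a γ b hγ fun α hα => h α (Finset.mem_union_right _ hα), add_zero]
  | smul k x _ hx =>
    obtain ⟨T, hT⟩ := hx
    exact ⟨T, fun a γ b hγ h => by rw [mul_smul_comm, hT a γ b hγ h, smul_zero]⟩

theorem mem_of_p_mem_span (hp : ∀ a, Φ.p a ≠ 0) (hH : IsHereditary H) (hsat : IsSaturated H)
    {a : F} (ha : Φ.p a ∈ TwoSidedIdeal.span (Φ.p '' H)) : a ∈ H := by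
  by_contra haH
  obtain ⟨T, hT⟩ := Φ.exists_finset_ghost_mul_eq_zero (Φ.mem_rangeSpan_of_mem_span hH ha)
  obtain ⟨γ, b, hγ, h⟩ := hH.exists_isWalk_not_prefix hsat haH T
  have := hT a γ b hγ h
  rw [Φ.ghost_mul_p hγ] at this
  exact hp b (by rw [← Φ.ghost_mul_real_self hγ, this, zero_mul])

end CKFamily

open Polynomial in
theorem not_dvd_X_pow {K : Type*} [Field K] {q : K[X]} (hq : q.coeff 0 ≠ 0)
    (hdeg : q.natDegree ≠ 0) (n : ℕ) :
    ¬ q ∣ X ^ n := by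
  intro hdvd
  have hcop : IsCoprime q (X ^ n) :=
    ((irreducible_X.coprime_iff_not_dvd).2 fun h => hq (X_dvd_iff.1 h)).symm.pow_right
  exact hdeg (natDegree_eq_zero_of_isUnit (hcop.isUnit_of_dvd' dvd_rfl hdvd))

namespace CKFamily

open Polynomial

variable {K : Type w} [Field K] {F : Type u} [Quiver.{v} F] {A : Type*}
    [NonUnitalRing A] [Module K A] [IsScalarTower K A A] [SMulCommClass K A A]
    {Φ : CKFamily K F A} {J : TwoSidedIdeal A}

theorem p_mem_or_exists_of_mem (hp : ∀ a, Φ.p a ≠ 0) {x : A} (hx : x ∈ J) (hx0 : x ≠ 0) :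
    (∃ a, Φ.p a ∈ J) ∨ ∃ a x, IsNoExit a ∧ x ∈ J ∧ x ≠ 0 ∧ Φ.p a * x * Φ.p a = x := by
  obtain ⟨a, h | ⟨ha, y, hy0, hya, h⟩⟩ := Φ.exists_reduces hp hx0
  · exact .inl ⟨a, h.mem hx⟩
  · exact .inr ⟨a, y, ha, h.mem hx, hy0, hya⟩

theorem exists_p_mem_of_conditionL (hp : ∀ a, Φ.p a ≠ 0) (hL : ConditionL F) {x : A}
    (hx : x ∈ J) (hx0 : x ≠ 0) : ∃ a, Φ.p a ∈ J :=
  (p_mem_or_exists_of_mem hp hx hx0).resolve_right fun ⟨_, _, ha, _⟩ => ha.not_conditionL hL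

theorem downwardDirected_of_isPrimeIdeal (hJ : IsPrimeIdeal J) (hv : ∀ a, Φ.p a ∉ J) :
    DownwardDirected F := by
  refine ⟨?_, fun a b => ?_⟩
  · by_contra hF
    refine hJ.1 (eq_top_iff.2 fun x _ => ?_)
    rw [Φ.eq_zero_of_forall_mul_p (x := x) (not_nonempty_iff.1 hF).elim]
    exact zero_mem _
  · by_contra! hcon
    obtain ⟨z, hz⟩ := hJ.exists_mul_mul_notMem (hv a) (hv b)
    have hempty : {y | ∃ c α β, IsWalk a α c ∧ IsWalk b β c ∧
        y = Φ.real α c * Φ.ghost β c} = ∅ :=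
      Set.eq_empty_of_forall_notMem fun y ⟨c, α, β, hα, hβ, _⟩ => hcon c hα.reaches hβ.reaches
    have hspan := Φ.p_mul_mul_p_mem_span a b z
    rw [hempty, Submodule.span_empty, Submodule.mem_bot] at hspan
    exact hz (hspan ▸ zero_mem J)

/-- When `J = ⊥`, a vertex of the countable set lies in all non-zero ideals; otherwise `J` meets
the corner at a loop, and the base of the loop lies in all larger ideals. -/
theorem exists_p_mem_of_lt (hp : ∀ a, Φ.p a ≠ 0) (hJ : IsPrimeIdeal J) (hv : ∀ a, Φ.p a ∉ J)
    (hF : Nonempty F) (hbot : J = ⊥ → ConditionL F) (hcsp : StrongCSP F) :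
    ∃ a, ∀ Q, J < Q → Φ.p a ∈ Q := by
  by_cases h0 : J = ⊥
  · obtain ⟨C, ⟨-, hC⟩, hC'⟩ := hcsp
    obtain ⟨c, hc, -⟩ := hC hF.some
    refine ⟨c, fun Q hQ => ?_⟩
    obtain ⟨x, hx, hx0⟩ := exists_mem_ne_zero_of_ne_bot (h0 ▸ hQ).ne'
    obtain ⟨a, ha⟩ := exists_p_mem_of_conditionL hp (hbot h0) hx hx0
    exact hC' {a | Φ.p a ∈ Q} ⟨a, ha⟩ (Φ.isHereditary_vertices Q) (Φ.isSaturated_vertices Q) hc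
  · obtain ⟨y, hy, hy0⟩ := exists_mem_ne_zero_of_ne_bot h0
    obtain ⟨a, x, ha, hxJ, hx0, hxa⟩ :=
      (p_mem_or_exists_of_mem hp hy hy0).resolve_left fun ⟨a, ha⟩ => hv a ha
    obtain ⟨l, hl⟩ := ha.exists_isLoop
    exact ⟨a, fun Q hQ => Φ.p_mem_of_isPrimeIdeal_lt hl hJ hxJ hx0 hxa hQ⟩

theorem isCompletelyIrreducible_of_strongCSP (hp : ∀ a, Φ.p a ≠ 0) (hJ : IsPrimeIdeal J)
    (hv : ∀ a, Φ.p a ∉ J) (hF : Nonempty F) (hbot : J = ⊥ → ConditionL F)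
    (hcsp : StrongCSP F) : IsCompletelyIrreducible J := by
  obtain ⟨a, ha⟩ := exists_p_mem_of_lt hp hJ hv hF hbot hcsp
  intro heq
  have hmem : Φ.p a ∈ sInf {Q | J < Q} := (TwoSidedIdeal.mem_sInf _).2 ha
  exact hv a (heq ▸ hmem)

/-- A prime ideal avoiding the base of a loop but containing a polynomial `X * f + 1` in the loop
cannot contain a corner element represented by `f`. -/
theorem exists_isPrimeIdeal_notMem {a : F} {l : List (Quiver.Total F)} (h : IsLoop a l)
    (hinj : Function.Injective (Φ.polyEval a l)) {x : A} (hx : Φ.p a * x * Φ.p a ≠ 0) :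
    ∃ Q : TwoSidedIdeal A, IsPrimeIdeal Q ∧ ⊥ < Q ∧ x ∉ Q := by
  obtain ⟨f, hf⟩ := Φ.exists_represents h x
  have hf0 : f ≠ 0 := by
    rintro rfl
    have := (hf.p_mul_mul_p_mem_iff h (J := ⊥)).2
    rw [map_zero] at this
    exact hx ((TwoSidedIdeal.mem_bot A).1 (this (zero_mem _)))
  set q : K[X] := X * f + 1 with hq
  have hqdeg : q.natDegree = f.natDegree + 1 := by
    rw [hq, ← C_1, natDegree_add_C, natDegree_X_mul hf0]
  have haN : Φ.p a ∉ Φ.loopIdeal h.isWalk (Ideal.span {q}) := fun ha => by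
    obtain ⟨n, hn⟩ := Φ.exists_X_pow_mem_of_p_mem_loopIdeal hinj ha
    exact not_dvd_X_pow (by simp [hq]) (by omega) n (Ideal.mem_span_singleton.1 hn)
  obtain ⟨Q, hQ, hNQ, haQ⟩ := exists_isPrimeIdeal (Φ.p_mul_self a) haN
  have hqQ : Φ.polyEval a l q ∈ Q :=
    hNQ (Φ.polyEval_mem_loopIdeal h (Ideal.mem_span_singleton_self q))
  refine ⟨Q, hQ, bot_lt_iff_ne_bot.2 fun hbot => ?_, fun hxQ => haQ ?_⟩
  · rw [hbot, TwoSidedIdeal.mem_bot] at hqQ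
    rw [hinj (hqQ.trans (map_zero _).symm), natDegree_zero] at hqdeg
    omega
  · have hfQ : f ∈ Φ.polyIdeal h.isWalk Q :=
      (hf.p_mul_mul_p_mem_iff h).1 (Q.mul_mem_right _ _ (Q.mul_mem_left _ _ hxQ))
    rw [← Φ.polyIdeal_eq_top_iff (h := h.isWalk), Ideal.eq_top_iff_one]
    rw [show (1 : K[X]) = q - X * f by rw [hq]; ring]
    exact Ideal.sub_mem _ hqQ (Ideal.mul_mem_left _ _ hfQ)

theorem conditionL_of_isLocallyClosed_bot (hp : ∀ a, Φ.p a ≠ 0)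
    (hinj : ∀ a l, IsLoop a l → Function.Injective (Φ.polyEval a l))
    (hprime : IsPrimeIdeal (⊥ : TwoSidedIdeal A)) (hlc : IsLocallyClosed (⊥ : TwoSidedIdeal A)) :
    ConditionL F := by
  refine conditionL_of_forall_not_isNoExit fun a ha => ?_
  obtain ⟨l, hl⟩ := ha.exists_isLoop
  obtain ⟨y, hy0, hy⟩ := hlc.exists_forall_mem
  have ha0 : Φ.p a ∉ (⊥ : TwoSidedIdeal A) := fun h => hp a ((TwoSidedIdeal.mem_bot A).1 h)
  obtain ⟨x, hx, hx0⟩ := Φ.exists_p_mul_mul_p_notMem (Q := TwoSidedIdeal.span {y}) hprime ha0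
    (bot_lt_iff_ne_bot.2 fun hbot => hy0 (hbot ▸ TwoSidedIdeal.subset_span rfl))
  obtain ⟨Q, hQ, hQ0, hxQ⟩ := exists_isPrimeIdeal_notMem hl (hinj a l hl)
    fun h => hx0 ((TwoSidedIdeal.mem_bot A).2 h)
  exact hxQ (TwoSidedIdeal.span_le.2 (Set.singleton_subset_iff.2 (hy Q hQ hQ0)) hx)

theorem strongCSP_of_isLocallyClosed_bot (hp : ∀ a, Φ.p a ≠ 0) (hdd : DownwardDirected F)
    (hL : ConditionL F) (hlc : IsLocallyClosed (⊥ : TwoSidedIdeal A)) : StrongCSP F := by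
  obtain ⟨y, hy0, hy⟩ := hlc.exists_forall_mem
  rw [TwoSidedIdeal.mem_bot] at hy0
  obtain ⟨u, hu⟩ := exists_p_mem_of_conditionL (J := TwoSidedIdeal.span {y}) hp hL
    (TwoSidedIdeal.subset_span rfl) hy0
  refine strongCSP_of_forall_mem hdd (u := u) fun H ⟨b, hb⟩ hH hsat => ?_
  by_contra huH
  obtain ⟨Q, hQ, hHQ, huQ⟩ := exists_isPrimeIdeal (Φ.p_mul_self u)
    fun h => huH (Φ.mem_of_p_mem_span hp hH hsat h)
  have hQ0 : ⊥ < Q := bot_lt_iff_ne_bot.2 fun hbot =>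
    hp b ((TwoSidedIdeal.mem_bot A).1 (hbot ▸ hHQ (TwoSidedIdeal.subset_span ⟨b, hb, rfl⟩)))
  exact huQ (TwoSidedIdeal.span_le.2 (Set.singleton_subset_iff.2 (hy Q hQ hQ0)) hu)

theorem strongCSP_of_isLocallyClosed (hp : ∀ a, Φ.p a ≠ 0)
    (hinj : ∀ a l, IsLoop a l → Function.Injective (Φ.polyEval a l)) (hJ : IsPrimeIdeal J)
    (hv : ∀ a, Φ.p a ∉ J) (hlc : IsLocallyClosed J) : StrongCSP F := by
  have hdd := downwardDirected_of_isPrimeIdeal hJ hv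
  rcases eq_or_ne J ⊥ with rfl | h0
  · exact strongCSP_of_isLocallyClosed_bot hp hdd (conditionL_of_isLocallyClosed_bot hp hinj hJ hlc)
      hlc
  · obtain ⟨y, hy, hy0⟩ := exists_mem_ne_zero_of_ne_bot h0
    obtain ⟨a, -, ha, -⟩ := (p_mem_or_exists_of_mem hp hy hy0).resolve_left fun ⟨a, ha⟩ => hv a ha
    exact ha.strongCSP hdd

end CKFamily

section Generators

variable (K : Type w) [Field K] (V : Type u) [Quiver.{v} V]

open Gen

/-- The inclusion of the Leavitt path algebra into the unital algebra with the same presentation. -/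
def toUnital : LeavittPathAlgebra K V →ₙₐ[K] RingQuot (Rel K V) :=
  NonUnitalSubalgebraClass.subtype (NonUnitalAlgebra.adjoin K (Set.range (unitalGen K V)))

theorem toUnital_injective : Function.Injective (toUnital K V) := Subtype.val_injective

theorem toUnital_gen (g : Gen V) : toUnital K V (gen K g) = unitalGen K V g := rfl

variable {K V}

theorem eq_of_rel {r r' : FreeAlgebra K (Gen V)} (h : Rel K V r r') {x y : LeavittPathAlgebra K V}
    (hx : toUnital K V x = RingQuot.mkAlgHom K (Rel K V) r)
    (hy : toUnital K V y = RingQuot.mkAlgHom K (Rel K V) r') : x = y :=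
  toUnital_injective K V (hx.trans ((RingQuot.mkAlgHom_rel K h).trans hy.symm))

theorem adjoin_gen_eq_top :
    NonUnitalAlgebra.adjoin K (Set.range (gen K : Gen V → LeavittPathAlgebra K V)) = ⊤ := by
  rw [eq_top_iff]
  rintro ⟨x, hx⟩ -
  induction hx using NonUnitalAlgebra.adjoin_induction with
  | mem x hx => obtain ⟨g, rfl⟩ := hx; exact NonUnitalAlgebra.subset_adjoin K ⟨g, rfl⟩
  | add x y hx hy h h' => exact add_mem h h'
  | zero => exact zero_mem _
  | mul x y hx hy h h' => exact mul_mem h h'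
  | smul k x hx h => exact SMulMemClass.smul_mem k h

variable (K V)

/-- The generators of the Leavitt path algebra, as a family satisfying the relations. -/
def leavittFamily : CKFamily K V (LeavittPathAlgebra K V) where
  p a := gen K (vertex a)
  s e := gen K (edge e)
  t e := gen K (ghost e)
  p_mul_self a := eq_of_rel (.idem a) (map_mul _ _ _).symm rfl
  p_mul_p_of_ne a b h := eq_of_rel (.orth a b h) (map_mul _ _ _).symm (map_zero _).symm
  p_mul_s e := eq_of_rel (.source_edge e) (map_mul _ _ _).symm rfl
  s_mul_p e := eq_of_rel (.edge_range e) (map_mul _ _ _).symm rfl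
  p_mul_t e := eq_of_rel (.range_ghost e) (map_mul _ _ _).symm rfl
  t_mul_p e := eq_of_rel (.ghost_source e) (map_mul _ _ _).symm rfl
  t_mul_s_self e := eq_of_rel (.ck1_same e) (map_mul _ _ _).symm rfl
  t_mul_s_of_ne e f h := eq_of_rel (.ck1_ne e f h) (map_mul _ _ _).symm (map_zero _).symm
  finsum_s_mul_t a h := by
    have := h.1
    have := h.2
    cases nonempty_fintype (Quiver.Star a)
    rw [finsum_eq_sum_of_fintype]
    refine (eq_of_rel (.ck2 a) rfl ?_).symm
    simp only [map_sum, map_mul, toUnital_gen, unitalGen]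
  adjoin_eq_top := by
    refine eq_top_iff.2 (adjoin_gen_eq_top.ge.trans (NonUnitalAlgebra.adjoin_mono ?_))
    rintro _ ⟨a | e | e, rfl⟩
    exacts [.inl (.inl ⟨a, rfl⟩), .inl (.inr ⟨e, rfl⟩), .inr ⟨e, rfl⟩]

variable {V}

theorem exists_isWalk_of_path {a c : V} (α : Quiver.Path a c) : ∃ l, IsWalk a l c ∧
    l.length = α.length ∧ ofPath K α = (leavittFamily K V).real l c ∧
      ofGhostPath K α = (leavittFamily K V).ghost l c := by
  induction α with
  | nil => exact ⟨[], rfl, rfl, rfl, rfl⟩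
  | @cons b c α e ih =>
    obtain ⟨l, hl, hlen, hreal, hghost⟩ := ih
    refine ⟨l ++ [⟨b, c, e⟩], hl.append (isWalk_singleton ⟨b, c, e⟩), by simp [hlen], ?_, ?_⟩
    · rw [ofPath, hreal]
      exact (leavittFamily K V).real_mul_s ⟨b, c, e⟩
    · rw [ofGhostPath, hghost]
      exact (leavittFamily K V).t_mul_ghost ⟨b, c, e⟩

theorem exists_path_of_isWalk {a c : V} {l : List (Quiver.Total V)} (h : IsWalk a l c) :
    ∃ α : Quiver.Path a c, l.length = α.length ∧ ofPath K α = (leavittFamily K V).real l c ∧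
      ofGhostPath K α = (leavittFamily K V).ghost l c := by
  induction l using List.reverseRecOn generalizing c with
  | nil => obtain rfl := h; exact ⟨.nil, rfl, rfl, rfl⟩
  | append_singleton l e ih =>
    obtain ⟨b, hl, rfl, rfl⟩ := isWalk_append.1 h
    obtain ⟨α, hlen, hreal, hghost⟩ := ih hl
    refine ⟨α.cons e.hom, by simp [hlen], ?_, ?_⟩
    · rw [ofPath, hreal]
      exact (leavittFamily K V).real_mul_s e
    · rw [ofGhostPath, hghost]
      exact (leavittFamily K V).t_mul_ghost e

theorem component_eq_deg (n : ℤ) : component K V n = (leavittFamily K V).deg n := by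
  refine congrArg (Submodule.span K) (Set.ext fun x => ⟨?_, ?_⟩)
  · rintro ⟨a, b, c, α, β, hn, rfl⟩
    obtain ⟨l, hl, hlen, hreal, -⟩ := exists_isWalk_of_path K α
    obtain ⟨l', hl', hlen', -, hghost⟩ := exists_isWalk_of_path K β
    exact ⟨a, b, c, l, l', hl, hl', by rw [hlen, hlen', hn], by rw [hreal, hghost]⟩
  · rintro ⟨a, b, c, l, l', hl, hl', hn, rfl⟩
    obtain ⟨α, hlen, hreal, -⟩ := exists_path_of_isWalk K hl
    obtain ⟨β, hlen', -, hghost⟩ := exists_path_of_isWalk K hl'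
    exact ⟨a, b, c, α, β, by rw [← hlen, ← hlen', hn], by rw [hreal, hghost]⟩

end Generators

section UnitalLift

variable {K : Type w} [Field K] {V : Type u} [Quiver.{v} V] {B : Type*} [Ring B] [Algebra K B]

/-- The homomorphism from the unital algebra with the same presentation as the Leavitt path algebra
which takes given values on the generators. -/
def unitalLift (f : Gen V → B)
    (hf : ∀ r r', Rel K V r r' → FreeAlgebra.lift K f r = FreeAlgebra.lift K f r') :
    RingQuot (Rel K V) →ₐ[K] B :=
  RingQuot.liftAlgHom K ⟨FreeAlgebra.lift K f, fun r r' h => hf r r' h⟩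

theorem unitalLift_unitalGen (f : Gen V → B)
    (hf : ∀ r r', Rel K V r r' → FreeAlgebra.lift K f r = FreeAlgebra.lift K f r') (g : Gen V) :
    unitalLift f hf (unitalGen K V g) = f g := by
  rw [unitalLift, unitalGen, RingQuot.liftAlgHom_mkAlgHom_apply]
  exact FreeAlgebra.lift_ι_apply _ _

end UnitalLift

section Coaction

variable {K : Type w} [Field K] {V : Type u} [Quiver.{v} V]

open Gen

/-- The degree of a generator. -/
def genDegree : Gen V → ℤ
  | vertex _ => 0
  | edge _ => 1
  | ghost _ => -1

variable (K V) in
/-- The grading of the Leavitt path algebra, encoded as the coaction of `K[ℤ]` which takes an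
element `x` of degree `n` to the monomial `x` of degree `n`. It shows that the components are
independent. -/
def coaction : RingQuot (Rel K V) →ₐ[K] AddMonoidAlgebra (RingQuot (Rel K V)) ℤ :=
  unitalLift (fun g => AddMonoidAlgebra.single (genDegree g) (unitalGen K V g)) (by
    intro r r' h
    have h' := RingQuot.mkAlgHom_rel K h
    cases h with
    | ck2 a =>
      simp only [map_mul, map_sum, FreeAlgebra.lift_ι_apply, genDegree,
        AddMonoidAlgebra.single_mul_single] at h' ⊢
      rw [unitalGen, h']
      exact map_sum (AddMonoidAlgebra.singleAddHom (0 : ℤ)) _ _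
    | _ =>
      simp only [map_mul, map_zero, FreeAlgebra.lift_ι_apply, genDegree,
        AddMonoidAlgebra.single_mul_single, unitalGen] at h' ⊢
      rw [h']
      simp)

theorem coaction_unitalGen (g : Gen V) : coaction K V (unitalGen K V g) =
    AddMonoidAlgebra.single (genDegree g) (unitalGen K V g) :=
  unitalLift_unitalGen _ _ g

theorem coaction_real (l : List (Quiver.Total V)) (c : V) :
    coaction K V (toUnital K V ((leavittFamily K V).real l c)) =
      AddMonoidAlgebra.single (l.length : ℤ) (toUnital K V ((leavittFamily K V).real l c)) := by
  induction l with
  | nil => exact coaction_unitalGen _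
  | cons e l ih =>
    have he : coaction K V (toUnital K V ((leavittFamily K V).s e)) =
        AddMonoidAlgebra.single 1 (toUnital K V ((leavittFamily K V).s e)) :=
      coaction_unitalGen (edge e)
    rw [CKFamily.real_cons, map_mul, map_mul, ih, he, AddMonoidAlgebra.single_mul_single,
      List.length_cons, Nat.cast_succ, add_comm]

theorem coaction_ghost (l : List (Quiver.Total V)) (c : V) :
    coaction K V (toUnital K V ((leavittFamily K V).ghost l c)) =
      AddMonoidAlgebra.single (-l.length : ℤ) (toUnital K V ((leavittFamily K V).ghost l c)) := by
  induction l with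
  | nil => exact coaction_unitalGen _
  | cons e l ih =>
    have he : coaction K V (toUnital K V ((leavittFamily K V).t e)) =
        AddMonoidAlgebra.single (-1) (toUnital K V ((leavittFamily K V).t e)) :=
      coaction_unitalGen (ghost e)
    rw [CKFamily.ghost_cons, map_mul, map_mul, ih, he, AddMonoidAlgebra.single_mul_single,
      List.length_cons, Nat.cast_succ, neg_add]

theorem coaction_toUnital {n : ℤ} {x : LeavittPathAlgebra K V} (hx : x ∈ component K V n) :
    coaction K V (toUnital K V x) = AddMonoidAlgebra.single n (toUnital K V x) := by
  rw [component_eq_deg] at hx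
  induction hx using Submodule.span_induction with
  | mem x hx =>
    obtain ⟨a, b, c, α, β, -, -, rfl, rfl⟩ := hx
    rw [map_mul, map_mul, coaction_real, coaction_ghost, AddMonoidAlgebra.single_mul_single,
      sub_eq_add_neg]
  | zero => simp only [map_zero, AddMonoidAlgebra.single_zero]
  | add x y _ _ hx hy => rw [map_add, map_add, hx, hy, AddMonoidAlgebra.single_add]
  | smul k x _ hx => rw [map_smul, map_smul, hx, AddMonoidAlgebra.smul_single]

end Coaction

section Graded

variable {K : Type w} [Field K] {V : Type u} [Quiver.{v} V]
    {P : TwoSidedIdeal (LeavittPathAlgebra K V)}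

theorem IsGraded.exists_toUnital_eq_coeff (hP : IsGraded P) {x : LeavittPathAlgebra K V}
    (hx : x ∈ P) (n : ℤ) :
    ∃ z ∈ P, toUnital K V z = (coaction K V (toUnital K V x)).coeff n := by
  classical
  replace hx := hP x hx
  induction hx using AddSubgroup.closure_induction with
  | mem x hx =>
    obtain ⟨hxP, m, hm⟩ := hx
    rw [coaction_toUnital hm, AddMonoidAlgebra.coeff_single, Finsupp.single_apply]
    split_ifs
    exacts [⟨x, hxP, rfl⟩, ⟨0, zero_mem _, map_zero _⟩]
  | zero => exact ⟨0, zero_mem _, by simp⟩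
  | add x y _ _ hx hy =>
    obtain ⟨z, hz, h⟩ := hx
    obtain ⟨z', hz', h'⟩ := hy
    exact ⟨z + z', add_mem hz hz', by simp [h, h']⟩
  | neg x _ hx =>
    obtain ⟨z, hz, h⟩ := hx
    refine ⟨-z, neg_mem hz, ?_⟩
    rw [map_neg, h, map_neg, map_neg, ← add_eq_zero_iff_neg_eq, ← Finsupp.add_apply,
      ← AddMonoidAlgebra.coeff_add, add_neg_cancel, AddMonoidAlgebra.coeff_zero,
      Finsupp.zero_apply]

theorem IsGraded.mem_of_sum_mem (hP : IsGraded P) {ι : Type*} {d : ι → ℤ}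
    (hd : Function.Injective d) {y : ι → LeavittPathAlgebra K V}
    (hy : ∀ i, y i ∈ component K V (d i)) {s : Finset ι} (hs : ∑ i ∈ s, y i ∈ P) {i : ι}
    (hi : i ∈ s) : y i ∈ P := by
  classical
  obtain ⟨z, hz, h⟩ := hP.exists_toUnital_eq_coeff hs (d i)
  suffices toUnital K V z = toUnital K V (y i) from toUnital_injective K V this ▸ hz
  rw [h, map_sum, map_sum, AddMonoidAlgebra.coeff_sum, Finsupp.finsetSum_apply,
    Finset.sum_eq_single_of_mem i hi, coaction_toUnital (hy i), AddMonoidAlgebra.coeff_single,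
    Finsupp.single_eq_same]
  intro j _ hj
  rw [coaction_toUnital (hy j), AddMonoidAlgebra.coeff_single,
    Finsupp.single_eq_of_ne (fun h => hj (hd h).symm)]

theorem mul_mem_closure_homogeneousElements (x : LeavittPathAlgebra K V)
    {y : LeavittPathAlgebra K V} (hy : y ∈ AddSubgroup.closure (homogeneousElements P)) :
    x * y ∈ AddSubgroup.closure (homogeneousElements P) ∧
      y * x ∈ AddSubgroup.closure (homogeneousElements P) := by
  have hx : x ∈ ⨆ n, (leavittFamily K V).deg n := by
    rw [CKFamily.iSup_deg_eq_top]; exact Submodule.mem_top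
  induction hx using Submodule.iSup_induction' with
  | zero => rw [zero_mul, mul_zero]; exact ⟨zero_mem _, zero_mem _⟩
  | add x x' _ _ hx hx' =>
    rw [add_mul, mul_add]
    exact ⟨add_mem hx.1 hx'.1, add_mem hx.2 hx'.2⟩
  | mem n x hx =>
    induction hy using AddSubgroup.closure_induction with
    | zero => rw [zero_mul, mul_zero]; exact ⟨zero_mem _, zero_mem _⟩
    | add y z _ _ hy hz => rw [add_mul, mul_add]; exact ⟨add_mem hy.1 hz.1, add_mem hy.2 hz.2⟩
    | neg y _ hy => rw [neg_mul, mul_neg]; exact ⟨neg_mem hy.1, neg_mem hy.2⟩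
    | mem y hy =>
      obtain ⟨hyP, m, hm⟩ := hy
      rw [component_eq_deg] at hm
      refine ⟨AddSubgroup.subset_closure ⟨P.mul_mem_left _ _ hyP, n + m, ?_⟩,
        AddSubgroup.subset_closure ⟨P.mul_mem_right _ _ hyP, m + n, ?_⟩⟩
      · rw [component_eq_deg]; exact CKFamily.mul_mem_deg _ hx hm
      · rw [component_eq_deg]; exact CKFamily.mul_mem_deg _ hm hx

theorem mem_gradedPart_iff {x : LeavittPathAlgebra K V} :
    x ∈ gradedPart P ↔ x ∈ AddSubgroup.closure (homogeneousElements P) := by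
  refine ⟨fun hx => ?_, fun hx => ?_⟩
  · let M : TwoSidedIdeal (LeavittPathAlgebra K V) :=
      .mk' (AddSubgroup.closure (homogeneousElements P)) (zero_mem _) add_mem neg_mem
        (fun {x _} hy => (mul_mem_closure_homogeneousElements x hy).1)
        (fun {_ y} hx => (mul_mem_closure_homogeneousElements y hx).2)
    have hM : ∀ x, x ∈ M ↔ x ∈ AddSubgroup.closure (homogeneousElements P) := fun x =>
      TwoSidedIdeal.mem_mk' _ _ _ _ _ _ _
    have hle : gradedPart P ≤ M :=
      TwoSidedIdeal.span_le.2 fun x hx => (hM x).2 (AddSubgroup.subset_closure hx)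
    exact (hM x).1 (hle hx)
  · induction hx using AddSubgroup.closure_induction with
    | mem _ hx => exact TwoSidedIdeal.subset_span hx
    | zero => exact zero_mem _
    | add x y _ _ hx hy => exact add_mem hx hy
    | neg x _ hx => exact neg_mem hx

theorem gradedPart_le (P : TwoSidedIdeal (LeavittPathAlgebra K V)) : gradedPart P ≤ P :=
  TwoSidedIdeal.span_le.2 fun _ hx => hx.1

theorem isGraded_iff_gradedPart_eq : IsGraded P ↔ gradedPart P = P :=
  ⟨fun h => le_antisymm (gradedPart_le P) fun x hx => mem_gradedPart_iff.2 (h x hx),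
    fun h _ hx => mem_gradedPart_iff.1 (h.symm ▸ hx)⟩

end Graded

theorem CKFamily.smul_mem {K : Type w} [Field K] {F : Type u} [Quiver.{v} F] {A : Type*}
    [NonUnitalRing A] [Module K A] [IsScalarTower K A A] [SMulCommClass K A A]
    (Φ : CKFamily K F A) (J : TwoSidedIdeal A) (k : K) {x : A} (hx : x ∈ J) : k • x ∈ J := by
  obtain ⟨T, hT⟩ := (Φ.eventually_sum_p_mul_eq x).exists
  rw [← hT, ← smul_mul_assoc]
  exact J.mul_mem_left _ _ hx

section Quotient

variable {K : Type w} [Field K] {V : Type u} [Quiver.{v} V]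

/-- The quotient of the Leavitt path algebra by an ideal. It is a `K`-algebra, since by the presence
of local units every ideal of the Leavitt path algebra is a `K`-subspace. -/
def LeavittQuotient (I : TwoSidedIdeal (LeavittPathAlgebra K V)) : Type (max u v w) :=
  I.ringCon.Quotient

namespace LeavittQuotient

variable (I : TwoSidedIdeal (LeavittPathAlgebra K V))

instance : NonUnitalRing (LeavittQuotient I) :=
  inferInstanceAs (NonUnitalRing I.ringCon.Quotient)

/-- The quotient map. -/
def mk : LeavittPathAlgebra K V →ₙ+* LeavittQuotient I where
  toFun x := (x : I.ringCon.Quotient)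
  map_zero' := rfl
  map_add' _ _ := rfl
  map_mul' _ _ := rfl

theorem mk_surjective : Function.Surjective (mk I) := Quotient.mk''_surjective

variable {I} in
theorem mk_eq_zero_iff {x : LeavittPathAlgebra K V} : mk I x = 0 ↔ x ∈ I :=
  RingCon.eq _

instance : SMul K (LeavittQuotient I) :=
  ⟨fun k => Quotient.map' (k • ·) fun x y h => by
    change I.ringCon (k • x) (k • y)
    change I.ringCon x y at h
    rw [TwoSidedIdeal.rel_iff] at h ⊢
    rw [← smul_sub]
    exact (leavittFamily K V).smul_mem I k h⟩

theorem mk_smul (k : K) (x : LeavittPathAlgebra K V) : mk I (k • x) = k • mk I x := rfl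

instance : Module K (LeavittQuotient I) :=
  (mk_surjective I).module K (mk I).toAddMonoidHom (mk_smul I)

instance : IsScalarTower K (LeavittQuotient I) (LeavittQuotient I) where
  smul_assoc k x y := by
    obtain ⟨x, rfl⟩ := mk_surjective I x
    obtain ⟨y, rfl⟩ := mk_surjective I y
    rw [smul_eq_mul, smul_eq_mul, ← mk_smul, ← map_mul, ← map_mul, ← mk_smul, smul_mul_assoc]

instance : SMulCommClass K (LeavittQuotient I) (LeavittQuotient I) where
  smul_comm k x y := by
    obtain ⟨x, rfl⟩ := mk_surjective I x
    obtain ⟨y, rfl⟩ := mk_surjective I y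
    rw [smul_eq_mul, smul_eq_mul, ← mk_smul, ← map_mul, ← map_mul, ← mk_smul, mul_smul_comm]

end LeavittQuotient

end Quotient

section PartialMaps

variable (K : Type w) [Field K] {Y : Type*}

/-- The linear operator on functions which is given by composition with a partial map, a function
being extended by zero where the partial map is undefined. -/
def partialOp (g : Y → Option Y) : Module.End K (Y → K) where
  toFun f y := (g y).elim 0 f
  map_add' f f' := by ext y; cases h : g y <;> simp [h]
  map_smul' k f := by ext y; cases h : g y <;> simp [h]

theorem partialOp_mul (g h : Y → Option Y) :
    partialOp K g * partialOp K h = partialOp K fun y => (g y).bind h := by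
  ext f y
  cases hg : g y <;> simp [partialOp, hg]

theorem partialOp_none : partialOp K (fun _ : Y => none) = 0 := rfl

end PartialMaps

section Branching

variable {V : Type u} [Quiver.{v} V]

/-- The edges which start at `a` and do not end in `H`. -/
abbrev StarOff (H : Set V) (a : V) : Type (max u v) := {e : Quiver.Star a // e.1 ∉ H}

variable (V) in
/-- An infinite set which is at least as large as the set of all edges. A copy of it at each vertex
plays the role of the set of boundary paths which start there. -/
abbrev BranchSet : Type (max u v) := ℕ ⊕ Quiver.Total V

theorem exists_branching (H S : Set V) (a : V) :
    ∃ f : StarOff H a × BranchSet V → BranchSet V, Function.Injective f ∧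
      (Function.Surjective f ↔ Nonempty (StarOff H a) ∧ a ∉ breaking H \ S) := by
  have hle : Cardinal.mk (StarOff H a) ≤ Cardinal.mk (BranchSet V) := by
    refine Cardinal.mk_le_of_injective (f := fun e => Sum.inr ⟨a, e.1.1, e.1.2⟩) ?_
    rintro ⟨⟨c, e⟩, h⟩ ⟨⟨c', e'⟩, h'⟩ heq
    simpa using heq
  have hinf : Cardinal.aleph0 ≤ Cardinal.mk (BranchSet V) := Cardinal.aleph0_le_mk _
  by_cases hC : Nonempty (StarOff H a) ∧ a ∉ breaking H \ S
  · have hne := hC.1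
    have hcard : Cardinal.mk (StarOff H a × BranchSet V) = Cardinal.mk (BranchSet V) := by
      rw [Cardinal.mk_prod, Cardinal.lift_id, Cardinal.lift_id]
      exact Cardinal.mul_eq_right hinf hle (Cardinal.mk_ne_zero _)
    obtain ⟨f⟩ := Cardinal.eq.1 hcard
    exact ⟨f, f.injective, iff_of_true f.surjective hC⟩
  · have hcard : Cardinal.mk (Option (StarOff H a × BranchSet V)) ≤ Cardinal.mk (BranchSet V) := by
      rw [Cardinal.mk_option, Cardinal.mk_prod, Cardinal.lift_id, Cardinal.lift_id]
      refine Cardinal.add_le_of_le hinf ?_ (Cardinal.one_le_aleph0.trans hinf)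
      exact Cardinal.mul_le_of_le hinf hle le_rfl
    obtain ⟨f⟩ := Cardinal.le_def _ _ |>.1 hcard
    refine ⟨fun q => f (some q), fun q q' h => by simpa using h, iff_of_false (fun h => ?_) hC⟩
    obtain ⟨q, hq⟩ := h (f none)
    exact Option.some_ne_none q (f.injective hq)

variable (H S : Set V)

/-- A branching at the vertex `a`: disjoint copies of `BranchSet V` inside itself, one for each edge
in `StarOff H a`. They leave elements over exactly when no edge is available or `a ∈ B_H \ S`, where
the quotient by `I(H, S)` must not satisfy (CK2) with respect to these edges. -/
def encode (a : V) : StarOff H a × BranchSet V → BranchSet V := (exists_branching H S a).choose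

theorem encode_injective (a : V) : Function.Injective (encode H S a) :=
  (exists_branching H S a).choose_spec.1

theorem encode_surjective_iff (a : V) : Function.Surjective (encode H S a) ↔
    Nonempty (StarOff H a) ∧ a ∉ breaking H \ S :=
  (exists_branching H S a).choose_spec.2

/-- The partial inverse of `encode`. -/
def decode (a : V) : BranchSet V → Option (StarOff H a × BranchSet V) :=
  Function.partialInv (encode H S a)

theorem decode_eq_some {a : V} {x : BranchSet V} {q : StarOff H a × BranchSet V} :
    decode H S a x = some q ↔ encode H S a q = x :=
  (encode_injective H S a).isPartialInv _ _

theorem decode_encode {a : V} (q : StarOff H a × BranchSet V) :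
    decode H S a (encode H S a q) = some q :=
  (decode_eq_some H S).2 rfl

theorem exists_decode_eq_none_iff {a : V} : (∃ x, decode H S a x = none) ↔
    ¬ (Nonempty (StarOff H a) ∧ a ∉ breaking H \ S) := by
  rw [← encode_surjective_iff, Function.Surjective]
  push Not
  refine exists_congr fun x => ?_
  rw [Option.eq_none_iff_forall_ne_some]
  exact forall_congr' fun q => (decode_eq_some H S).not

variable {H S}

theorem decode_ne_none {a : V} (hne : Nonempty (StarOff H a)) (ha : a ∉ breaking H \ S)
    (x : BranchSet V) : decode H S a x ≠ none :=
  fun hx => (exists_decode_eq_none_iff H S).1 ⟨x, hx⟩ ⟨hne, ha⟩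

theorem decode_ne_none_of_isRegular (hH : IsSaturated H) {a : V} (ha : a ∉ H)
    (hreg : IsRegular a) (x : BranchSet V) : decode H S a x ≠ none := by
  refine decode_ne_none ?_ (fun hb => not_finite_iff_infinite.2 hb.1.2.1 hreg.2) x
  by_contra hne
  exact ha (hH a hreg fun e => by_contra fun he => hne ⟨⟨e, he⟩⟩)

theorem IsHereditary.left_notMem (hH : IsHereditary H) {e : Quiver.Total V} (he : e.right ∉ H) :
    e.left ∉ H := fun h => he (hH _ h _ (.of_edge e))

theorem IsHereditary.decode_eq_none (hH : IsHereditary H) {a : V} (ha : a ∈ H)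
    (x : BranchSet V) : decode H S a x = none := by
  by_contra h
  obtain ⟨q, -⟩ := Option.ne_none_iff_exists'.1 h
  exact q.1.2 (hH a ha _ ⟨q.1.1.2.toPath⟩)

variable (H S) in
open Classical in
/-- The partial map given by a generator of the Leavitt path algebra, on pairs of a vertex and an
element of `BranchSet V`, which are thought of as boundary paths: an edge removes itself from the
beginning of a path, and a ghost edge adds the edge to the beginning. -/
def branchMap : Gen V → V × BranchSet V → Option (V × BranchSet V)
  | .vertex a, y => if y.1 = a ∧ a ∉ H then some y else none
  | .edge e, y => (decode H S y.1 y.2).bind fun q =>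
      if (⟨y.1, q.1.1.1, q.1.1.2⟩ : Quiver.Total V) = e then some (e.right, q.2) else none
  | .ghost e, y => if h : e.right ∉ H ∧ y.1 = e.right then
      some (e.left, encode H S e.left (⟨⟨e.right, e.hom⟩, h.1⟩, y.2)) else none

theorem branchMap_vertex_bind_vertex (a : V) (y : V × BranchSet V) :
    (branchMap H S (.vertex a) y).bind (branchMap H S (.vertex a)) =
      branchMap H S (.vertex a) y := by
  by_cases h : y.1 = a ∧ a ∉ H <;> simp [branchMap, h]

theorem branchMap_vertex_bind_vertex_of_ne {a b : V} (hab : a ≠ b) (y : V × BranchSet V) :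
    (branchMap H S (.vertex a) y).bind (branchMap H S (.vertex b)) = none := by
  by_cases h : y.1 = a ∧ a ∉ H
  · simp [branchMap, h, hab]
  · simp [branchMap, h]

theorem branchMap_vertex_bind_edge (hH : IsHereditary H) (e : Quiver.Total V)
    (y : V × BranchSet V) : (branchMap H S (.vertex e.left) y).bind (branchMap H S (.edge e)) =
      branchMap H S (.edge e) y := by
  obtain ⟨b, x⟩ := y
  by_cases hb : b = e.left
  · subst hb
    by_cases he : e.left ∈ H
    · simp [branchMap, hH.decode_eq_none he]
    · simp [branchMap, he]
  · have hne : ∀ c (g : b ⟶ c), (⟨b, c, g⟩ : Quiver.Total V) ≠ e := by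
      rintro c g rfl
      exact hb rfl
    cases hx : decode H S b x <;> simp [branchMap, hb, hx, hne]

theorem branchMap_edge_bind_vertex (e : Quiver.Total V) (y : V × BranchSet V) :
    (branchMap H S (.edge e) y).bind (branchMap H S (.vertex e.right)) =
      branchMap H S (.edge e) y := by
  obtain ⟨b, x⟩ := y
  cases hx : decode H S b x with
  | none => simp [branchMap, hx]
  | some q =>
    by_cases he : (⟨b, q.1.1.1, q.1.1.2⟩ : Quiver.Total V) = e
    · subst he
      have hq : q.1.1.1 ∉ H := q.1.2
      simp [branchMap, hx, hq]
    · simp [branchMap, hx, he]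

theorem branchMap_vertex_bind_ghost (e : Quiver.Total V) (y : V × BranchSet V) :
    (branchMap H S (.vertex e.right) y).bind (branchMap H S (.ghost e)) =
      branchMap H S (.ghost e) y := by
  by_cases hb : e.right ∉ H ∧ y.1 = e.right
  · simp [branchMap, hb]
  · have hb' : ¬ (y.1 = e.right ∧ e.right ∉ H) := fun h => hb h.symm
    simp [branchMap, hb, hb']

theorem branchMap_ghost_bind_vertex (hH : IsHereditary H) (e : Quiver.Total V)
    (y : V × BranchSet V) : (branchMap H S (.ghost e) y).bind (branchMap H S (.vertex e.left)) =
      branchMap H S (.ghost e) y := by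
  by_cases hb : e.right ∉ H ∧ y.1 = e.right
  · simp [branchMap, hb, hH.left_notMem hb.1]
  · simp [branchMap, hb]

theorem branchMap_ghost_bind_edge (e : Quiver.Total V) (y : V × BranchSet V) :
    (branchMap H S (.ghost e) y).bind (branchMap H S (.edge e)) =
      branchMap H S (.vertex e.right) y := by
  obtain ⟨b, x⟩ := y
  by_cases hb : e.right ∉ H ∧ b = e.right
  · obtain ⟨hb, rfl⟩ := hb
    simp [branchMap, hb, decode_encode]
  · have hb' : ¬ (b = e.right ∧ e.right ∉ H) := fun h => hb h.symm
    simp [branchMap, hb, hb']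

theorem branchMap_ghost_bind_edge_of_ne {e f : Quiver.Total V} (hef : e ≠ f)
    (y : V × BranchSet V) : (branchMap H S (.ghost e) y).bind (branchMap H S (.edge f)) = none := by
  by_cases hb : e.right ∉ H ∧ y.1 = e.right
  · simp [branchMap, hb, decode_encode, hef]
  · simp [branchMap, hb]

theorem branchMap_edge_bind_ghost {e : Quiver.Total V} {b : V} {x : BranchSet V}
    {q : StarOff H b × BranchSet V} (hq : decode H S b x = some q)
    (he : (⟨b, q.1.1.1, q.1.1.2⟩ : Quiver.Total V) = e) :
    (branchMap H S (.edge e) (b, x)).bind (branchMap H S (.ghost e)) = some (b, x) := by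
  subst he
  have hq1 : q.1.1.1 ∉ H := q.1.2
  simp [branchMap, hq, hq1, (decode_eq_some H S).1 hq]

theorem branchMap_edge_eq_none {e : Quiver.Total V} {b : V} {x : BranchSet V}
    (h : ∀ q, decode H S b x = some q → (⟨b, q.1.1.1, q.1.1.2⟩ : Quiver.Total V) ≠ e) :
    branchMap H S (.edge e) (b, x) = none := by
  cases hq : decode H S b x with
  | none => simp [branchMap, hq]
  | some q => simp [branchMap, hq, h q hq]

variable (K : Type w) [Field K]

variable (H S) in
/-- The operator given by a generator of the Leavitt path algebra. -/
def branchOp (g : Gen V) : Module.End K (V × BranchSet V → K) := partialOp K (branchMap H S g)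

theorem branchOp_mul_eq {g g' g'' : Gen V}
    (h : ∀ y, (branchMap H S g y).bind (branchMap H S g') = branchMap H S g'' y) :
    branchOp H S K g * branchOp H S K g' = branchOp H S K g'' :=
  (partialOp_mul K _ _).trans (congrArg _ (funext h))

theorem branchOp_mul_eq_zero {g g' : Gen V}
    (h : ∀ y, (branchMap H S g y).bind (branchMap H S g') = none) :
    branchOp H S K g * branchOp H S K g' = 0 :=
  (partialOp_mul K _ _).trans ((congrArg _ (funext h)).trans (partialOp_none K))

open Classical in
theorem branchOp_vertex_apply (a : V) (f : V × BranchSet V → K) (b : V) (x : BranchSet V) :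
    branchOp H S K (.vertex a) f (b, x) = if b = a ∧ a ∉ H then f (b, x) else 0 := by
  by_cases h : b = a ∧ a ∉ H <;> simp [branchOp, partialOp, branchMap, h]

theorem branchOp_edge_mul_ghost_apply {e : Quiver.Total V} {b : V} {x : BranchSet V}
    {q : StarOff H b × BranchSet V} (hq : decode H S b x = some q)
    (he : (⟨b, q.1.1.1, q.1.1.2⟩ : Quiver.Total V) = e) (f : V × BranchSet V → K) :
    (branchOp H S K (.edge e) * branchOp H S K (.ghost e)) f (b, x) = f (b, x) := by
  rw [branchOp, branchOp, partialOp_mul]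
  exact congrArg (fun y => Option.elim y 0 f) (branchMap_edge_bind_ghost hq he)

theorem branchOp_edge_mul_ghost_apply_eq_zero {e : Quiver.Total V} {b : V} {x : BranchSet V}
    (h : ∀ q, decode H S b x = some q → (⟨b, q.1.1.1, q.1.1.2⟩ : Quiver.Total V) ≠ e)
    (f : V × BranchSet V → K) :
    (branchOp H S K (.edge e) * branchOp H S K (.ghost e)) f (b, x) = 0 :=
  congrArg (fun y => Option.elim y 0 _) (branchMap_edge_eq_none h)

open Classical in
theorem sum_branchOp_apply {ι : Type*} [Fintype ι] {a : V} (j : ι → Quiver.Star a)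
    (hj : Function.Injective j) (hj' : ∀ e : Quiver.Star a, e.1 ∉ H → e ∈ Set.range j)
    (f : V × BranchSet V → K) (b : V) (x : BranchSet V) :
    (∑ i, branchOp H S K (.edge ⟨a, (j i).1, (j i).2⟩) *
      branchOp H S K (.ghost ⟨a, (j i).1, (j i).2⟩)) f (b, x) =
      if b = a ∧ decode H S b x ≠ none then f (b, x) else 0 := by
  rw [LinearMap.sum_apply, Finset.sum_apply]
  split_ifs with h
  · obtain ⟨rfl, hx⟩ := h
    obtain ⟨q, hq⟩ := Option.ne_none_iff_exists'.1 hx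
    obtain ⟨i, hi⟩ := hj' q.1.1 q.1.2
    rw [Finset.sum_eq_single i]
    · exact branchOp_edge_mul_ghost_apply K hq (by rw [hi]) f
    · refine fun i' _ hi' => branchOp_edge_mul_ghost_apply_eq_zero K (fun q' hq' hne => hi' ?_) f
      obtain rfl := Option.some.inj (hq.symm.trans hq')
      refine hj (hi ▸ ?_)
      cases hji : j i'
      rw [hji] at hne
      cases hq1 : q.1.1
      rw [hq1] at hne
      simpa using hne.symm
    · exact fun hi => (hi (Finset.mem_univ i)).elim
  · refine Finset.sum_eq_zero fun i _ =>
      branchOp_edge_mul_ghost_apply_eq_zero K (fun q hq hne => h ?_) f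
    exact ⟨congrArg Quiver.Total.left hne, hq ▸ Option.some_ne_none q⟩

theorem sum_branchOp_eq (hH : IsHereditary H) (hsat : IsSaturated H) (a : V)
    [Fintype (Quiver.Star a)] [Nonempty (Quiver.Star a)] :
    branchOp H S K (.vertex a) = ∑ e : Quiver.Star a,
      branchOp H S K (.edge ⟨a, e.1, e.2⟩) * branchOp H S K (.ghost ⟨a, e.1, e.2⟩) := by
  classical
  ext f ⟨b, x⟩
  rw [sum_branchOp_apply K (fun e : Quiver.Star a => e) Function.injective_id
    (fun e _ => ⟨e, rfl⟩), branchOp_vertex_apply]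
  refine if_congr (and_congr_right ?_) rfl rfl
  rintro rfl
  exact ⟨fun hb => decode_ne_none_of_isRegular hsat hb ⟨inferInstance, Finite.of_fintype _⟩ x,
    fun hx hb => hx (hH.decode_eq_none hb x)⟩

theorem branchOp_rel (hH : IsHereditary H) (hsat : IsSaturated H) (x y : FreeAlgebra K (Gen V))
    (hxy : Rel K V x y) :
    FreeAlgebra.lift K (branchOp H S K) x = FreeAlgebra.lift K (branchOp H S K) y := by
  cases hxy <;> simp only [map_mul, map_sum, map_zero, FreeAlgebra.lift_ι_apply]
  case idem a => exact branchOp_mul_eq K (branchMap_vertex_bind_vertex a)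
  case orth a b h => exact branchOp_mul_eq_zero K (branchMap_vertex_bind_vertex_of_ne h)
  case source_edge e => exact branchOp_mul_eq K (branchMap_vertex_bind_edge hH e)
  case edge_range e => exact branchOp_mul_eq K (branchMap_edge_bind_vertex e)
  case range_ghost e => exact branchOp_mul_eq K (branchMap_vertex_bind_ghost e)
  case ghost_source e => exact branchOp_mul_eq K (branchMap_ghost_bind_vertex hH e)
  case ck1_same e => exact branchOp_mul_eq K (branchMap_ghost_bind_edge e)
  case ck1_ne e f h => exact branchOp_mul_eq_zero K (branchMap_ghost_bind_edge_of_ne h)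
  case ck2 a _ _ => exact sum_branchOp_eq K hH hsat a

/-- The representation of the Leavitt path algebra on functions which is given by the operators
`branchOp`. It vanishes on `I(H, S)`, and serves to show that certain elements lie outside. -/
def branchRep (h : IsAdmissible H S) :
    LeavittPathAlgebra K V →ₙₐ[K] Module.End K (V × BranchSet V → K) :=
  ((unitalLift (branchOp H S K) (branchOp_rel K h.1 h.2.1) : _ →ₙₐ[K] _)).comp (toUnital K V)

theorem branchRep_gen (h : IsAdmissible H S) (g : Gen V) :
    branchRep K h (gen K g) = branchOp H S K g :=
  unitalLift_unitalGen _ _ _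

open Classical in
theorem branchRep_breakingElement_apply (h : IsAdmissible H S) {a : V} (ha : a ∈ breaking H)
    (f : V × BranchSet V → K) (b : V) (x : BranchSet V) :
    branchRep K h (breakingElement K H a) f (b, x) =
      if b = a ∧ decode H S b x = none then f (b, x) else 0 := by
  have := ha.2.2.2
  cases nonempty_fintype (StarOff H a)
  rw [breakingElement, finsum_eq_sum_of_fintype, map_sub, map_sum, LinearMap.sub_apply,
    Pi.sub_apply]
  simp only [map_mul, branchRep_gen]
  rw [branchOp_vertex_apply, sum_branchOp_apply K (fun e : StarOff H a => e.1)
    Subtype.val_injective (fun e he => ⟨⟨e, he⟩, rfl⟩)]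
  by_cases hb : b = a <;> by_cases hx : decode H S b x = none <;> simp [hb, hx, ha.1]

theorem admissibleIdeal_le_ker (h : IsAdmissible H S) :
    admissibleIdeal K H S ≤ TwoSidedIdeal.ker (branchRep K h) := by
  classical
  rw [admissibleIdeal, TwoSidedIdeal.span_le]
  rintro _ (⟨a, ha, rfl⟩ | ⟨a, ha, rfl⟩) <;> rw [SetLike.mem_coe, TwoSidedIdeal.mem_ker] <;>
    ext f ⟨b, x⟩
  · rw [branchRep_gen, branchOp_vertex_apply, if_neg fun h => h.2 ha]
    rfl
  · have hb := h.2.2 ha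
    rw [branchRep_breakingElement_apply K h hb, if_neg]
    · rfl
    · rintro ⟨rfl, hx⟩
      exact decode_ne_none hb.2.2.1 (fun h => h.2 ha) x hx

theorem notMem_admissibleIdeal_of_branchRep_apply (h : IsAdmissible H S)
    {x : LeavittPathAlgebra K V} {f : V × BranchSet V → K} {y : V × BranchSet V}
    (hx : branchRep K h x f y ≠ 0) : x ∉ admissibleIdeal K H S := fun hmem => hx <| by
  rw [(TwoSidedIdeal.mem_ker _).1 (admissibleIdeal_le_ker K h hmem)]
  rfl

theorem vertex_notMem_admissibleIdeal (h : IsAdmissible H S) {a : V} (ha : a ∉ H) :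
    gen K (.vertex a) ∉ admissibleIdeal K H S := by
  classical
  refine notMem_admissibleIdeal_of_branchRep_apply K h (f := fun _ => 1) (y := (a, Sum.inl 0)) ?_
  rw [branchRep_gen, branchOp_vertex_apply, if_pos ⟨rfl, ha⟩]
  exact one_ne_zero

theorem breakingElement_notMem_admissibleIdeal (h : IsAdmissible H S) {a : V}
    (ha : a ∈ breaking H \ S) : breakingElement K H a ∉ admissibleIdeal K H S := by
  classical
  obtain ⟨x, hx⟩ := (exists_decode_eq_none_iff H S).2 fun h => h.2 ha
  refine notMem_admissibleIdeal_of_branchRep_apply K h (f := fun _ => 1) (y := (a, x)) ?_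
  rw [branchRep_breakingElement_apply K h ha.1, if_pos ⟨rfl, hx⟩]
  exact one_ne_zero

end Branching

section Relations

variable (K : Type w) [Field K] {V : Type u} [Quiver.{v} V]

open Gen

theorem vertex_mul_vertex (a : V) : gen K (vertex a) * gen K (vertex a) = gen K (vertex a) :=
  (leavittFamily K V).p_mul_self a

theorem vertex_mul_vertex_of_ne {a b : V} (h : a ≠ b) : gen K (vertex a) * gen K (vertex b) = 0 :=
  (leavittFamily K V).p_mul_p_of_ne a b h

theorem vertex_mul_edge (e : Quiver.Total V) :
    gen K (vertex e.left) * gen K (edge e) = gen K (edge e) :=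
  (leavittFamily K V).p_mul_s e

theorem edge_mul_vertex (e : Quiver.Total V) :
    gen K (edge e) * gen K (vertex e.right) = gen K (edge e) :=
  (leavittFamily K V).s_mul_p e

theorem vertex_mul_ghost (e : Quiver.Total V) :
    gen K (vertex e.right) * gen K (ghost e) = gen K (ghost e) :=
  (leavittFamily K V).p_mul_t e

theorem ghost_mul_vertex (e : Quiver.Total V) :
    gen K (ghost e) * gen K (vertex e.left) = gen K (ghost e) :=
  (leavittFamily K V).t_mul_p e

theorem ghost_mul_edge (e : Quiver.Total V) :
    gen K (ghost e) * gen K (edge e) = gen K (vertex e.right) :=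
  (leavittFamily K V).t_mul_s_self e

theorem ghost_mul_edge_of_ne {e f : Quiver.Total V} (h : e ≠ f) :
    gen K (ghost e) * gen K (edge f) = 0 :=
  (leavittFamily K V).t_mul_s_of_ne e f h

theorem vertex_mem_component (a : V) : gen K (vertex a) ∈ component K V 0 := by
  rw [component_eq_deg]
  exact (leavittFamily K V).p_mem_deg a

theorem edge_mem_component (e : Quiver.Total V) : gen K (edge e) ∈ component K V 1 := by
  rw [component_eq_deg]
  exact (leavittFamily K V).s_mem_deg e

theorem ghost_mem_component (e : Quiver.Total V) : gen K (ghost e) ∈ component K V (-1) := by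
  rw [component_eq_deg]
  exact (leavittFamily K V).t_mem_deg e

variable {K} in
theorem mul_mem_component {m n : ℤ} {x y : LeavittPathAlgebra K V} (hx : x ∈ component K V m)
    (hy : y ∈ component K V n) : x * y ∈ component K V (m + n) := by
  rw [component_eq_deg] at hx hy ⊢
  exact (leavittFamily K V).mul_mem_deg hx hy

end Relations

section BreakingElement

variable {K : Type w} [Field K] {V : Type u} [Quiver.{v} V] {H S : Set V} {a : V}

open Gen

/-- An edge in `StarOff H a`, together with its source `a`. -/
abbrev StarOff.edge (e : StarOff H a) : Quiver.Total V := ⟨a, e.1.1, e.1.2⟩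

theorem StarOff.edge_injective : Function.Injective (StarOff.edge : StarOff H a → _) := by
  rintro ⟨⟨b, e⟩, he⟩ ⟨⟨c, f⟩, hf⟩ h
  simpa using h

variable (K H a) in
theorem vertex_sub_breakingElement [Fintype (StarOff H a)] :
    gen K (vertex a) - breakingElement K H a =
      ∑ e : StarOff H a, gen K (edge e.edge) * gen K (ghost e.edge) := by
  rw [breakingElement, finsum_eq_sum_of_fintype, sub_sub_cancel]

theorem vertex_mul_breakingElement (ha : a ∈ breaking H) :
    gen K (vertex a) * breakingElement K H a = breakingElement K H a := by
  have := ha.2.2.2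
  cases nonempty_fintype (StarOff H a)
  rw [← sub_sub_cancel (gen K (vertex a)) (breakingElement K H a), vertex_sub_breakingElement,
    mul_sub, vertex_mul_vertex, Finset.mul_sum]
  simp only [← mul_assoc, vertex_mul_edge K (StarOff.edge _)]

theorem breakingElement_mul_vertex (ha : a ∈ breaking H) :
    breakingElement K H a * gen K (vertex a) = breakingElement K H a := by
  have := ha.2.2.2
  cases nonempty_fintype (StarOff H a)
  rw [← sub_sub_cancel (gen K (vertex a)) (breakingElement K H a), vertex_sub_breakingElement,
    sub_mul, vertex_mul_vertex, Finset.sum_mul]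
  simp only [mul_assoc, ghost_mul_vertex K (StarOff.edge _)]

theorem breakingElement_mul_edge (ha : a ∈ breaking H) (e : StarOff H a) :
    breakingElement K H a * gen K (edge e.edge) = 0 := by
  have := ha.2.2.2
  cases nonempty_fintype (StarOff H a)
  rw [← sub_sub_cancel (gen K (vertex a)) (breakingElement K H a), vertex_sub_breakingElement,
    sub_mul, vertex_mul_edge K e.edge, Finset.sum_mul, Fintype.sum_eq_single e fun f hf => ?_,
    mul_assoc, ghost_mul_edge, edge_mul_vertex, sub_self]
  rw [mul_assoc, ghost_mul_edge_of_ne K (StarOff.edge_injective.ne hf), mul_zero]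

theorem ghost_mul_breakingElement (ha : a ∈ breaking H) (e : StarOff H a) :
    gen K (ghost e.edge) * breakingElement K H a = 0 := by
  have := ha.2.2.2
  cases nonempty_fintype (StarOff H a)
  rw [← sub_sub_cancel (gen K (vertex a)) (breakingElement K H a), vertex_sub_breakingElement,
    mul_sub, ghost_mul_vertex K e.edge, Finset.mul_sum, Fintype.sum_eq_single e fun f hf => ?_,
    ← mul_assoc, ghost_mul_edge, vertex_mul_ghost, sub_self]
  rw [← mul_assoc, ghost_mul_edge_of_ne K (StarOff.edge_injective.ne hf.symm), zero_mul]

theorem breakingElement_mul_self (ha : a ∈ breaking H) :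
    breakingElement K H a * breakingElement K H a = breakingElement K H a := by
  have := ha.2.2.2
  cases nonempty_fintype (StarOff H a)
  have h : breakingElement K H a * (gen K (vertex a) - breakingElement K H a) = 0 := by
    rw [vertex_sub_breakingElement, Finset.mul_sum]
    refine Finset.sum_eq_zero fun e _ => ?_
    rw [← mul_assoc, breakingElement_mul_edge ha e, zero_mul]
  rwa [mul_sub, breakingElement_mul_vertex ha, sub_eq_zero, eq_comm] at h

theorem vertex_mem_of_vertex_sub_breakingElement_mem
    {J : TwoSidedIdeal (LeavittPathAlgebra K V)} (ha : a ∈ breaking H)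
    (hJ : gen K (vertex a) - breakingElement K H a ∈ J) (e : StarOff H a) :
    gen K (vertex e.edge.right) ∈ J := by
  have h : gen K (ghost e.edge) * (gen K (vertex a) - breakingElement K H a) =
      gen K (ghost e.edge) := by
    rw [mul_sub, ghost_mul_vertex K e.edge, ghost_mul_breakingElement ha, sub_zero]
  rw [← ghost_mul_edge, ← h]
  exact J.mul_mem_right _ _ (J.mul_mem_left _ _ hJ)

theorem breakingElement_mem_component (ha : a ∈ breaking H) :
    breakingElement K H a ∈ component K V 0 := by
  have := ha.2.2.2
  cases nonempty_fintype (StarOff H a)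
  rw [breakingElement, finsum_eq_sum_of_fintype]
  refine Submodule.sub_mem _ (vertex_mem_component K a) (Submodule.sum_mem _ fun e _ => ?_)
  rw [← add_neg_cancel (1 : ℤ)]
  exact mul_mem_component (edge_mem_component K _) (ghost_mem_component K _)

variable (K H S) in
open Classical in
/-- The element of the Leavitt path algebra corresponding to the new vertex `a'` of the quotient
graph, and zero if there is no such vertex. -/
def sinkElement (a : V) : LeavittPathAlgebra K V :=
  if a ∈ breaking H \ S then breakingElement K H a else 0

theorem sinkElement_of_mem (ha : a ∈ breaking H \ S) :
    sinkElement K H S a = breakingElement K H a := if_pos ha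

theorem sinkElement_of_notMem (ha : a ∉ breaking H \ S) : sinkElement K H S a = 0 := if_neg ha

theorem sinkElement_mem_component (a : V) : sinkElement K H S a ∈ component K V 0 := by
  by_cases ha : a ∈ breaking H \ S
  · rw [sinkElement_of_mem ha]; exact breakingElement_mem_component ha.1
  · rw [sinkElement_of_notMem ha]; exact zero_mem _

theorem vertex_mul_sinkElement (a : V) :
    gen K (vertex a) * sinkElement K H S a = sinkElement K H S a := by
  by_cases ha : a ∈ breaking H \ S
  · rw [sinkElement_of_mem ha, vertex_mul_breakingElement ha.1]
  · rw [sinkElement_of_notMem ha, mul_zero]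

theorem sinkElement_mul_vertex (a : V) :
    sinkElement K H S a * gen K (vertex a) = sinkElement K H S a := by
  by_cases ha : a ∈ breaking H \ S
  · rw [sinkElement_of_mem ha, breakingElement_mul_vertex ha.1]
  · rw [sinkElement_of_notMem ha, zero_mul]

theorem sinkElement_mul_self (a : V) :
    sinkElement K H S a * sinkElement K H S a = sinkElement K H S a := by
  by_cases ha : a ∈ breaking H \ S
  · rw [sinkElement_of_mem ha, breakingElement_mul_self ha.1]
  · rw [sinkElement_of_notMem ha, zero_mul]

theorem sinkElement_mul_edge {e : Quiver.Total V} (he : e.right ∉ H) :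
    sinkElement K H S e.left * gen K (edge e) = 0 := by
  by_cases ha : e.left ∈ breaking H \ S
  · rw [sinkElement_of_mem ha]
    exact breakingElement_mul_edge ha.1 ⟨⟨e.right, e.hom⟩, he⟩
  · rw [sinkElement_of_notMem ha, zero_mul]

theorem ghost_mul_sinkElement {e : Quiver.Total V} (he : e.right ∉ H) :
    gen K (ghost e) * sinkElement K H S e.left = 0 := by
  by_cases ha : e.left ∈ breaking H \ S
  · rw [sinkElement_of_mem ha]
    exact ghost_mul_breakingElement ha.1 ⟨⟨e.right, e.hom⟩, he⟩
  · rw [sinkElement_of_notMem ha, mul_zero]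

open LeavittQuotient

variable (K H S) in
/-- The quotient map modulo `I(H, S)`. -/
abbrev toQuotient : LeavittPathAlgebra K V →ₙ+* LeavittQuotient (admissibleIdeal K H S) := mk _

theorem toQuotient_vertex (ha : a ∈ H) : toQuotient K H S (gen K (vertex a)) = 0 :=
  mk_eq_zero_iff.2 (TwoSidedIdeal.subset_span (Or.inl ⟨a, ha, rfl⟩))

theorem toQuotient_edge {e : Quiver.Total V} (he : e.right ∈ H) :
    toQuotient K H S (gen K (edge e)) = 0 := by
  rw [← edge_mul_vertex, map_mul, toQuotient_vertex he, mul_zero]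

theorem toQuotient_breakingElement (ha : a ∈ breaking H) :
    toQuotient K H S (breakingElement K H a) = toQuotient K H S (sinkElement K H S a) := by
  by_cases haS : a ∈ S
  · rw [sinkElement_of_notMem fun h => h.2 haS, map_zero]
    exact mk_eq_zero_iff.2 (TwoSidedIdeal.subset_span (Or.inr ⟨a, haS, rfl⟩))
  · rw [sinkElement_of_mem ⟨ha, haS⟩]

theorem toQuotient_vertex_sub_sinkElement [Fintype (StarOff H a)] [Nonempty (StarOff H a)]
    (ha : a ∉ H) : toQuotient K H S (gen K (vertex a) - sinkElement K H S a) =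
      toQuotient K H S (∑ e : StarOff H a, gen K (edge e.edge) * gen K (ghost e.edge)) := by
  by_cases hfin : Finite (Quiver.Star a)
  · have hb : a ∉ breaking H \ S := fun h => not_finite_iff_infinite.2 h.1.2.1 hfin
    cases nonempty_fintype (Quiver.Star a)
    obtain ⟨e⟩ := ‹Nonempty (StarOff H a)›
    have hck : _ = gen K (vertex a) := (leavittFamily K V).finsum_s_mul_t a ⟨⟨e.1⟩, hfin⟩
    rw [sinkElement_of_notMem hb, sub_zero, ← hck, finsum_eq_sum_of_fintype, map_sum, map_sum]
    symm
    refine Fintype.sum_of_injective (fun e : StarOff H a => e.1) Subtype.val_injective _ _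
      (fun e he => ?_) fun e => rfl
    have heH : e.1 ∈ H := by_contra fun h => he ⟨⟨e, h⟩, rfl⟩
    rw [map_mul]
    exact (congrArg (· * _) (toQuotient_edge heH)).trans (zero_mul _)
  · have hb : a ∈ breaking H := ⟨ha, not_finite_iff_infinite.1 hfin, ‹_›, inferInstance⟩
    rw [map_sub, ← toQuotient_breakingElement hb, ← map_sub, vertex_sub_breakingElement]

end BreakingElement

section QuotientGraph

variable {V : Type u} [Quiver.{v} V] {H S : Set V}

namespace QuotientGraph

/-- The vertex of `E` below a vertex of the quotient graph. -/
def base : QuotientGraph H S → V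
  | Sum.inl a => a
  | Sum.inr a => a

/-- The vertex of the quotient graph given by a vertex outside `H`. -/
abbrev old (a : V) (ha : a ∉ H) : QuotientGraph H S := Sum.inl ⟨a, ha⟩

/-- The new vertex `a'` of the quotient graph given by a vertex `a ∈ B_H \ S`. -/
abbrev new (a : V) (ha : a ∈ breaking H \ S) : QuotientGraph H S := Sum.inr ⟨a, ha⟩

theorem base_notMem (x : QuotientGraph H S) : x.base ∉ H := by
  rcases x with a | a
  exacts [a.2, a.2.1.1]

/-- The edge of `E` below an edge of the quotient graph, with the given endpoints. -/
def baseHom : ∀ {x y : QuotientGraph H S}, (x ⟶ y) → (x.base ⟶ y.base)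
  | Sum.inl _, Sum.inl _, e => e
  | Sum.inl _, Sum.inr _, e => e
  | Sum.inr _, _, e => e.elim

/-- The edge of `E` below an edge of the quotient graph. -/
abbrev baseEdge (e : Quiver.Total (QuotientGraph H S)) : Quiver.Total V :=
  ⟨e.left.base, e.right.base, baseHom e.hom⟩

theorem left_eq_old (e : Quiver.Total (QuotientGraph H S)) :
    e.left = old e.left.base e.left.base_notMem := by
  obtain ⟨x | x, y, e⟩ := e
  · rfl
  · exact e.elim

theorem eq_of_baseEdge_eq {e f : Quiver.Total (QuotientGraph H S)}
    (h : baseEdge e = baseEdge f) (h' : e.right = f.right) : e = f := by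
  obtain ⟨⟨a, ha⟩ | x, y, e⟩ := e
  · obtain ⟨⟨b, hb⟩ | x', y', f⟩ := f
    · obtain rfl : y = y' := h'
      rcases y with ⟨c, hc⟩ | ⟨c, hc⟩ <;> cases h <;> rfl
    · exact f.elim
  · exact e.elim

theorem exists_baseEdge_eq (hH : IsHereditary H) {e : Quiver.Total V} {x : QuotientGraph H S}
    (hx : x.base = e.right) : ∃ f, baseEdge f = e ∧ f.right = x := by
  obtain ⟨a, b, e⟩ := e
  obtain rfl : x.base = b := hx
  have ha : a ∉ H := hH.left_notMem (e := ⟨a, x.base, e⟩) x.base_notMem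
  obtain x | x := x
  · exact ⟨⟨old a ha, Sum.inl x, e⟩, rfl, rfl⟩
  · exact ⟨⟨old a ha, Sum.inr x, e⟩, rfl, rfl⟩

variable (S) in
/-- The edges of the quotient graph which start at an old vertex `a`: the edges of `E` from `a` to a
vertex outside `H`, and a copy of each of those which end in `B_H \ S`. -/
def starEquiv (a : V) (ha : a ∉ H) : Quiver.Star (old (S := S) a ha) ≃
    StarOff H a ⊕ {e : StarOff H a // e.1.1 ∈ breaking H \ S} where
  toFun
    | ⟨Sum.inl b, e⟩ => Sum.inl ⟨⟨b, e⟩, b.2⟩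
    | ⟨Sum.inr b, e⟩ => Sum.inr ⟨⟨⟨b, e⟩, b.2.1.1⟩, b.2⟩
  invFun
    | Sum.inl e => ⟨Sum.inl ⟨e.1.1, e.2⟩, e.1.2⟩
    | Sum.inr e => ⟨Sum.inr ⟨e.1.1.1, e.2⟩, e.1.1.2⟩
  left_inv := by rintro ⟨b | b, e⟩ <;> rfl
  right_inv := by rintro (e | e) <;> rfl

theorem nonempty_starOff {a : V} {ha : a ∉ H} (h : Nonempty (Quiver.Star (old (S := S) a ha))) :
    Nonempty (StarOff H a) :=
  h.map fun e => (starEquiv S a ha e).elim id Subtype.val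

theorem finite_starOff {a : V} {ha : a ∉ H} [Finite (Quiver.Star (old (S := S) a ha))] :
    Finite (StarOff H a) :=
  .of_injective _ ((starEquiv S a ha).symm.injective.comp Sum.inl_injective)

end QuotientGraph

variable {K : Type w} [Field K]

open Gen QuotientGraph

/-- The homogeneous element of the Leavitt path algebra of `E` given by a vertex of the quotient
graph. Where `a ∈ B_H \ S`, the vertex `a` of `E` is the sum of the elements given by the vertices
`a` and `a'` of the quotient graph. -/
def quotientVertex (K : Type w) [Field K] : QuotientGraph H S → LeavittPathAlgebra K V
  | Sum.inl a => gen K (vertex a.1) - sinkElement K H S a.1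
  | Sum.inr a => sinkElement K H S a.1

theorem quotientVertex_mem_component (x : QuotientGraph H S) :
    quotientVertex K x ∈ component K V 0 := by
  rcases x with a | a
  · exact Submodule.sub_mem _ (vertex_mem_component K _) (sinkElement_mem_component _)
  · exact sinkElement_mem_component _

theorem vertex_mul_quotientVertex (x : QuotientGraph H S) :
    gen K (vertex x.base) * quotientVertex K x = quotientVertex K x := by
  rcases x with a | a
  · rw [quotientVertex, base, mul_sub, vertex_mul_vertex, vertex_mul_sinkElement]
  · exact vertex_mul_sinkElement _

theorem quotientVertex_mul_vertex (x : QuotientGraph H S) :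
    quotientVertex K x * gen K (vertex x.base) = quotientVertex K x := by
  rcases x with a | a
  · rw [quotientVertex, base, sub_mul, vertex_mul_vertex, sinkElement_mul_vertex]
  · exact sinkElement_mul_vertex _

theorem quotientVertex_mul_self (x : QuotientGraph H S) :
    quotientVertex K x * quotientVertex K x = quotientVertex K x := by
  rcases x with a | a
  · rw [quotientVertex, mul_sub, sub_mul, sub_mul, vertex_mul_vertex, sinkElement_mul_vertex,
      vertex_mul_sinkElement, sinkElement_mul_self, sub_self, sub_zero]
  · exact sinkElement_mul_self _

theorem quotientVertex_mul_quotientVertex_of_ne {x y : QuotientGraph H S} (h : x ≠ y) :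
    quotientVertex K x * quotientVertex K y = 0 := by
  by_cases hb : x.base = y.base
  · obtain ⟨a, ha⟩ | ⟨a, ha⟩ := x <;> obtain ⟨b, hb'⟩ | ⟨b, hb'⟩ := y <;>
      obtain rfl : a = b := hb
    · exact (h rfl).elim
    · rw [quotientVertex, quotientVertex, sub_mul, vertex_mul_sinkElement, sinkElement_mul_self,
        sub_self]
    · rw [quotientVertex, quotientVertex, mul_sub, sinkElement_mul_vertex, sinkElement_mul_self,
        sub_self]
    · exact (h rfl).elim
  · rw [← quotientVertex_mul_vertex, ← vertex_mul_quotientVertex y, mul_assoc,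
      ← mul_assoc (gen K _), vertex_mul_vertex_of_ne K hb, zero_mul, mul_zero]

theorem quotientVertex_left (e : Quiver.Total (QuotientGraph H S)) : quotientVertex K e.left =
    gen K (vertex (baseEdge e).left) - sinkElement K H S (baseEdge e).left := by
  rw [left_eq_old e]
  rfl

theorem quotientVertex_mul_edge (e : Quiver.Total (QuotientGraph H S)) :
    quotientVertex K e.left * gen K (edge (baseEdge e)) = gen K (edge (baseEdge e)) := by
  rw [quotientVertex_left, sub_mul, vertex_mul_edge, sinkElement_mul_edge e.right.base_notMem,
    sub_zero]

theorem ghost_mul_quotientVertex (e : Quiver.Total (QuotientGraph H S)) :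
    gen K (ghost (baseEdge e)) * quotientVertex K e.left = gen K (ghost (baseEdge e)) := by
  rw [quotientVertex_left, mul_sub, ghost_mul_vertex, ghost_mul_sinkElement e.right.base_notMem,
    sub_zero]

theorem toQuotient_mul_vertex_mul_mem {a : V}
    {M : AddSubmonoid (LeavittQuotient (admissibleIdeal K H S))} {c d : LeavittPathAlgebra K V}
    (hM : ∀ x : QuotientGraph H S, x.base = a →
      toQuotient K H S (c * quotientVertex K x * d) ∈ M) :
    toQuotient K H S (c * gen K (vertex a) * d) ∈ M := by
  by_cases ha : a ∈ H
  · rw [map_mul, map_mul, toQuotient_vertex ha, mul_zero, zero_mul]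
    exact zero_mem _
  · have hold := hM (old a ha) rfl
    by_cases hb : a ∈ breaking H \ S
    · have hadd := add_mem hold (hM (new a hb) rfl)
      rwa [← map_add, ← add_mul, ← mul_add, quotientVertex, quotientVertex, sub_add_cancel] at hadd
    · rwa [quotientVertex, sinkElement_of_notMem hb, sub_zero] at hold

/-- The terms `e (a - a^H) e*` and `e' a^H (e')*`, with `e'` the copy of an edge `e` which ends in
`a ∈ B_H \ S`, add up to `e e*`. -/
theorem sum_edge_mul_quotientVertex_mul_ghost {a : V} (ha : a ∉ H) [Fintype (StarOff H a)]
    [Fintype (Quiver.Star (old (S := S) a ha))] :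
    ∑ e : Quiver.Star (old (S := S) a ha), gen K (edge (baseEdge ⟨_, e.1, e.2⟩)) *
        quotientVertex K e.1 * gen K (ghost (baseEdge ⟨_, e.1, e.2⟩)) =
      ∑ e : StarOff H a, gen K (edge e.edge) * gen K (ghost e.edge) := by
  classical
  have hsink : ∑ e : {e : StarOff H a // e.1.1 ∈ breaking H \ S}, gen K (edge e.1.edge) *
        sinkElement K H S e.1.1.1 * gen K (ghost e.1.edge) =
      ∑ e : StarOff H a, gen K (edge e.edge) * sinkElement K H S e.1.1 * gen K (ghost e.edge) := by
    refine Fintype.sum_of_injective _ Subtype.val_injective _ _ (fun e he => ?_) fun e => rfl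
    rw [sinkElement_of_notMem fun h => he ⟨⟨e, h⟩, rfl⟩, mul_zero, zero_mul]
  rw [← (starEquiv S a ha).symm.sum_comp, Fintype.sum_sum_type]
  refine (congrArg _ hsink).trans ?_
  rw [← Finset.sum_add_distrib]
  refine Finset.sum_congr rfl fun e _ => ?_
  change gen K (edge e.edge) * (gen K (vertex e.1.1) - sinkElement K H S e.1.1) *
    gen K (ghost e.edge) + gen K (edge e.edge) * sinkElement K H S e.1.1 * gen K (ghost e.edge) = _
  rw [← add_mul, ← mul_add, sub_add_cancel, edge_mul_vertex K e.edge]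

theorem toQuotient_finsum_edge_mul_ghost {a : V} {ha : a ∉ H}
    (hreg : IsRegular (old (S := S) a ha)) :
    ∑ᶠ e : Quiver.Star (old (S := S) a ha),
      toQuotient K H S (gen K (edge (baseEdge ⟨_, e.1, e.2⟩)) * quotientVertex K e.1) *
        toQuotient K H S (quotientVertex K e.1 * gen K (ghost (baseEdge ⟨_, e.1, e.2⟩))) =
      toQuotient K H S (quotientVertex K (old (S := S) a ha)) := by
  have := nonempty_starOff hreg.1
  have := hreg.2
  have := finite_starOff (S := S) (ha := ha)
  cases nonempty_fintype (StarOff H a)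
  cases nonempty_fintype (Quiver.Star (old (S := S) a ha))
  rw [quotientVertex, toQuotient_vertex_sub_sinkElement ha,
    ← sum_edge_mul_quotientVertex_mul_ghost (S := S) ha, map_sum, finsum_eq_sum_of_fintype]
  refine Finset.sum_congr rfl fun e _ => ?_
  rw [← map_mul, mul_assoc, ← mul_assoc (quotientVertex K e.1), quotientVertex_mul_self,
    ← mul_assoc]

end QuotientGraph

section QuotientFamily

variable (K : Type w) [Field K] {V : Type u} [Quiver.{v} V] {H S : Set V}

open Gen QuotientGraph LeavittQuotient

section Mem

variable {K} {M : AddSubmonoid (LeavittQuotient (admissibleIdeal K H S))}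

theorem toQuotient_vertex_mem
    (hM : ∀ x : QuotientGraph H S, toQuotient K H S (quotientVertex K x) ∈ M) (a : V) :
    toQuotient K H S (gen K (vertex a)) ∈ M := by
  suffices toQuotient K H S (gen K (vertex a) * gen K (vertex a) * gen K (vertex a)) ∈ M by
    rwa [vertex_mul_vertex, vertex_mul_vertex] at this
  refine toQuotient_mul_vertex_mul_mem fun x hx => ?_
  rw [← hx, vertex_mul_quotientVertex, quotientVertex_mul_vertex]
  exact hM x

theorem toQuotient_edge_mem (hH : IsHereditary H)
    (hM : ∀ e : Quiver.Total (QuotientGraph H S),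
      toQuotient K H S (gen K (edge (baseEdge e)) * quotientVertex K e.right) ∈ M)
    (e : Quiver.Total V) : toQuotient K H S (gen K (edge e)) ∈ M := by
  rw [← edge_mul_vertex, ← edge_mul_vertex]
  refine toQuotient_mul_vertex_mul_mem fun x hx => ?_
  obtain ⟨f, hf, rfl⟩ := exists_baseEdge_eq hH hx
  rw [← hx, mul_assoc, quotientVertex_mul_vertex, ← hf]
  exact hM f

theorem toQuotient_ghost_mem (hH : IsHereditary H)
    (hM : ∀ e : Quiver.Total (QuotientGraph H S),
      toQuotient K H S (quotientVertex K e.right * gen K (ghost (baseEdge e))) ∈ M)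
    (e : Quiver.Total V) : toQuotient K H S (gen K (ghost e)) ∈ M := by
  rw [← vertex_mul_ghost, ← vertex_mul_ghost, ← mul_assoc]
  refine toQuotient_mul_vertex_mul_mem fun x hx => ?_
  obtain ⟨f, hf, rfl⟩ := exists_baseEdge_eq hH hx
  rw [← hx, vertex_mul_quotientVertex, ← hf]
  exact hM f

end Mem

theorem adjoin_toQuotient_eq_top (hH : IsHereditary H) :
    NonUnitalAlgebra.adjoin K
      (Set.range (fun x : QuotientGraph H S => toQuotient K H S (quotientVertex K x)) ∪
        Set.range (fun e : Quiver.Total (QuotientGraph H S) =>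
          toQuotient K H S (gen K (edge (baseEdge e)) * quotientVertex K e.right)) ∪
        Set.range fun e : Quiver.Total (QuotientGraph H S) =>
          toQuotient K H S (quotientVertex K e.right * gen K (ghost (baseEdge e)))) = ⊤ := by
  set N := NonUnitalAlgebra.adjoin K (_ : Set (LeavittQuotient (admissibleIdeal K H S)))
  rw [eq_top_iff]
  intro x _
  obtain ⟨x, rfl⟩ := mk_surjective _ x
  have hx : x ∈ NonUnitalAlgebra.adjoin K (Set.range (gen K : Gen V → _)) := by
    rw [adjoin_gen_eq_top]; exact trivial
  induction hx using NonUnitalAlgebra.adjoin_induction with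
  | mem x hx =>
    obtain ⟨a | e | e, rfl⟩ := hx
    · exact toQuotient_vertex_mem (M := N.toAddSubmonoid)
        (fun x => NonUnitalAlgebra.subset_adjoin K (Or.inl (Or.inl ⟨x, rfl⟩))) a
    · exact toQuotient_edge_mem hH (M := N.toAddSubmonoid)
        (fun e => NonUnitalAlgebra.subset_adjoin K (Or.inl (Or.inr ⟨e, rfl⟩))) e
    · exact toQuotient_ghost_mem hH (M := N.toAddSubmonoid)
        (fun e => NonUnitalAlgebra.subset_adjoin K (Or.inr ⟨e, rfl⟩)) e
  | zero => rw [map_zero]; exact zero_mem _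
  | add x y _ _ hx hy => rw [map_add]; exact add_mem (hx trivial) (hy trivial)
  | mul x y _ _ hx hy => rw [map_mul]; exact mul_mem (hx trivial) (hy trivial)
  | smul k x _ hx => rw [mk_smul]; exact SMulMemClass.smul_mem k (hx trivial)

/-- The quotient of the Leavitt path algebra of `E` by `I(H, S)` is generated by a family indexed
by the quotient graph `E \ (H, S)`. -/
def quotientFamily (h : IsAdmissible H S) :
    CKFamily K (QuotientGraph H S) (LeavittQuotient (admissibleIdeal K H S)) where
  p x := toQuotient K H S (quotientVertex K x)
  s e := toQuotient K H S (gen K (edge (baseEdge e)) * quotientVertex K e.right)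
  t e := toQuotient K H S (quotientVertex K e.right * gen K (ghost (baseEdge e)))
  p_mul_self x := by rw [← map_mul, quotientVertex_mul_self]
  p_mul_p_of_ne x y hxy := by
    rw [← map_mul, quotientVertex_mul_quotientVertex_of_ne hxy, map_zero]
  p_mul_s e := by rw [← map_mul, ← mul_assoc, quotientVertex_mul_edge]
  s_mul_p e := by rw [← map_mul, mul_assoc, quotientVertex_mul_self]
  p_mul_t e := by rw [← map_mul, ← mul_assoc, quotientVertex_mul_self]
  t_mul_p e := by rw [← map_mul, mul_assoc, ghost_mul_quotientVertex]
  t_mul_s_self e := by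
    rw [← map_mul, mul_assoc, ← mul_assoc (gen K (ghost _)), ghost_mul_edge,
      vertex_mul_quotientVertex, quotientVertex_mul_self]
  t_mul_s_of_ne e f hef := by
    rw [← map_mul, mul_assoc, ← mul_assoc (gen K (ghost _))]
    by_cases hb : baseEdge e = baseEdge f
    · rw [← hb, ghost_mul_edge, ← mul_assoc, quotientVertex_mul_vertex,
        quotientVertex_mul_quotientVertex_of_ne fun h' => hef (eq_of_baseEdge_eq hb h'), map_zero]
    · rw [ghost_mul_edge_of_ne K hb, zero_mul, mul_zero, map_zero]
  finsum_s_mul_t x hx := by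
    obtain ⟨a, ha⟩ | x := x
    · exact toQuotient_finsum_edge_mul_ghost hx
    · obtain ⟨e⟩ := hx.1
      exact e.2.elim
  adjoin_eq_top := adjoin_toQuotient_eq_top K h.1

variable {K}

theorem exists_gen_mem_of_quotientVertex_mem {J : TwoSidedIdeal (LeavittPathAlgebra K V)}
    {x : QuotientGraph H S} (hx : quotientVertex K x ∈ J) :
    (∃ a ∉ H, gen K (vertex a) ∈ J) ∨ ∃ a ∈ breaking H \ S, breakingElement K H a ∈ J := by
  obtain ⟨a, ha⟩ | ⟨a, ha⟩ := x
  · rw [quotientVertex] at hx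
    by_cases hb : a ∈ breaking H \ S
    · rw [sinkElement_of_mem hb] at hx
      obtain ⟨e⟩ := hb.1.2.2.1
      exact Or.inl ⟨_, e.2, vertex_mem_of_vertex_sub_breakingElement_mem hb.1 hx e⟩
    · rw [sinkElement_of_notMem hb, sub_zero] at hx
      exact Or.inl ⟨a, ha, hx⟩
  · rw [quotientVertex, sinkElement_of_mem ha] at hx
    exact Or.inr ⟨a, ha, hx⟩

theorem quotientFamily_p_ne_zero (h : IsAdmissible H S) (x : QuotientGraph H S) :
    (quotientFamily K h).p x ≠ 0 := by
  intro h0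
  rcases exists_gen_mem_of_quotientVertex_mem (mk_eq_zero_iff.1 h0) with
    ⟨a, ha, hmem⟩ | ⟨a, ha, hmem⟩
  exacts [vertex_notMem_admissibleIdeal K h ha hmem,
    breakingElement_notMem_admissibleIdeal K h ha hmem]

theorem toQuotient_real_mem_deg (h : IsAdmissible H S) (l : List (Quiver.Total V)) (a : V) :
    toQuotient K H S ((leavittFamily K V).real l a) ∈ (quotientFamily K h).deg l.length := by
  induction l with
  | nil =>
    exact toQuotient_vertex_mem (M := ((quotientFamily K h).deg 0).toAddSubmonoid)
      (quotientFamily K h).p_mem_deg a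
  | cons e l ih =>
    rw [CKFamily.real_cons, map_mul, List.length_cons, Nat.cast_succ, add_comm]
    exact (quotientFamily K h).mul_mem_deg (toQuotient_edge_mem h.1
      (M := ((quotientFamily K h).deg 1).toAddSubmonoid) (quotientFamily K h).s_mem_deg e) ih

theorem toQuotient_ghost_mem_deg (h : IsAdmissible H S) (l : List (Quiver.Total V)) (a : V) :
    toQuotient K H S ((leavittFamily K V).ghost l a) ∈ (quotientFamily K h).deg (-l.length) := by
  induction l with
  | nil =>
    exact toQuotient_vertex_mem (M := ((quotientFamily K h).deg 0).toAddSubmonoid)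
      (quotientFamily K h).p_mem_deg a
  | cons e l ih =>
    rw [CKFamily.ghost_cons, map_mul, List.length_cons, Nat.cast_succ, neg_add]
    exact (quotientFamily K h).mul_mem_deg ih (toQuotient_ghost_mem h.1
      (M := ((quotientFamily K h).deg (-1)).toAddSubmonoid) (quotientFamily K h).t_mem_deg e)

theorem toQuotient_mem_deg (h : IsAdmissible H S) {n : ℤ} {x : LeavittPathAlgebra K V}
    (hx : x ∈ component K V n) : toQuotient K H S x ∈ (quotientFamily K h).deg n := by
  rw [component_eq_deg] at hx
  induction hx using Submodule.span_induction with
  | mem x hx =>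
    obtain ⟨a, b, c, α, β, -, -, rfl, rfl⟩ := hx
    rw [map_mul, sub_eq_add_neg]
    exact CKFamily.mul_mem_deg _ (toQuotient_real_mem_deg h α c) (toQuotient_ghost_mem_deg h β c)
  | zero => rw [map_zero]; exact zero_mem _
  | add x y _ _ hx hy => rw [map_add]; exact add_mem hx hy
  | smul k x _ hx => rw [mk_smul]; exact Submodule.smul_mem _ k hx

theorem exists_toQuotient_eq_real (h : IsAdmissible H S)
    (l : List (Quiver.Total (QuotientGraph H S))) (b : QuotientGraph H S) :
    ∃ x ∈ component K V l.length, toQuotient K H S x = (quotientFamily K h).real l b := by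
  induction l with
  | nil => exact ⟨quotientVertex K b, quotientVertex_mem_component b, rfl⟩
  | cons e l ih =>
    obtain ⟨x, hx, hxl⟩ := ih
    refine ⟨gen K (edge (baseEdge e)) * quotientVertex K e.right * x, ?_, ?_⟩
    · have hmem := mul_mem_component (mul_mem_component (edge_mem_component K (baseEdge e))
        (quotientVertex_mem_component e.right)) hx
      rwa [add_zero, add_comm, ← Nat.cast_succ] at hmem
    · rw [map_mul, hxl]
      rfl

end QuotientFamily

section StronglyPrimitive

variable {K : Type w} [Field K] {V : Type u} [Quiver.{v} V] {H S : Set V}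

open Gen LeavittQuotient

theorem isGraded_gradedPart (P : TwoSidedIdeal (LeavittPathAlgebra K V)) :
    IsGraded (gradedPart P) :=
  isGraded_iff_gradedPart_eq.2 <| le_antisymm (gradedPart_le _) <|
    TwoSidedIdeal.span_le.2 fun _ hx =>
      TwoSidedIdeal.subset_span ⟨TwoSidedIdeal.subset_span hx, hx.2⟩

theorem mem_gradedPart_of_mem_component {P : TwoSidedIdeal (LeavittPathAlgebra K V)}
    {x : LeavittPathAlgebra K V} (hx : x ∈ P) {n : ℤ} (hn : x ∈ component K V n) :
    x ∈ gradedPart P :=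
  TwoSidedIdeal.subset_span ⟨hx, n, hn⟩

theorem exists_quotientVertex_mem_of_mem_component (h : IsAdmissible H S)
    {P : TwoSidedIdeal (LeavittPathAlgebra K V)} (hIP : admissibleIdeal K H S ≤ P)
    {x : LeavittPathAlgebra K V} (hx : x ∈ P) {n : ℤ} (hn : x ∈ component K V n)
    (hxI : x ∉ admissibleIdeal K H S) :
    ∃ a : QuotientGraph H S, quotientVertex K a ∈ P := by
  obtain ⟨J, rfl⟩ := exists_comap_eq (mk_surjective (admissibleIdeal K H S))
    fun x hx => hIP (mk_eq_zero_iff.1 hx)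
  obtain ⟨a, ha⟩ := CKFamily.exists_reduces_p_of_mem_deg _ (quotientFamily_p_ne_zero h)
    (toQuotient_mem_deg h hn) (mt mk_eq_zero_iff.1 hxI)
  exact ⟨a, (TwoSidedIdeal.mem_comap _).2 (ha.mem ((TwoSidedIdeal.mem_comap _).1 hx))⟩

theorem exists_gradedPart_eq_admissibleIdeal (P : TwoSidedIdeal (LeavittPathAlgebra K V)) :
    ∃ H S : Set V, IsAdmissible H S ∧ gradedPart P = admissibleIdeal K H S := by
  set H : Set V := {a | gen K (vertex a) ∈ P}
  set S : Set V := {a | a ∈ breaking H ∧ breakingElement K H a ∈ P}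
  have h : IsAdmissible H S := ⟨(leavittFamily K V).isHereditary_vertices P,
    (leavittFamily K V).isSaturated_vertices P, fun a ha => ha.1⟩
  have hle : admissibleIdeal K H S ≤ gradedPart P := by
    rw [admissibleIdeal, TwoSidedIdeal.span_le]
    rintro _ (⟨a, ha, rfl⟩ | ⟨a, ha, rfl⟩)
    · exact mem_gradedPart_of_mem_component ha (vertex_mem_component K a)
    · exact mem_gradedPart_of_mem_component ha.2 (breakingElement_mem_component ha.1)
  refine ⟨H, S, h, le_antisymm (TwoSidedIdeal.span_le.2 ?_) hle⟩
  rintro x ⟨hxP, n, hn⟩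
  by_contra hx
  obtain ⟨a, ha⟩ :=
    exists_quotientVertex_mem_of_mem_component h (hle.trans (gradedPart_le P)) hxP hn hx
  rcases exists_gen_mem_of_quotientVertex_mem ha with ⟨b, hb, hbP⟩ | ⟨b, hb, hbP⟩
  exacts [hb hbP, hb.2 ⟨hb.1, hbP⟩]

theorem exists_comap_mk_eq {P : TwoSidedIdeal (LeavittPathAlgebra K V)}
    (hgr : gradedPart P = admissibleIdeal K H S) :
    ∃ J : TwoSidedIdeal (LeavittQuotient (admissibleIdeal K H S)), J.comap (mk _) = P :=
  exists_comap_eq (mk_surjective _) fun _ hx =>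
    gradedPart_le P (hgr ▸ mk_eq_zero_iff.1 hx)

section Comap

variable {J : TwoSidedIdeal (LeavittQuotient (admissibleIdeal K H S))}
  (hgr : gradedPart (J.comap (mk _)) = admissibleIdeal K H S)
include hgr

theorem quotientFamily_p_notMem (h : IsAdmissible H S) (a : QuotientGraph H S) :
    (quotientFamily K h).p a ∉ J := fun ha =>
  quotientFamily_p_ne_zero h a <| mk_eq_zero_iff.2 <| hgr ▸
    mem_gradedPart_of_mem_component ((TwoSidedIdeal.mem_comap _).2 ha)
      (quotientVertex_mem_component a)

theorem isGraded_comap_mk_iff : IsGraded (J.comap (mk _)) ↔ J = ⊥ := by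
  rw [isGraded_iff_gradedPart_eq, hgr]
  have hbot : admissibleIdeal K H S = (⊥ : TwoSidedIdeal (LeavittQuotient _)).comap (mk _) :=
    TwoSidedIdeal.ext fun x => by
      rw [TwoSidedIdeal.mem_comap, TwoSidedIdeal.mem_bot, mk_eq_zero_iff]
  conv_lhs => lhs; rw [hbot]
  rw [(comap_injective (mk_surjective _)).eq_iff, eq_comm]

end Comap

open Polynomial in
/-- The powers of a loop have distinct degrees, so no polynomial relation between them holds modulo
a graded ideal. -/
theorem polyEval_injective (h : IsAdmissible H S) (hI : IsGraded (admissibleIdeal K H S))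
    {a : QuotientGraph H S} {l : List (Quiver.Total (QuotientGraph H S))}
    (hl : IsLoop a l) : Function.Injective ((quotientFamily K h).polyEval a l) := by
  rw [injective_iff_map_eq_zero]
  intro f hf
  have exists_lift : ∀ n, ∃ x ∈ component K V ((n * l.length : ℕ) : ℤ),
      toQuotient K H S x = (quotientFamily K h).real (listPow l n) a := fun n => by
    simpa [listPow] using exists_toQuotient_eq_real h (listPow l n) a
  choose x hx hxr using exists_lift
  have hd : Function.Injective fun n : ℕ => ((n * l.length : ℕ) : ℤ) := fun m n hmn =>
    Nat.eq_of_mul_eq_mul_right (List.length_pos_iff.2 hl.ne_nil) (Nat.cast_injective hmn)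
  have hsum : ∑ n ∈ f.support, f.coeff n • x n ∈ admissibleIdeal K H S := by
    rw [← mk_eq_zero_iff, ← hf, map_sum]
    conv_rhs => rw [f.as_sum_support, map_sum]
    refine Finset.sum_congr rfl fun n _ => ?_
    rw [CKFamily.polyEval_monomial, ← hxr, mk_smul]
  by_contra hf0
  obtain ⟨n, hn⟩ := support_nonempty.2 hf0
  have hmem : f.coeff n • x n ∈ admissibleIdeal K H S :=
    hI.mem_of_sum_mem hd (fun n => Submodule.smul_mem _ _ (hx n)) hsum hn
  have hreal : (quotientFamily K h).real (listPow l n) a = 0 := by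
    rw [← mk_eq_zero_iff, mk_smul] at hmem
    exact (hxr n).symm.trans ((smul_eq_zero.1 hmem).resolve_left (mem_support_iff.1 hn))
  have hp := (quotientFamily K h).ghost_mul_real_self (hl.isWalk.listPow n)
  rw [hreal, mul_zero] at hp
  exact quotientFamily_p_ne_zero h a hp.symm

variable {P : TwoSidedIdeal (LeavittPathAlgebra K V)}

theorem IsStronglyPrimitive.isCompletelyIrreducible (hsp : IsStronglyPrimitive P)
    (hP : IsPrimeIdeal P) : IsCompletelyIrreducible P := by
  obtain ⟨H, S, h, hgr, hdd, hcsp, hL⟩ := hsp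
  obtain ⟨J, rfl⟩ := exists_comap_mk_eq hgr
  rw [isPrimeIdeal_comap_iff (mk_surjective _)] at hP
  rw [isCompletelyIrreducible_comap_iff (mk_surjective _)]
  exact CKFamily.isCompletelyIrreducible_of_strongCSP (quotientFamily_p_ne_zero h) hP
    (quotientFamily_p_notMem hgr h) hdd.1 (fun hJ => hL ((isGraded_comap_mk_iff hgr).2 hJ)) hcsp

theorem IsLocallyClosed.isStronglyPrimitive (hlc : IsLocallyClosed P) (hP : IsPrimeIdeal P) :
    IsStronglyPrimitive P := by
  obtain ⟨H, S, h, hgr⟩ := exists_gradedPart_eq_admissibleIdeal P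
  obtain ⟨J, rfl⟩ := exists_comap_mk_eq hgr
  rw [isPrimeIdeal_comap_iff (mk_surjective _)] at hP
  rw [isLocallyClosed_comap_iff (mk_surjective _)] at hlc
  have hp := quotientFamily_p_ne_zero (K := K) h
  have hv := quotientFamily_p_notMem hgr h
  have hinj := fun a l => polyEval_injective h (hgr ▸ isGraded_gradedPart _) (a := a) (l := l)
  refine ⟨H, S, h, hgr, CKFamily.downwardDirected_of_isPrimeIdeal hP hv,
    CKFamily.strongCSP_of_isLocallyClosed hp hinj hP hv hlc, fun hgraded => ?_⟩
  obtain rfl := (isGraded_comap_mk_iff hgr).1 hgraded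
  exact CKFamily.conditionL_of_isLocallyClosed_bot hp hinj hP hlc

end StronglyPrimitive

end LPA

end

theorem mainTheorem1 {K : Type w} [Field K] {V : Type u} [Quiver.{v} V]
    (P : TwoSidedIdeal (LPA.LeavittPathAlgebra K V)) (hP : LPA.IsPrimeIdeal P) :
    List.TFAE
      [LPA.IsLocallyClosed P,
       LPA.IsCompletelyIrreducible P,
       ∃ a : LPA.LeavittPathAlgebra K V, Maximal (fun J : TwoSidedIdeal (LPA.LeavittPathAlgebra K V) => a ∉ J) P,
       LPA.IsStronglyPrimitive P] := by
  tfae_have 2 → 1 := fun h => h.isLocallyClosed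
  tfae_have 2 ↔ 3 := LPA.isCompletelyIrreducible_iff_exists_maximal
  tfae_have 1 → 4 := fun h => h.isStronglyPrimitive hP
  tfae_have 4 → 2 := fun h => h.isCompletelyIrreducible hP
  tfae_finish
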